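/- A finite automaton is $A=(\Sigma,Q,E,I,F)$ with finite alphabet $\Sigma$, finite state set $Q$, transitions $E\subseteq Q\times(\Sigma\cup\{\epsilon\})\times Q$, initial states $I$ and final states $F$. It is trim if every state lies on a path from $I$ to $F$, and $\epsilon$-cycle free if no nonempty cycle is labeled by the empty word. For $x\in\Sigma^*$ let $\mathrm{da}(A,x)$ be the number of paths from $I$ to $F$ labeled by $x$. $A$ is polynomially ambiguous if $\mathrm{da}(A,x)\le h(|x|)$ for all $x$ and some $h\in\mathbb N[X]$; the least degree of such an $h$ is the degree of polynomial ambiguity $\mathrm{dpa}(A)$. Theorem. (1) There is an algorithm (a program of a random-access machine with unit-cost instructions, whose words and addresses stay polynomially bounded in $|Q|+|\Sigma|+|E|$) that, given any trim, $\epsilon$-cycle-free, polynomially ambiguous finite automaton $A$ (its transitions listed in any order), computes $\mathrm{dpa}(A)$ in time $O(|E|^3)$, more precisely in at most $C(|E|^3+1)$ steps for a constant $C$ independent of $A$. (2) Let $A$ be a trim, $\epsilon$-cycle-free, polynomially ambiguous finite automaton with at least one state. Let $A^3=(A\cap A)\cap A$, where the intersection $A_1\cap A_2$ has states $(q_1,m,q_2)$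 with $m$ the state of the epsilon filter: a letter is read by both automata simultaneously and resets $m$ to the initial filter state; between letters, first some simultaneous $\epsilon$-moves are made (the filter staying in its initial state), and then only $\epsilon$-moves of one and the same automaton (the filter being in a state that records which one). Let $G$ be the graph whose vertices are the strongly connected components of $A$, with an edge between two distinct components for every transition of $A$ from a state of the first to a state of the second, and moreover with an edge marked $\#$ from the component of $p$ to the component of $q$ for every pair of states $p\ne q$ such that $A^3$ has a path with nonempty label from $(p,p,q)$ to $(p,q,q)$, both filters being in their initial state at both ends. Then $\mathrm{dpa}(A)$ is the maximum number of edges marked $\#$ on a path in $G$. -/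

import Mathlib

/-! ### Finite automata with ε-transitions: paths, ambiguity

A finite automaton over the alphabet `α` with state set `σ` is an `εNFA α σ` with `α` and `σ` finite;
`q ∈ M.step p (some a)` is a transition labelled by the letter `a`, and `q ∈ M.step p none`
is an ε-transition. -/

namespace εNFA

variable {α σ : Type*}

/-- The set `E` of transitions (origin, label, destination). -/
def transitions (M : εNFA α σ) : Set (σ × Option α × σ) :=
  {e | e.2.2 ∈ M.step e.1 e.2.1}

/-- `M.TransPath p π q`: the sequence of transitions `π` is a path from `p` to `q`. -/
inductive TransPath (M : εNFA α σ) : σ → List (σ × Option α × σ) → σ → Prop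
  | nil (p : σ) : TransPath M p [] p
  | cons {p q r : σ} {a : Option α} {π : List (σ × Option α × σ)} :
      q ∈ M.step p a → TransPath M q π r → TransPath M p ((p, a, q) :: π) r

/-- The label of a path: the word of its letters, the ε's being erased. -/
def pathLabel (π : List (σ × Option α × σ)) : List α :=
  π.filterMap fun e => e.2.1

/-- Some path leads from `p` to `q`. -/
def Reach (M : εNFA α σ) (p q : σ) : Prop :=
  ∃ π, M.TransPath p π q

/-- Every state lies on a path from an initial state to a final state. -/
def Trim (M : εNFA α σ) : Prop :=
  ∀ q, (∃ i ∈ M.start, M.Reach i q) ∧ (∃ f ∈ M.accept, M.Reach q f)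

/-- No nonempty cycle is labelled by the empty word. -/
def EpsCycleFree (M : εNFA α σ) : Prop :=
  ∀ p π, M.TransPath p π p → pathLabel π = [] → π = []

/-- The successful paths labelled by `x`. A path is given by its origin (needed for the empty
paths) and its sequence of transitions. -/
def successfulPaths (M : εNFA α σ) (x : List α) : Set (σ × List (σ × Option α × σ)) :=
  {π | π.1 ∈ M.start ∧ (∃ f ∈ M.accept, M.TransPath π.1 π.2 f) ∧ pathLabel π.2 = x}

/-- The degree of ambiguity of the word `x`. -/
noncomputable def da (M : εNFA α σ) (x : List α) : ℕ∞ :=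
  (M.successfulPaths x).encard

/-- The polynomial `h` bounds the ambiguity of every word in terms of its length. -/
def AmbiguityBound (M : εNFA α σ) (h : Polynomial ℕ) : Prop :=
  ∀ x : List α, M.da x ≤ (h.eval x.length : ℕ)

/-- `M` is polynomially ambiguous. -/
def PolyAmbiguous (M : εNFA α σ) : Prop :=
  ∃ h : Polynomial ℕ, M.AmbiguityBound h

/-- The degree of polynomial ambiguity: the least degree of a bounding polynomial, and `⊤` if
there is none. -/
noncomputable def dpa (M : εNFA α σ) : ℕ∞ :=
  ⨅ (h : Polynomial ℕ) (_ : M.AmbiguityBound h), (h.natDegree : ℕ∞)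

/-! ### Intersection with the epsilon filter, and the automaton `A³` -/

/-- The states of the epsilon filter: `init` (at the beginning, and after a letter or a
simultaneous ε-move of both automata), `left` (after an ε-move of the left automaton alone) and
`right` (after an ε-move of the right automaton alone). -/
inductive FilterState
  | init
  | left
  | right

/-- The intersection of two automata with epsilon filtering. Letters are read simultaneously.
Between two letters, the filter allows some simultaneous ε-moves and then only ε-moves of one and
the same automaton, so that matching paths are paired in exactly one way. -/
def inter {σ₁ σ₂ : Type*} (M₁ : εNFA α σ₁) (M₂ : εNFA α σ₂) :
    εNFA α (σ₁ × FilterState × σ₂) where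
  step s a := {s' | match a with
    | some a => s'.1 ∈ M₁.step s.1 (some a) ∧ s'.2.1 = .init ∧ s'.2.2 ∈ M₂.step s.2.2 (some a)
    | none =>
        (s.2.1 = .init ∧ s'.2.1 = .init ∧
          s'.1 ∈ M₁.step s.1 none ∧ s'.2.2 ∈ M₂.step s.2.2 none) ∨
        (s.2.1 ≠ .right ∧ s'.2.1 = .left ∧ s'.1 ∈ M₁.step s.1 none ∧ s'.2.2 = s.2.2) ∨
        (s.2.1 ≠ .left ∧ s'.2.1 = .right ∧ s'.1 = s.1 ∧ s'.2.2 ∈ M₂.step s.2.2 none)}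
  start := {s | s.1 ∈ M₁.start ∧ s.2.1 = .init ∧ s.2.2 ∈ M₂.start}
  accept := {s | s.1 ∈ M₁.accept ∧ s.2.2 ∈ M₂.accept}

/-- `A³ = (A ∩ A) ∩ A`. -/
def cube (M : εNFA α σ) : εNFA α ((σ × FilterState × σ) × FilterState × σ) :=
  inter (inter M M) M

/-- The state `(p, q, r)` of `A³`, both filters being in their initial state. -/
def cubeState (p q r : σ) : (σ × FilterState × σ) × FilterState × σ :=
  ((p, .init, q), .init, r)

/-- The pairs `p ≠ q` such that `A³` has a path from `(p, p, q)` to `(p, q, q)` with nonempty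
label. -/
def IDAPair (M : εNFA α σ) (p q : σ) : Prop :=
  p ≠ q ∧ ∃ π, M.cube.TransPath (cubeState p p q) π (cubeState p q q) ∧ pathLabel π ≠ []

/-! ### The component graph -/

theorem TransPath.append {M : εNFA α σ} {p q r : σ} {π π' : List (σ × Option α × σ)}
    (h : M.TransPath p π q) (h' : M.TransPath q π' r) : M.TransPath p (π ++ π') r := by
  induction h with
  | nil => exact h'
  | cons hs _ ih => exact .cons hs (ih h')

/-- Mutual reachability. -/
def sccSetoid (M : εNFA α σ) : Setoid σ where
  r p q := M.Reach p q ∧ M.Reach q p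
  iseqv :=
    { refl := fun p => ⟨⟨[], .nil p⟩, ⟨[], .nil p⟩⟩
      symm := fun h => ⟨h.2, h.1⟩
      trans := fun ⟨⟨π₁, h₁⟩, ⟨π₂, h₂⟩⟩ ⟨⟨π₃, h₃⟩, ⟨π₄, h₄⟩⟩ =>
        ⟨⟨π₁ ++ π₃, h₁.append h₃⟩, ⟨π₄ ++ π₂, h₄.append h₂⟩⟩ }

/-- The strongly connected components of `M`. -/
def Component (M : εNFA α σ) : Type _ :=
  Quotient M.sccSetoid

/-- The strongly connected component of a state. -/
def component (M : εNFA α σ) (q : σ) : M.Component :=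
  Quotient.mk M.sccSetoid q

/-- `M.ComponentPath c c' d`: the component graph, enriched with a `#`-edge from the component
of `p` to that of `q` for every pair `(p, q)` with `M.IDAPair p q`, has a path from `c` to `c'` with
exactly `d` edges marked by `#`. -/
inductive ComponentPath (M : εNFA α σ) : M.Component → M.Component → ℕ → Prop
  | nil (c : M.Component) : ComponentPath M c c 0
  | edge {p q : σ} {a : Option α} {c : M.Component} {d : ℕ} :
      q ∈ M.step p a → M.component p ≠ M.component q →
      ComponentPath M (M.component q) c d → ComponentPath M (M.component p) c d
  | hash {p q : σ} {c : M.Component} {d : ℕ} :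
      M.IDAPair p q →
      ComponentPath M (M.component q) c d → ComponentPath M (M.component p) c (d + 1)

end εNFA

/-! ### A random-access machine with bounded words and a step count -/

namespace RAM

/-- A machine state: registers and a random-access memory, each cell holding a natural number. -/
structure State where
  reg : ℕ → ℕ
  mem : ℕ → ℕ

/-- Programs. The operands are names of registers. -/
inductive Prog
  | skip
  /-- `r := c` -/
  | const (r c : ℕ)
  /-- `r := x + y` -/
  | add (r x y : ℕ)
  /-- `r := x - y`, truncated at zero -/
  | sub (r x y : ℕ)
  /-- `r := x * y` -/
  | mul (r x y : ℕ)
  /-- `r := mem[x]` -/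
  | load (r x : ℕ)
  /-- `mem[x] := y` -/
  | store (x y : ℕ)
  | seq (P P' : Prog)
  /-- `if x < y then P else P'` -/
  | ite (x y : ℕ) (P P' : Prog)
  /-- `while x < y do P` -/
  | while (x y : ℕ) (P : Prog)

/-- Assignment to a register. -/
def State.setReg (s : State) (r v : ℕ) : State :=
  { s with reg := Function.update s.reg r v }

/-- Assignment to a memory cell. -/
def State.setMem (s : State) (i v : ℕ) : State :=
  { s with mem := Function.update s.mem i v }

/-- `Exec W P s t s'`: on a machine whose words hold the numbers up to `W`, the program `P`
started in the state `s` halts after exactly `t` steps in the state `s'`. Every elementary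
instruction and every test is one step; a computation producing a number above `W` or
addressing memory above `W` has no rule, so it does not count as halting. -/
inductive Exec (W : ℕ) : Prog → State → ℕ → State → Prop
  | skip (s : State) : Exec W .skip s 1 s
  | const (s : State) (r c : ℕ) : c ≤ W → Exec W (.const r c) s 1 (s.setReg r c)
  | add (s : State) (r x y : ℕ) : s.reg x + s.reg y ≤ W →
      Exec W (.add r x y) s 1 (s.setReg r (s.reg x + s.reg y))
  | sub (s : State) (r x y : ℕ) : s.reg x - s.reg y ≤ W →
      Exec W (.sub r x y) s 1 (s.setReg r (s.reg x - s.reg y))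
  | mul (s : State) (r x y : ℕ) : s.reg x * s.reg y ≤ W →
      Exec W (.mul r x y) s 1 (s.setReg r (s.reg x * s.reg y))
  | load (s : State) (r x : ℕ) : s.reg x ≤ W → s.mem (s.reg x) ≤ W →
      Exec W (.load r x) s 1 (s.setReg r (s.mem (s.reg x)))
  | store (s : State) (x y : ℕ) : s.reg x ≤ W → s.reg y ≤ W →
      Exec W (.store x y) s 1 (s.setMem (s.reg x) (s.reg y))
  | seq {P P' : Prog} {s s' s'' : State} {t t' : ℕ} :
      Exec W P s t s' → Exec W P' s' t' s'' → Exec W (.seq P P') s (t + t') s''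
  | ite_true {P P' : Prog} {s s' : State} {x y t : ℕ} : s.reg x < s.reg y →
      Exec W P s t s' → Exec W (.ite x y P P') s (t + 1) s'
  | ite_false {P P' : Prog} {s s' : State} {x y t : ℕ} : ¬ s.reg x < s.reg y →
      Exec W P' s t s' → Exec W (.ite x y P P') s (t + 1) s'
  | while_true {P : Prog} {s s' s'' : State} {x y t t' : ℕ} : s.reg x < s.reg y →
      Exec W P s t s' → Exec W (.while x y P) s' t' s'' →
      Exec W (.while x y P) s (t + t' + 1) s''
  | while_false {P : Prog} {s : State} {x y : ℕ} : ¬ s.reg x < s.reg y →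
      Exec W (.while x y P) s 1 s

/-- The initial state: registers are zero, the memory holds the input followed by zeros. -/
def initState (input : List ℕ) : State where
  reg _ := 0
  mem i := input.getD i 0

end RAM

namespace εNFA

/-- The label of a transition as a number: `0` for ε, `a + 1` for the letter `a`. -/
def encodeLabel {k : ℕ} : Option (Fin k) → ℕ
  | none => 0
  | some a => a + 1

open Classical in
/-- The automaton `A` as an input: the numbers of states, of letters and of transitions, the list
`l` of the transitions, and the characteristic vectors of the sets of initial and of final
states. -/
noncomputable def encode {n k : ℕ} (A : εNFA (Fin k) (Fin n))
    (l : List (Fin n × Option (Fin k) × Fin n)) : List ℕ :=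
  [n, k, l.length] ++
    l.flatMap (fun e => [(e.1 : ℕ), encodeLabel e.2.1, (e.2.2 : ℕ)]) ++
    (List.finRange n).map (fun q => if q ∈ A.start then 1 else 0) ++
    (List.finRange n).map (fun q => if q ∈ A.accept then 1 else 0)

end εNFA

namespace εNFA

variable {α σ : Type*}

/-! ### Paths and their labels -/

/-! Two states `p ≠ q` are synchronized if one word labels a cycle at `p`, a path from `p` to `q`
and a cycle at `q`; the parameter of `SyncPair` is the common number of ε-transitions after the last
letter. The degree of ambiguity is the greatest number of synchronized pairs that a walk in the
automaton can use.

Lower bound. On the word `v ^ N` a synchronized pair has the `N` different paths `π₁ ^ i π₂ π₃ ^ (N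
- 1 - i)` (`SyncPair.le_encard_paths`). Without ε-cycles, concatenation is injective on paths with
prescribed ends and labels, so numbers of paths multiply along a walk. A walk with `d` pairs thus
yields `N ^ d` paths on words of length linear in `N`, and trimness completes them to successful
paths (`EndWalk.le_natDegree`). The same argument with exponential growth shows that a word labels
at most one cycle at a state (`PolyAmbiguous.subsingleton_paths`).

Upper bound. Cutting paths at their letters turns the finitely many ε-paths into the states of an
ε-free automaton. The grade of a state is the greatest number of letter-synchronized pairs on a walk
ending at its origin; it never decreases along a run and is at most `d`, so on a word of length `n`
the sequence of grades is given by `d` numbers up to `n + 1`. Over all runs on the word with the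
same grades, the times at which some run leaves its strongly connected component are bounded in
number: by Ramsey's theorem, many such times would give a synchronized pair with no growth of the
grade (`exists_card_leaves_lt`). A run is determined by its states at the ends and around these
times, because its cycles are unambiguous (`IsRun.eq_of_agree`). So there are `O(n ^ d)` paths
(`exists_run_code`, `PolyAmbiguous.exists_bound`).

The lower bound allows any number of trailing ε-transitions and the upper bound needs only pairs
with none, so every relation between the two computes the degree
(`PolyAmbiguous.dpa_eq_of_isGreatest`). The pairs read off from `A³` form such a relation: an
initial filter state at the end forces equal numbers of trailing ε-transitions
(`TransPath.inter_project`), and paths ending with a letter can always be paired by the filter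
(`LetterPath.inter`).

The algorithm uses the pairs without trailing ε-transitions. A graph on triples of states simulates
three paths with equal labels. Extra edges from `(p, q, q)` back to `(p, p, q)` create no false
pairs, so being synchronized becomes strong connectedness (`scc_iff_syncPair`), and one run of
Kosaraju's algorithm (`DFS.Inv.mark_eq_iff`) decides it for all pairs. The greatest weight of a walk
is then found by relaxation (`Estimate.next_round`). All loops run over triples from a list of `3
|E|` items or over the resulting graph, never over all states; this gives `O(|E| ^ 3)`. A small
language of loop-free blocks and simple loops is compiled to the machine with explicit bounds on
time and word size (`Code.Runs.loop`, `PolyBounded.code`). -/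

@[simp] theorem pathLabel_nil : pathLabel ([] : List (σ × Option α × σ)) = [] := rfl

@[simp] theorem pathLabel_append (π π' : List (σ × Option α × σ)) :
    pathLabel (π ++ π') = pathLabel π ++ pathLabel π' := by
  simp [pathLabel]

@[simp] theorem pathLabel_cons_none (p q : σ) (π : List (σ × Option α × σ)) :
    pathLabel ((p, none, q) :: π) = pathLabel π := by
  simp [pathLabel]

@[simp] theorem pathLabel_cons_some (p q : σ) (a : α) (π : List (σ × Option α × σ)) :
    pathLabel ((p, some a, q) :: π) = a :: pathLabel π := by
  simp [pathLabel]

theorem pathLabel_eq_nil_iff {π : List (σ × Option α × σ)} :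
    pathLabel π = [] ↔ ∀ e ∈ π, e.2.1 = none := by
  simp [pathLabel, List.filterMap_eq_nil_iff]

theorem transPath_nil_iff {M : εNFA α σ} {p q : σ} : M.TransPath p [] q ↔ p = q := by
  constructor
  · intro h; cases h; rfl
  · rintro rfl; exact .nil p

theorem transPath_cons_iff {M : εNFA α σ} {p q : σ} {e : σ × Option α × σ}
    {π : List (σ × Option α × σ)} :
    M.TransPath p (e :: π) q ↔ e.1 = p ∧ e.2.2 ∈ M.step p e.2.1 ∧ M.TransPath e.2.2 π q := by
  constructor
  · intro h; cases h with
    | cons h h' => exact ⟨rfl, h, h'⟩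
  · obtain ⟨x, a, y⟩ := e
    rintro ⟨rfl, h, h'⟩
    exact .cons h h'

theorem transPath_append_iff {M : εNFA α σ} {p q : σ} {π π' : List (σ × Option α × σ)} :
    M.TransPath p (π ++ π') q ↔ ∃ r, M.TransPath p π r ∧ M.TransPath r π' q := by
  induction π generalizing p with
  | nil => simp [transPath_nil_iff]
  | cons e π ih =>
    simp only [List.cons_append, transPath_cons_iff, ih]
    tauto

theorem TransPath.end_unique {M : εNFA α σ} {p q q' : σ} {π : List (σ × Option α × σ)}
    (h : M.TransPath p π q) (h' : M.TransPath p π q') : q = q' := by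
  induction h with
  | nil => exact transPath_nil_iff.1 h'
  | cons _ _ ih => exact ih (transPath_cons_iff.1 h').2.2

theorem Reach.trans {M : εNFA α σ} {p q r : σ} (h : M.Reach p q) (h' : M.Reach q r) :
    M.Reach p r := by
  obtain ⟨π, h⟩ := h
  obtain ⟨π', h'⟩ := h'
  exact ⟨π ++ π', h.append h'⟩

theorem Reach.single {M : εNFA α σ} {p q : σ} {a : Option α} (h : q ∈ M.step p a) :
    M.Reach p q := ⟨[(p, a, q)], .cons h (.nil q)⟩

/-- The paths from `p` to `q` labelled by `x`. -/
def paths (M : εNFA α σ) (p q : σ) (x : List α) : Set (List (σ × Option α × σ)) :=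
  {π | M.TransPath p π q ∧ pathLabel π = x}

/-- The path `π` ends with a letter followed by exactly `t` ε-transitions. -/
def TailLength (π : List (σ × Option α × σ)) (t : ℕ) : Prop :=
  ∃ κ e τ, π = κ ++ e :: τ ∧ e.2.1 ≠ none ∧ pathLabel τ = [] ∧ τ.length = t

theorem TailLength.append {π τ : List (σ × Option α × σ)} {t : ℕ} (h : TailLength π t)
    (hτ : pathLabel τ = []) : TailLength (π ++ τ) (t + τ.length) := by
  obtain ⟨κ, e, τ', rfl, he, hl, rfl⟩ := h
  exact ⟨κ, e, τ' ++ τ, by simp, he, by simp [hl, hτ], by simp⟩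

theorem TailLength.append_left {π : List (σ × Option α × σ)} {t : ℕ} (h : TailLength π t)
    (π' : List (σ × Option α × σ)) : TailLength (π' ++ π) t := by
  obtain ⟨κ, e, τ, rfl, he, hl, rfl⟩ := h
  exact ⟨π' ++ κ, e, τ, by simp, he, hl, rfl⟩

theorem TailLength.label_ne_nil {π : List (σ × Option α × σ)} {t : ℕ} (h : TailLength π t) :
    pathLabel π ≠ [] := by
  obtain ⟨κ, e, τ, rfl, he, hl, rfl⟩ := h
  intro h
  exact he (pathLabel_eq_nil_iff.1 h e (by simp))

/-- The letter before the shorter tail would otherwise lie inside the longer tail, which consists of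
ε-transitions. -/
theorem TailLength.le {π : List (σ × Option α × σ)} {t t' : ℕ} (h : TailLength π t)
    (h' : TailLength π t') : t ≤ t' := by
  obtain ⟨κ, e, τ, rfl, he, hl, rfl⟩ := h
  obtain ⟨κ', e', τ', heq, he', hl', rfl⟩ := h'
  by_contra hlt
  push Not at hlt
  have h1 : e' :: τ' <:+ κ ++ e :: τ := ⟨κ', heq.symm⟩
  have h2 : e' :: τ' <:+ τ := by
    refine List.suffix_of_suffix_length_le h1 ?_ (by simpa using hlt)
    exact ⟨κ ++ [e], by simp⟩
  exact he' (pathLabel_eq_nil_iff.1 hl e' (h2.subset (by simp)))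

theorem TailLength.unique {π : List (σ × Option α × σ)} {t t' : ℕ} (h : TailLength π t)
    (h' : TailLength π t') : t = t' := le_antisymm (h.le h') (h'.le h)

/-- Two prefixes of the same path with the same label and the same number of trailing
ε-transitions are equal. -/
theorem TailLength.prefix_eq {π₁ π₂ x y : List (σ × Option α × σ)} {t : ℕ}
    (h₁ : TailLength π₁ t) (h₂ : TailLength π₂ t) (hl : pathLabel π₁ = pathLabel π₂)
    (h : π₁ ++ x = π₂ ++ y) : π₁ = π₂ := by
  -- One prefix extends the other by `δ`. Equal labels make `δ` an ε-path, and equal tail lengths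
  -- make it empty.
  have key : ∀ {π₁ δ : List (σ × Option α × σ)}, TailLength π₁ t → TailLength (π₁ ++ δ) t →
      pathLabel π₁ = pathLabel (π₁ ++ δ) → π₁ = π₁ ++ δ := by
    intro π₁ δ h₁ h₂ hl
    have hδ : pathLabel δ = [] := by simpa using hl
    have := (h₁.append hδ).unique h₂
    have : δ = [] := List.length_eq_zero_iff.1 (by omega)
    simp [this]
  rcases List.append_eq_append_iff.1 h with ⟨δ, rfl, -⟩ | ⟨δ, rfl, -⟩
  · exact key h₁ h₂ hl
  · exact (key h₂ h₁ hl.symm).symm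

/-! ### Synchronized pairs and walks that use them -/

/-- `p ≠ q`, and there are paths from `p` to `p`, from `p` to `q` and from `q` to `q` with the same
label, which ends with a letter followed by `t` ε-transitions on each of them. -/
def SyncPair (M : εNFA α σ) (t : ℕ) (p q : σ) : Prop :=
  p ≠ q ∧ ∃ π₁ π₂ π₃, M.TransPath p π₁ p ∧ M.TransPath p π₂ q ∧ M.TransPath q π₃ q ∧
    pathLabel π₁ = pathLabel π₂ ∧ pathLabel π₂ = pathLabel π₃ ∧
    TailLength π₁ t ∧ TailLength π₂ t ∧ TailLength π₃ t

/-- `M.EndWalk R q d`: some walk using the transitions of `M` and exactly `d` pairs related by `R`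
ends in `q`. -/
inductive EndWalk (M : εNFA α σ) (R : σ → σ → Prop) : σ → ℕ → Prop
  | nil (q : σ) : EndWalk M R q 0
  | step {p q : σ} {a : Option α} {d : ℕ} : EndWalk M R p d → q ∈ M.step p a → EndWalk M R q d
  | pair {p q : σ} {d : ℕ} : EndWalk M R p d → R p q → EndWalk M R q (d + 1)

theorem EndWalk.reach {M : εNFA α σ} {R : σ → σ → Prop} {p q : σ} {d : ℕ}
    (h : M.EndWalk R p d) (h' : M.Reach p q) : M.EndWalk R q d := by
  obtain ⟨π, h'⟩ := h'
  induction h' with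
  | nil => exact h
  | cons hs _ ih => exact ih (h.step hs)

theorem EndWalk.mono {M : εNFA α σ} {R R' : σ → σ → Prop} (hR : ∀ p q, R p q → R' p q) {q : σ}
    {d : ℕ} (h : M.EndWalk R q d) : M.EndWalk R' q d := by
  induction h with
  | nil q => exact .nil q
  | step _ hs ih => exact ih.step hs
  | pair _ hp ih => exact ih.pair (hR _ _ hp)

end εNFA

namespace εNFA

variable {α σ : Type*}

/-! ### Lower bounds for the degree -/

/-- Concatenation is injective here: two cutting points of one path, both at `r` and after the same
word, would enclose an ε-cycle. -/
theorem encard_paths_mul_le {M : εNFA α σ} (hM : M.EpsCycleFree) (p r q : σ) (x y : List α) :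
    (M.paths p r x).encard * (M.paths r q y).encard ≤ (M.paths p q (x ++ y)).encard := by
  have hinj : Set.InjOn (fun z : List (σ × Option α × σ) × List (σ × Option α × σ) => z.1 ++ z.2)
      (M.paths p r x ×ˢ M.paths r q y) := by
    have key : ∀ a b c d : List (σ × Option α × σ), M.TransPath p a r → pathLabel a = x →
        M.TransPath p (a ++ d) r → pathLabel (a ++ d) = x → d = [] := by
      intro a _ _ d ha hla hd hld
      obtain ⟨s, hs, hd⟩ := transPath_append_iff.1 hd
      obtain rfl := hs.end_unique ha
      exact hM _ _ hd (by simpa [hla] using hld)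
    rintro ⟨a, b⟩ ⟨⟨ha, hla⟩, ⟨hb, hlb⟩⟩ ⟨c, d⟩ ⟨⟨hc, hlc⟩, ⟨hd, hld⟩⟩ h
    dsimp only at *
    rcases List.append_eq_append_iff.1 h with ⟨δ, rfl, rfl⟩ | ⟨δ, rfl, rfl⟩
    · obtain rfl := key a a a δ ha hla hc hlc
      simp
    · obtain rfl := key c c c δ hc hlc ha hla
      simp
  rw [← Set.encard_prod, ← hinj.encard_image]
  refine Set.encard_le_encard ?_
  rintro _ ⟨⟨a, b⟩, ⟨⟨ha, hla⟩, ⟨hb, hlb⟩⟩, rfl⟩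
  exact ⟨ha.append hb, by simp [hla, hlb]⟩

theorem transPath_flatten_replicate {M : εNFA α σ} {p : σ} {π : List (σ × Option α × σ)}
    (h : M.TransPath p π p) (N : ℕ) :
    M.TransPath p (List.replicate N π).flatten p ∧
      pathLabel (List.replicate N π).flatten = (List.replicate N (pathLabel π)).flatten := by
  induction N with
  | zero => exact ⟨.nil p, rfl⟩
  | succ N ih => simpa [List.replicate_succ, ih.2] using h.append ih.1

/-- The `N` paths differ in the round in which they change from `p` to `q`. -/
theorem SyncPair.le_encard_paths {M : εNFA α σ} {t : ℕ} {p q : σ} (h : M.SyncPair t p q) :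
    ∃ v : List α, ∀ N : ℕ, (N : ℕ∞) ≤ (M.paths p q (List.replicate N v).flatten).encard := by
  obtain ⟨hpq, π₁, π₂, π₃, h₁, h₂, h₃, hl₁, hl₂, ht₁, ht₂, -⟩ := h
  refine ⟨pathLabel π₁, fun N => ?_⟩
  let F : Fin N → List (σ × Option α × σ) := fun i =>
    (List.replicate i π₁).flatten ++ (π₂ ++ (List.replicate (N - 1 - i) π₃).flatten)
  have hF : Function.Injective F := by
    have key : ∀ i j : Fin N, i < j → F i ≠ F j := by
      intro i j hij heq
      obtain ⟨m, hm⟩ : ∃ m, (j : ℕ) = i + (m + 1) := ⟨j - i - 1, by omega⟩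
      simp only [F, hm, List.replicate_add, List.flatten_append, List.append_assoc,
        List.replicate_succ, List.flatten_cons] at heq
      -- After cancelling the first `i` rounds, one path starts with `π₂` and the other with `π₁`.
      -- Equal labels alone would not separate them; the equal tail lengths give `π₁ = π₂`, hence `p
      -- = q`.
      have := ht₂.prefix_eq ht₁ hl₁.symm (List.append_cancel_left heq)
      subst this
      exact hpq (h₁.end_unique h₂)
    intro i j hij
    rcases lt_trichotomy i j with h | h | h
    · exact absurd hij (key i j h)
    · exact h
    · exact absurd hij.symm (key j i h)
  have : (Set.range F).encard = N := by
    rw [← Set.image_univ, hF.encard_image]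
    simp
  rw [← this]
  refine Set.encard_le_encard ?_
  rintro _ ⟨i, rfl⟩
  refine ⟨((transPath_flatten_replicate h₁ i).1.append
    (h₂.append (transPath_flatten_replicate h₃ (N - 1 - i)).1)), ?_⟩
  have hN : N = i + (1 + (N - 1 - i)) := by omega
  conv_rhs => rw [hN]
  simp [F, (transPath_flatten_replicate h₁ _).2, (transPath_flatten_replicate h₃ _).2,
    List.replicate_add, ← hl₂, ← hl₁]

/-- A polynomial of degree `d` is at most a constant times `(l + 1) ^ d`, and `l` is linear in `N`,
so a lower bound `N ^ m` with `m > d` fails for large `N`. -/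
theorem le_natDegree_of_pow_le (h : Polynomial ℕ) (m L : ℕ)
    (H : ∀ N : ℕ, ∃ l, l ≤ L * (N + 1) ∧ N ^ m ≤ h.eval l) : m ≤ h.natDegree := by
  by_contra hlt
  push Not at hlt
  set d := h.natDegree with hd
  have heval : ∀ l : ℕ, h.eval l ≤ h.eval 1 * (l + 1) ^ d := by
    intro l
    rw [Polynomial.eval_eq_sum_range, Polynomial.eval_eq_sum_range, Finset.sum_mul]
    refine Finset.sum_le_sum fun i hi => ?_
    rw [one_pow, mul_one]
    refine Nat.mul_le_mul_left _ ?_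
    calc l ^ i ≤ (l + 1) ^ i := Nat.pow_le_pow_left (by omega) _
      _ ≤ (l + 1) ^ d := Nat.pow_le_pow_right (by omega) (by simp at hi; omega)
  -- `K` is the constant for which the value at `l` is at most `K * N ^ d`; already `N = K + 1` is
  -- large enough for the contradiction.
  set K := h.eval 1 * (2 * L + 1) ^ d with hK
  obtain ⟨l, hl, hle⟩ := H (K + 1)
  have h1 : l + 1 ≤ (2 * L + 1) * (K + 1) := by nlinarith [Nat.zero_le (L * K)]
  have h2 : (K + 1) ^ (d + 1) ≤ K * (K + 1) ^ d :=
    calc (K + 1) ^ (d + 1) ≤ (K + 1) ^ m := Nat.pow_le_pow_right (by omega) hlt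
      _ ≤ h.eval 1 * (l + 1) ^ d := hle.trans (heval l)
      _ ≤ h.eval 1 * ((2 * L + 1) * (K + 1)) ^ d :=
        Nat.mul_le_mul_left _ (Nat.pow_le_pow_left h1 _)
      _ = K * (K + 1) ^ d := by rw [mul_pow, hK]; ring
  rw [pow_succ, mul_comm] at h2
  have := Nat.le_of_mul_le_mul_right h2 (by positivity)
  omega

/-- If the numbers of paths between two states grow at least like a power, then that power bounds
from below the degree of every polynomial bounding the ambiguity. -/
theorem le_natDegree_of_pow_le_encard_paths {M : εNFA α σ} (hT : M.Trim) (hM : M.EpsCycleFree)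
    {h : Polynomial ℕ} (hh : M.AmbiguityBound h) {p q : σ} {m L : ℕ}
    (H : ∀ N : ℕ, ∃ x : List α, x.length ≤ L * (N + 1) ∧
      ((N ^ m : ℕ) : ℕ∞) ≤ (M.paths p q x).encard) : m ≤ h.natDegree := by
  obtain ⟨i, hi, π, hπ⟩ := (hT p).1
  obtain ⟨f, hf, π', hπ'⟩ := (hT q).2
  -- The added lengths pay for a path from an initial state to `p` and a path from `q` to a final
  -- state.
  refine le_natDegree_of_pow_le h m (L + (pathLabel π).length + (pathLabel π').length) fun N => ?_
  obtain ⟨x, hx, hle⟩ := H N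
  refine ⟨(pathLabel π ++ (x ++ pathLabel π')).length, ?_, ?_⟩
  · simp only [List.length_append]
    nlinarith [Nat.zero_le (N * (pathLabel π).length), Nat.zero_le (N * (pathLabel π').length)]
  · have h1 : (M.paths p q x).encard ≤ (M.paths i f (pathLabel π ++ (x ++ pathLabel π'))).encard := by
      have e1 : 1 ≤ (M.paths i p (pathLabel π)).encard :=
        Set.one_le_encard_iff_nonempty.2 ⟨π, hπ, rfl⟩
      have e2 : 1 ≤ (M.paths q f (pathLabel π')).encard :=
        Set.one_le_encard_iff_nonempty.2 ⟨π', hπ', rfl⟩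
      calc (M.paths p q x).encard = 1 * ((M.paths p q x).encard * 1) := by simp
        _ ≤ (M.paths i p (pathLabel π)).encard *
            ((M.paths p q x).encard * (M.paths q f (pathLabel π')).encard) := by gcongr
        _ ≤ (M.paths i p (pathLabel π)).encard * (M.paths p f (x ++ pathLabel π')).encard := by
          gcongr; exact encard_paths_mul_le hM _ _ _ _ _
        _ ≤ _ := encard_paths_mul_le hM _ _ _ _ _
    have h2 : (M.paths i f (pathLabel π ++ (x ++ pathLabel π'))).encard ≤
        M.da (pathLabel π ++ (x ++ pathLabel π')) := by
      have hinj : Function.Injective (fun κ : List (σ × Option α × σ) => (i, κ)) :=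
        fun a b h => by simpa using h
      rw [da, ← hinj.encard_image]
      refine Set.encard_le_encard ?_
      rintro _ ⟨κ, ⟨hκ, hl⟩, rfl⟩
      exact ⟨hi, ⟨f, hf, hκ⟩, hl⟩
    exact_mod_cast hle.trans (h1.trans (h2.trans (hh _)))

/-- Each pair multiplies the number of paths by `N` and lengthens the word by a constant times `N`;
a transition costs one letter at most and loses no paths. -/
theorem EndWalk.pow_le_encard_paths {M : εNFA α σ} (hM : M.EpsCycleFree) {R : σ → σ → Prop}
    (hR : ∀ p q, R p q → ∃ t, M.SyncPair t p q) {q : σ} {d : ℕ} (h : M.EndWalk R q d) :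
    ∃ p L, ∀ N : ℕ, ∃ x : List α, x.length ≤ L * (N + 1) ∧
      ((N ^ d : ℕ) : ℕ∞) ≤ (M.paths p q x).encard := by
  induction h with
  | nil q =>
    refine ⟨q, 0, fun N => ⟨[], by simp, ?_⟩⟩
    have : (M.paths q q []).Nonempty := ⟨[], .nil q, rfl⟩
    simpa using Set.one_le_encard_iff_nonempty.2 this
  | @step p q a d _ hs ih =>
    obtain ⟨u, L, H⟩ := ih
    refine ⟨u, L + 1, fun N => ?_⟩
    obtain ⟨x, hx, hle⟩ := H N
    refine ⟨x ++ pathLabel [(p, a, q)], ?_, ?_⟩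
    · have : (pathLabel [(p, a, q)]).length ≤ 1 := by cases a <;> simp
      rw [List.length_append]
      nlinarith
    · have e1 : 1 ≤ (M.paths p q (pathLabel [(p, a, q)])).encard :=
        Set.one_le_encard_iff_nonempty.2 ⟨_, .cons hs (.nil q), rfl⟩
      calc ((N ^ d : ℕ) : ℕ∞) ≤ (M.paths u p x).encard * 1 := by simpa using hle
        _ ≤ (M.paths u p x).encard * (M.paths p q (pathLabel [(p, a, q)])).encard := by gcongr
        _ ≤ _ := encard_paths_mul_le hM _ _ _ _ _
  | @pair p q d _ hp ih =>
    obtain ⟨u, L, H⟩ := ih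
    obtain ⟨t, ht⟩ := hR p q hp
    obtain ⟨v, hv⟩ := ht.le_encard_paths
    refine ⟨u, L + v.length, fun N => ?_⟩
    obtain ⟨x, hx, hle⟩ := H N
    refine ⟨x ++ (List.replicate N v).flatten, ?_, ?_⟩
    · simp only [List.length_append, List.length_flatten, List.map_replicate, List.sum_replicate,
        smul_eq_mul]
      nlinarith
    · calc ((N ^ (d + 1) : ℕ) : ℕ∞) = ((N ^ d : ℕ) : ℕ∞) * (N : ℕ∞) := by push_cast; ring
        _ ≤ (M.paths u p x).encard * (M.paths p q (List.replicate N v).flatten).encard := by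
          gcongr; exact hv N
        _ ≤ _ := encard_paths_mul_le hM _ _ _ _ _

theorem EndWalk.le_natDegree {M : εNFA α σ} (hT : M.Trim) (hM : M.EpsCycleFree)
    {h : Polynomial ℕ} (hh : M.AmbiguityBound h) {R : σ → σ → Prop}
    (hR : ∀ p q, R p q → ∃ t, M.SyncPair t p q) {q : σ} {d : ℕ} (hw : M.EndWalk R q d) :
    d ≤ h.natDegree := by
  obtain ⟨p, L, H⟩ := hw.pow_le_encard_paths hM hR
  exact le_natDegree_of_pow_le_encard_paths hT hM hh H

/-- In every round one of two cycles can be chosen independently. -/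
theorem two_pow_le_encard_paths {M : εNFA α σ} (hM : M.EpsCycleFree) {p : σ} {v : List α}
    (h : 2 ≤ (M.paths p p v).encard) (N : ℕ) :
    ((2 ^ N : ℕ) : ℕ∞) ≤ (M.paths p p (List.replicate N v).flatten).encard := by
  induction N with
  | zero =>
    have : (M.paths p p []).Nonempty := ⟨[], .nil p, rfl⟩
    simpa using Set.one_le_encard_iff_nonempty.2 this
  | succ N ih =>
    calc ((2 ^ (N + 1) : ℕ) : ℕ∞) = 2 * ((2 ^ N : ℕ) : ℕ∞) := by push_cast; ring
      _ ≤ (M.paths p p v).encard * (M.paths p p (List.replicate N v).flatten).encard := by gcongr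
      _ ≤ (M.paths p p (v ++ (List.replicate N v).flatten)).encard :=
        encard_paths_mul_le hM _ _ _ _ _
      _ = _ := by simp [List.replicate_succ]

/-- In a polynomially ambiguous automaton, a word labels at most one cycle through a state. -/
theorem PolyAmbiguous.subsingleton_paths {M : εNFA α σ} (hT : M.Trim) (hM : M.EpsCycleFree)
    (hP : M.PolyAmbiguous) (p : σ) (v : List α) : (M.paths p p v).Subsingleton := by
  obtain ⟨h, hh⟩ := hP
  by_contra hs
  have h2 : 2 ≤ (M.paths p p v).encard := by
    have := Set.one_lt_encard_iff_nontrivial.2 (Set.not_subsingleton_iff.1 hs)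
    rw [← one_add_one_eq_two]
    exact Order.add_one_le_of_lt this
  -- Exponential growth dominates every power: `N * m` rounds give at least `(2 ^ N) ^ m ≥ N ^ m`
  -- paths on a word of length linear in `N`, for every `m`.
  have : ∀ m, m ≤ h.natDegree := by
    intro m
    refine le_natDegree_of_pow_le_encard_paths (p := p) (q := p) (L := m * v.length) hT hM hh
      fun N => ⟨(List.replicate (N * m) v).flatten, ?_, ?_⟩
    · simp only [List.length_flatten, List.map_replicate, List.sum_replicate, smul_eq_mul]
      nlinarith [Nat.zero_le (m * v.length)]
    · refine le_trans ?_ (two_pow_le_encard_paths hM h2 (N * m))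
      rw [pow_mul]
      exact_mod_cast Nat.pow_le_pow_left Nat.lt_two_pow_self.le m
  exact absurd (this (h.natDegree + 1)) (by omega)

end εNFA

/-! ### Ramsey's theorem for pairs -/

/-- A set of numbers that is large enough contains an increasing sequence along which a colouring
of the pairs depends only on the smaller element. -/
theorem exists_prehomogeneous {κ : Type*} [Finite κ] (N : ℕ) :
    ∃ R : ℕ, ∀ (T : Finset ℕ), R ≤ T.card → ∀ χ : ℕ → ℕ → κ,
      ∃ (t : ℕ → ℕ) (c : ℕ → κ), (∀ i < N, t i ∈ T) ∧
        ∀ i j, i < j → j < N → t i < t j ∧ χ (t i) (t j) = c i := by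
  classical
  have := Fintype.ofFinite κ
  induction N with
  | zero =>
    refine ⟨1, fun T hT χ => ?_⟩
    obtain ⟨x, -⟩ := Finset.card_pos.1 (by omega : 0 < T.card)
    exact ⟨fun _ => x, fun _ => χ x x, by omega, by omega⟩
  | succ N ih =>
    obtain ⟨R, hR⟩ := ih
    -- One element is reserved for the minimum `x`. Among the others, some colour of the pairs with
    -- `x` occurs at least `R` times, and the sequence continues inside this colour class.
    refine ⟨Fintype.card κ * R + 1, fun T hT χ => ?_⟩
    have hne : T.Nonempty := Finset.card_pos.1 (by omega)
    set x := T.min' hne with hx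
    have hcard : Fintype.card κ * R ≤ (T.erase x).card := by
      rw [Finset.card_erase_of_mem (T.min'_mem hne)]
      omega
    have : Nonempty κ := ⟨χ x x⟩
    obtain ⟨c₀, -, hc₀⟩ := Finset.exists_le_card_fiber_of_mul_le_card_of_maps_to
      (s := T.erase x) (t := Finset.univ) (f := fun y => χ x y) (n := R) (by simp)
      Finset.univ_nonempty (by simpa using hcard)
    obtain ⟨t, c, ht, hc⟩ := hR _ hc₀ χ
    refine ⟨fun i => Nat.casesOn i x t, fun i => Nat.casesOn i c₀ c, ?_, ?_⟩
    · rintro (_ | i) hi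
      · exact T.min'_mem hne
      · exact Finset.mem_of_mem_erase (Finset.mem_filter.1 (ht i (by omega))).1
    · rintro (_ | i) (_ | j) hij hj
      · omega
      · have := Finset.mem_filter.1 (ht j (by omega))
        have h2 := Finset.mem_erase.1 this.1
        exact ⟨lt_of_le_of_ne (T.min'_le _ h2.2) (Ne.symm h2.1), this.2⟩
      · omega
      · exact hc i j (by omega) (by omega)

/-- In a sequence whose colours depend only on the smaller element, the pigeonhole principle selects
`N` elements with the same colour. -/
theorem exists_homogeneous {κ : Type*} [Finite κ] (N : ℕ) :
    ∃ R : ℕ, ∀ (T : Finset ℕ), R ≤ T.card → ∀ χ : ℕ → ℕ → κ,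
      ∃ (t : ℕ → ℕ) (c : κ), (∀ i < N, t i ∈ T) ∧
        ∀ i j, i < j → j < N → t i < t j ∧ χ (t i) (t j) = c := by
  classical
  have := Fintype.ofFinite κ
  obtain ⟨R, hR⟩ := exists_prehomogeneous (κ := κ) (Fintype.card κ * N)
  refine ⟨R, fun T hT χ => ?_⟩
  obtain ⟨t, c, ht, hc⟩ := hR T hT χ
  have : Nonempty κ := ⟨χ 0 0⟩
  obtain ⟨c₀, -, hc₀⟩ := Finset.exists_le_card_fiber_of_mul_le_card_of_maps_to
    (s := Finset.range (Fintype.card κ * N)) (t := Finset.univ) (f := c) (n := N) (by simp)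
    Finset.univ_nonempty (by simp)
  obtain ⟨U, hU, hUc⟩ := Finset.exists_subset_card_eq hc₀
  have hmem : ∀ i (hi : i < N), U.orderEmbOfFin hUc ⟨i, hi⟩ ∈ U :=
    fun i hi => U.orderEmbOfFin_mem hUc _
  refine ⟨fun i => if hi : i < N then t (U.orderEmbOfFin hUc ⟨i, hi⟩) else 0, c₀, ?_, ?_⟩
  · intro i hi
    have := Finset.mem_filter.1 (hU (hmem i hi))
    simpa [hi] using ht _ (by simpa using this.1)
  · intro i j hij hj
    have hi : i < N := by omega
    have h1 := Finset.mem_filter.1 (hU (hmem i hi))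
    have h2 := Finset.mem_filter.1 (hU (hmem j hj))
    have hlt : U.orderEmbOfFin hUc ⟨i, hi⟩ < U.orderEmbOfFin hUc ⟨j, hj⟩ := by
      simpa using hij
    have := hc _ _ hlt (by simpa using h2.1)
    simp only [hi, hj, dif_pos]
    exact ⟨this.1, this.2.trans h1.2⟩

/-! ### Runs of ε-free automata -/

/-- `wordRel step u s s'`: the word `u` leads from `s` to `s'`. -/
def wordRel {α S : Type*} (step : α → S → S → Prop) : List α → S → S → Prop
  | [], s, s' => s = s'
  | a :: u, s, s' => ∃ r, step a s r ∧ wordRel step u r s'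

section Runs

variable {α S : Type*} {step : α → S → S → Prop}

theorem wordRel_append {u v : List α} {s s' : S} :
    wordRel step (u ++ v) s s' ↔ ∃ r, wordRel step u s r ∧ wordRel step v r s' := by
  induction u generalizing s with
  | nil => simp [wordRel]
  | cons a u ih =>
    simp only [List.cons_append, wordRel, ih]
    grind

/-- `f` is a run on the word `w`, its state at time `t` being `f t`. -/
def IsRun (step : α → S → S → Prop) (w : List α) (f : ℕ → S) : Prop :=
  ∀ t (h : t < w.length), step w[t] (f t) (f (t + 1))

/-- The factor of a word between two times. -/
def factor (w : List α) (i j : ℕ) : List α := (w.drop i).take (j - i)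

theorem factor_append {w : List α} {i j k : ℕ} (hij : i ≤ j) (hjk : j ≤ k) :
    factor w i j ++ factor w j k = factor w i k := by
  have h1 : k - i = (j - i) + (k - j) := by omega
  have h2 : w.drop j = (w.drop i).drop (j - i) := by rw [List.drop_drop]; congr 1; omega
  rw [factor, factor, factor, h1, h2, List.take_add]

theorem IsRun.wordRel_factor {w : List α} {f : ℕ → S} (h : IsRun step w f) {i j : ℕ}
    (hij : i ≤ j) (hj : j ≤ w.length) : wordRel step (factor w i j) (f i) (f j) := by
  obtain ⟨m, rfl⟩ := Nat.exists_eq_add_of_le hij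
  induction m with
  | zero => simp [factor, wordRel]
  | succ m ih =>
    rw [← factor_append (j := i + m) (by omega) (by omega), wordRel_append]
    refine ⟨_, ih (by omega) (by omega), ?_⟩
    have : factor w (i + m) (i + (m + 1)) = [w[i + m]] := by
      have e : i + (m + 1) - (i + m) = 1 := by omega
      have hd : w.drop (i + m) = w[i + m] :: w.drop (i + m + 1) := List.drop_eq_getElem_cons _
      rw [factor, e, hd]
      rfl
    rw [this]
    exact ⟨_, h (i + m) (by omega), rfl⟩

/-- Reachability by some word. -/
def WordReach (step : α → S → S → Prop) (s s' : S) : Prop := ∃ u, wordRel step u s s'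

theorem WordReach.trans {s s' s'' : S} (h : WordReach step s s') (h' : WordReach step s' s'') :
    WordReach step s s'' := by
  obtain ⟨u, h⟩ := h
  obtain ⟨v, h'⟩ := h'
  exact ⟨u ++ v, wordRel_append.2 ⟨_, h, h'⟩⟩

theorem IsRun.wordReach {w : List α} {f : ℕ → S} (h : IsRun step w f) {i j : ℕ}
    (hij : i ≤ j) (hj : j ≤ w.length) : WordReach step (f i) (f j) :=
  ⟨_, h.wordRel_factor hij hj⟩

/-! ### Runs in automata with unambiguous cycles -/

/-- No word labels two different cycles through the same state. -/
def UnambiguousCycles (step : α → S → S → Prop) : Prop :=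
  ∀ (u v : List α) (s r r' : S), wordRel step u s r → wordRel step u s r' →
    wordRel step v r s → wordRel step v r' s → r = r'

/-- The run `f` leaves its strongly connected component at time `t`. -/
def Leaves (step : α → S → S → Prop) (f : ℕ → S) (t : ℕ) : Prop :=
  ¬ WordReach step (f (t + 1)) (f t)

/-- Two runs that agree at the ends and whenever one of them leaves a strongly connected component
are equal. -/
theorem IsRun.eq_of_agree (hU : UnambiguousCycles step) {w : List α} {f f' : ℕ → S}
    (hf : IsRun step w f) (hf' : IsRun step w f') (h0 : f 0 = f' 0)
    (hn : f w.length = f' w.length)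
    (hL : ∀ t < w.length, Leaves step f t → f t = f' t ∧ f (t + 1) = f' (t + 1)) :
    ∀ t ≤ w.length, f t = f' t := by
  classical
  intro t ht
  by_contra hne
  have hlt : t < w.length := lt_of_le_of_ne ht (by rintro rfl; exact hne hn)
  -- The times `a < t < b` constructed here bound the maximal interval around `t` on which the runs
  -- differ; they agree at `a` and at `b`.
  have hex : ∃ k, f (t + k) = f' (t + k) := ⟨w.length - t, by
    rw [show t + (w.length - t) = w.length by omega]; exact hn⟩
  set b := t + Nat.find hex with hb
  have hfb : f b = f' b := Nat.find_spec hex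
  have hbmin : ∀ s, t ≤ s → s < b → f s ≠ f' s := fun s h1 h2 h3 =>
    Nat.find_min hex (m := s - t) (by omega) (by rwa [show t + (s - t) = s by omega])
  have hbn : b ≤ w.length := by
    by_contra h
    exact hbmin w.length ht (by omega) hn
  have htb : t < b := lt_of_le_of_ne (by omega) (fun h => hne (by rw [← h] at hfb; exact hfb))
  have hex' : ∃ k, f (t - k) = f' (t - k) := ⟨t, by simpa using h0⟩
  set a := t - Nat.find hex' with ha
  have hfa : f a = f' a := Nat.find_spec hex'
  have hamin : ∀ s, a < s → s ≤ t → f s ≠ f' s := fun s h1 h2 h3 =>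
    Nat.find_min hex' (m := t - s) (by omega) (by rwa [show t - (t - s) = s by omega])
  have hat : a < t := lt_of_le_of_ne (by omega) (fun h => hne (by rw [h] at hfa; exact hfa))
  have hdiff : ∀ s, a < s → s < b → f s ≠ f' s := fun s h1 h2 =>
    if h : s ≤ t then hamin s h1 h else hbmin s (by omega) h2
  -- Between `a` and `b` the run `f` stays in its component: leaving it would force agreement at two
  -- consecutive times, one of which lies strictly between `a` and `b`.
  have hback : ∀ m, a + m ≤ b → WordReach step (f (a + m)) (f a) := by
    intro m
    induction m with
    | zero => exact fun _ => ⟨[], rfl⟩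
    | succ m ih =>
      intro hm
      refine WordReach.trans ?_ (ih (by omega))
      by_contra hleave
      obtain ⟨h1, h2⟩ := hL (a + m) (by omega) hleave
      rcases Nat.eq_zero_or_pos m with rfl | hm0
      · exact hdiff (a + 0 + 1) (by omega) (by omega) h2
      · exact hdiff (a + m) (by omega) (by omega) h1
  obtain ⟨z, hz⟩ := hback (b - a) (by omega)
  rw [show a + (b - a) = b by omega] at hz
  -- With a way back from `f b` to `f a`, the two runs close to cycles with the same label that pass
  -- through `f t` and `f' t` at the same position.
  refine hne (hU (factor w a t) (factor w t b ++ z) (f a) (f t) (f' t)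
    (hf.wordRel_factor hat.le ht) ?_ ?_ ?_)
  · rw [hfa]; exact hf'.wordRel_factor hat.le ht
  · exact wordRel_append.2 ⟨_, hf.wordRel_factor htb.le hbn, hz⟩
  · refine wordRel_append.2 ⟨f b, ?_, hz⟩
    rw [hfb]; exact hf'.wordRel_factor htb.le hbn

/-- If a word labels cycles through two states and leads from one to the other, then the grade
grows strictly. -/
def GradeIncreases (step : α → S → S → Prop) (gr : S → ℕ) : Prop :=
  ∀ (u : List α) (s s' : S), s ≠ s' → wordRel step u s s → wordRel step u s s' →
    wordRel step u s' s' → gr s < gr s'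

/-- The number of times when a run with a given sequence of grades leaves a strongly connected
component is bounded. -/
theorem exists_card_leaves_lt [Finite S] (gr : S → ℕ) (d : ℕ) (hd : ∀ s, gr s ≤ d)
    (hI : GradeIncreases step gr) :
    ∃ R : ℕ, ∀ (w : List α) (γ : ℕ → ℕ) (T : Finset ℕ),
      (∀ t ∈ T, t < w.length ∧ ∃ f, IsRun step w f ∧ (∀ s ≤ w.length, gr (f s) = γ s) ∧
        Leaves step f t) → T.card < R := by
  classical
  have := Fintype.ofFinite S
  set n := Fintype.card S with hn
  -- There are `n + 1` times for a repeated state up to the middle and `n + 1` for another one after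
  -- it. One more is needed because the grade of a time is read from a pair with a later time.
  obtain ⟨R, hR⟩ := exists_homogeneous (κ := (S → S → Prop) × Fin (d + 1)) (2 * n + 3)
  refine ⟨R, fun w γ T hT => ?_⟩
  by_contra hlt
  push Not at hlt
  -- A pair of times is coloured by the relation of the factor between them and by the grade at the
  -- first. Reduction modulo `d + 1` loses nothing, as grades are at most `d`.
  obtain ⟨t, ⟨e, g⟩, ht, hc⟩ := hR T hlt fun i j =>
    (wordRel step (factor w i j), Fin.ofNat (d + 1) (γ i))
  have hlen : ∀ i < 2 * n + 3, t i < w.length := fun i hi => (hT _ (ht i hi)).1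
  have he : ∀ i j, i < j → j < 2 * n + 3 → wordRel step (factor w (t i) (t j)) = e :=
    fun i j h h' => (Prod.ext_iff.1 (hc i j h h').2).1
  have hmono : ∀ i j, i ≤ j → j < 2 * n + 3 → t i ≤ t j := by
    intro i j hij hj
    rcases hij.eq_or_lt with rfl | hij
    · exact le_rfl
    · exact (hc i j hij hj).1.le
  -- Only the run that leaves its component at the middle time is followed; the runs belonging to
  -- the other times serve merely to put those times into `T`.
  obtain ⟨-, f, hf, hfγ, hleave⟩ := hT _ (ht n (by omega))
  have hfe : ∀ i j, i < j → j < 2 * n + 3 → e (f (t i)) (f (t j)) := by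
    intro i j hij hj
    rw [← he i j hij hj]
    exact hf.wordRel_factor (hmono i j hij.le hj) (hlen j hj).le
  have hγ : ∀ i < 2 * n + 2, gr (f (t i)) = g := by
    intro i hi
    have h1 := (Prod.ext_iff.1 (hc i (i + 1) (by omega) (by omega)).2).2
    have h2 := hfγ (t i) (hlen i (by omega)).le
    have h3 := hd (f (t i))
    dsimp only at h1
    rw [← h1, h2, Fin.val_ofNat, Nat.mod_eq_of_lt (by omega)]
  have hpig : ∀ a, ∃ i j, i < j ∧ j ≤ n ∧ f (t (a + i)) = f (t (a + j)) := by
    intro a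
    obtain ⟨x, y, hxy, h⟩ := Fintype.exists_ne_map_eq_of_card_lt
      (fun i : Fin (n + 1) => f (t (a + i))) (by simp [hn])
    rcases lt_or_gt_of_ne hxy with h' | h'
    · exact ⟨x, y, h', by omega, h⟩
    · exact ⟨y, x, h', by omega, h.symm⟩
  obtain ⟨i, j, hij, hj, hz⟩ := hpig 0
  obtain ⟨i', j', hij', hj', hz'⟩ := hpig (n + 1)
  simp only [zero_add] at hz
  -- The repeated states before and after the middle both carry loops with the relation `e`, and `e`
  -- leads from the first to the second. If they differed, the grade would have to grow, but it is
  -- `g` at both.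
  have hzz : f (t j) = f (t (n + 1 + i')) := by
    by_contra hne
    have key := hI (factor w (t 0) (t 1)) (f (t j)) (f (t (n + 1 + i'))) hne
    rw [he 0 1 (by omega) (by omega)] at key
    have := key (by simpa [hz] using hfe i j hij (by omega)) (hfe _ _ (by omega) (by omega))
      (by simpa [hz'] using hfe (n + 1 + i') (n + 1 + j') (by omega) (by omega))
    rw [hγ _ (by omega), hγ _ (by omega)] at this
    exact lt_irrefl _ this
  refine hleave ?_
  have h1 : WordReach step (f (t n + 1)) (f (t (n + 1 + i'))) :=
    hf.wordReach ((hc n (n + 1 + i') (by omega) (by omega)).1) (hlen _ (by omega)).le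
  have h2 : WordReach step (f (t j)) (f (t n)) :=
    hf.wordReach (hmono j n hj (by omega)) (hlen n (by omega)).le
  rw [← hzz] at h1
  exact h1.trans h2

/-- A nondecreasing sequence with values up to `d` is determined by the `d` positions at which it
exceeds `0, …, d - 1`. If `x t < y t`, then the counts for the threshold `x t` are at least `t + 1`
and at most `t`. -/
theorem eq_of_card_filter_le_eq {n d : ℕ} {x y : ℕ → ℕ} (hx : ∀ s t, s ≤ t → t ≤ n → x s ≤ x t)
    (hy : ∀ s t, s ≤ t → t ≤ n → y s ≤ y t) (hxd : ∀ t ≤ n, x t ≤ d) (hyd : ∀ t ≤ n, y t ≤ d)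
    (h : ∀ g < d, ((Finset.range (n + 1)).filter fun t => x t ≤ g).card =
      ((Finset.range (n + 1)).filter fun t => y t ≤ g).card) : ∀ t ≤ n, x t = y t := by
  have key : ∀ {x y : ℕ → ℕ}, (∀ s t, s ≤ t → t ≤ n → x s ≤ x t) → (∀ t ≤ n, y t ≤ d) →
      (∀ s t, s ≤ t → t ≤ n → y s ≤ y t) →
      (∀ g < d, ((Finset.range (n + 1)).filter fun t => x t ≤ g).card =
      ((Finset.range (n + 1)).filter fun t => y t ≤ g).card) → ∀ t ≤ n, ¬ x t < y t := by
    intro x y hx hyd hy h t ht hlt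
    have h0 := h (x t) (lt_of_lt_of_le hlt (hyd t ht))
    have h1 : t + 1 ≤ ((Finset.range (n + 1)).filter fun s => x s ≤ x t).card := by
      rw [← Finset.card_range (t + 1)]
      refine Finset.card_le_card fun s hs => ?_
      simp only [Finset.mem_range, Finset.mem_filter] at hs ⊢
      exact ⟨by omega, hx s t (by omega) ht⟩
    have h2 : ((Finset.range (n + 1)).filter fun s => y s ≤ x t).card ≤ t := by
      refine (Finset.card_le_card (t := Finset.range t) fun s hs => ?_).trans_eq
        (Finset.card_range t)
      simp only [Finset.mem_range, Finset.mem_filter] at hs ⊢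
      by_contra hts
      have := hy t s (by omega) (by omega)
      omega
    omega
  intro t ht
  have h1 := key hx hyd hy h t ht
  have h2 := key hy hxd hx (fun g hg => (h g hg).symm) t ht
  omega

/-- The runs of an ε-free automaton on a word of length `n` are coded by a bounded amount of
information and `d` numbers up to `n + 1`, where `d` bounds the grades. -/
theorem exists_run_code [Finite S] (gr : S → ℕ) (d : ℕ) (hd : ∀ s, gr s ≤ d)
    (hmono : ∀ a s s', step a s s' → gr s ≤ gr s')
    (hU : UnambiguousCycles step) (hI : GradeIncreases step gr) :
    ∃ K : ℕ, ∀ w : List α, ∃ code : (ℕ → S) → (Fin K → S) × (Fin d → Fin (w.length + 2)),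
      ∀ f f', IsRun step w f → IsRun step w f' → code f = code f' →
        ∀ t ≤ w.length, f t = f' t := by
  classical
  obtain ⟨R, hR⟩ := exists_card_leaves_lt gr d hd hI
  refine ⟨2 * R + 2, fun w => ?_⟩
  set n := w.length with hn
  let prof : (ℕ → S) → Fin d → Fin (n + 2) := fun f g =>
    ⟨((Finset.range (n + 1)).filter fun t => gr (f t) ≤ g).card, by
      have := Finset.card_filter_le (Finset.range (n + 1)) fun t => gr (f t) ≤ g
      rw [Finset.card_range] at this
      omega⟩
  have hgm : ∀ f, IsRun step w f → ∀ s t, s ≤ t → t ≤ n → gr (f s) ≤ gr (f t) := by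
    intro f hf s t hst
    obtain ⟨m, rfl⟩ := Nat.exists_eq_add_of_le hst
    induction m with
    | zero => exact fun _ => le_rfl
    | succ m ih => exact fun h => (ih (by omega) (by omega)).trans (hmono _ _ _ (hf (s + m) h))
  have hprof : ∀ f f', IsRun step w f → IsRun step w f' → prof f = prof f' →
      ∀ t ≤ n, gr (f t) = gr (f' t) := by
    intro f f' hf hf' h
    refine eq_of_card_filter_le_eq (d := d) (hgm f hf) (hgm f' hf') (fun t _ => hd _)
      (fun t _ => hd _) fun g hg => ?_
    exact congrArg Fin.val (congrFun h ⟨g, hg⟩)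
  -- The set collects the leaving times of all runs with the given profile. It depends on the
  -- profile alone, so the positions at which states are recorded need not be stored in the code.
  let T : (Fin d → Fin (n + 2)) → Finset ℕ := fun c =>
    (Finset.range n).filter fun t => ∃ f, IsRun step w f ∧ prof f = c ∧ Leaves step f t
  have hT : ∀ c, (T c).card < R := by
    intro c
    by_cases hne : ∃ f, IsRun step w f ∧ prof f = c
    · obtain ⟨f₀, hf₀, rfl⟩ := hne
      refine hR w (fun t => gr (f₀ t)) _ fun t ht => ?_
      simp only [T, Finset.mem_filter, Finset.mem_range] at ht
      obtain ⟨ht, f, hf, hp, hl⟩ := ht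
      exact ⟨ht, f, hf, fun s hs => hprof f f₀ hf hf₀ hp s hs, hl⟩
    · have : T c = ∅ := by
        refine Finset.filter_eq_empty_iff.2 fun t _ => ?_
        rintro ⟨f, hf, hp, -⟩
        exact hne ⟨f, hf, hp⟩
      rw [this]
      exact lt_of_le_of_lt (by simp) (hR [] (fun _ => 0) ∅ (by simp))
  -- Agreement is needed immediately before and after each leaving time and at both ends.
  let U : (Fin d → Fin (n + 2)) → Finset ℕ := fun c =>
    (T c ∪ (T c).image (· + 1)) ∪ {0, n}
  have hUc : ∀ c, (U c).card ≤ 2 * R + 2 := by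
    intro c
    have h1 := Finset.card_union_le (T c ∪ (T c).image (· + 1)) {0, n}
    have h2 := Finset.card_union_le (T c) ((T c).image (· + 1))
    have h3 := Finset.card_image_le (s := T c) (f := (· + 1))
    have h4 := Finset.card_le_two (a := 0) (b := n)
    have := hT c
    change (T c ∪ (T c).image (· + 1) ∪ {0, n}).card ≤ _
    omega
  have hemb : ∀ c, ∃ e : ℕ → Fin (2 * R + 2), Set.InjOn e (U c) := by
    intro c
    have e := (U c).equivFin
    refine ⟨fun u => if h : u ∈ U c then Fin.castLE (hUc c) (e ⟨u, h⟩) else ⟨0, by omega⟩, ?_⟩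
    intro u hu v hv h
    have hu' : u ∈ U c := hu
    have hv' : v ∈ U c := hv
    simpa [hu', hv'] using h
  choose e he using hemb
  -- The code consists of the states at the times in `U`, numbered by the injection `e`, and the
  -- profile. Unused numbers receive the default value `f 0`.
  refine ⟨fun f => (fun k => if h : ∃ u ∈ U (prof f), e (prof f) u = k then f h.choose else f 0,
    prof f), fun f f' hf hf' h => ?_⟩
  rw [Prod.mk.injEq] at h
  obtain ⟨h1, h2⟩ := h
  have hagree : ∀ u ∈ U (prof f), f u = f' u := by
    intro u hu
    have h3 := congrFun h1 (e (prof f) u)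
    rw [← h2] at h3
    have hex : ∃ v ∈ U (prof f), e (prof f) v = e (prof f) u := ⟨u, hu, rfl⟩
    simp only [dif_pos hex] at h3
    have := he (prof f) hex.choose_spec.1 hu hex.choose_spec.2
    rwa [this] at h3
  refine hf.eq_of_agree hU hf' (hagree 0 (by simp [U])) (hagree n (by simp [U])) fun t ht hl => ?_
  have htT : t ∈ T (prof f) := by
    simp only [T, Finset.mem_filter, Finset.mem_range]
    exact ⟨ht, f, hf, rfl, hl⟩
  exact ⟨hagree t (by simp [U, htT]), hagree (t + 1) (by simp [U, htT])⟩

end Runs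

namespace εNFA

variable {α σ : Type*}

/-! ### The ε-free automaton of the ε-paths -/

/-- A repeated state on an ε-path would close a nonempty ε-cycle. -/
theorem TransPath.nodup_of_label_nil {M : εNFA α σ} (hM : M.EpsCycleFree) {p q : σ}
    {π : List (σ × Option α × σ)} (h : M.TransPath p π q) (hl : pathLabel π = []) :
    (p :: π.map fun e => e.2.2).Nodup := by
  induction h with
  | nil => simp
  | @cons p q r a π hs h ih =>
    have ha : a = none := pathLabel_eq_nil_iff.1 hl _ (List.mem_cons_self)
    subst ha
    rw [pathLabel_cons_none] at hl
    rw [List.nodup_cons]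
    refine ⟨fun hmem => ?_, ih hl⟩
    obtain ⟨e, he, hep⟩ := List.mem_map.1 hmem
    obtain ⟨π₁, π₂, hπ⟩ := List.append_of_mem he
    have h2 : M.TransPath p ((p, none, q) :: π) r := .cons hs h
    rw [hπ, ← List.singleton_append, ← List.append_assoc] at h2
    obtain ⟨x, hx, -⟩ := transPath_append_iff.1 h2
    obtain ⟨y, hy, hx'⟩ := transPath_append_iff.1 hx
    have : x = p := by
      rw [transPath_cons_iff, transPath_nil_iff] at hx'
      exact hx'.2.2.symm.trans hep
    subst this
    have hnil := hM x _ hx (by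
      refine pathLabel_eq_nil_iff.2 fun e' he' => ?_
      have h3 : e' ∈ (x, none, q) :: π := by
        rw [hπ]
        simp only [List.mem_append, List.mem_cons] at he' ⊢
        tauto
      rcases List.mem_cons.1 h3 with rfl | h3
      · rfl
      · exact pathLabel_eq_nil_iff.1 hl e' h3)
    simp at hnil

/-- The paths consisting of ε-transitions. -/
@[ext]
structure EpsPath (M : εNFA α σ) where
  origin : σ
  dest : σ
  path : List (σ × Option α × σ)
  isPath : M.TransPath origin path dest
  label_eq_nil : pathLabel path = []

theorem EpsPath.eq_of_path_eq {M : εNFA α σ} {ρ ρ' : M.EpsPath} (ho : ρ.origin = ρ'.origin)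
    (hp : ρ.path = ρ'.path) : ρ = ρ' := by
  refine EpsPath.ext ho ?_ hp
  have h := ρ.isPath
  rw [ho, hp] at h
  exact h.end_unique ρ'.isPath

/-- An ε-path without repeated states has at most as many transitions as there are states, and it is
determined by its origin and its transitions. -/
theorem EpsCycleFree.finite_epsPath [Finite α] [Finite σ] {M : εNFA α σ}
    (hM : M.EpsCycleFree) : Finite M.EpsPath := by
  have := Fintype.ofFinite σ
  have hfin := (List.finite_length_le (σ × Option α × σ) (Fintype.card σ)).to_subtype
  have : Finite {l : List (σ × Option α × σ) // l.length ≤ Fintype.card σ} := hfin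
  refine Finite.of_injective (β := σ × {l : List (σ × Option α × σ) // l.length ≤ Fintype.card σ})
    (fun ρ => (ρ.origin, ⟨ρ.path, ?_⟩)) ?_
  · have := (ρ.isPath.nodup_of_label_nil hM ρ.label_eq_nil).length_le_card
    simp only [List.length_cons, List.length_map] at this
    omega
  · intro ρ ρ' h
    simp only [Prod.mk.injEq, Subtype.mk.injEq] at h
    exact EpsPath.eq_of_path_eq h.1 h.2

/-- The empty path. -/
def EpsPath.refl (M : εNFA α σ) (p : σ) : M.EpsPath := ⟨p, p, [], .nil p, rfl⟩

/-- A letter leads from an ε-path to another one. -/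
def epsStep (M : εNFA α σ) (a : α) (ρ ρ' : M.EpsPath) : Prop :=
  ρ'.origin ∈ M.step ρ.dest (some a)

/-- The path of `M` described by a run on the ε-paths. -/
def flattenRun (M : εNFA α σ) : List α → (ℕ → M.EpsPath) → List (σ × Option α × σ)
  | [], f => (f 0).path
  | a :: w, f => (f 0).path ++ ((f 0).dest, some a, (f 1).origin) ::
      flattenRun M w fun t => f (t + 1)

theorem flattenRun_congr {M : εNFA α σ} {w : List α} {f f' : ℕ → M.EpsPath}
    (h : ∀ t ≤ w.length, f t = f' t) : M.flattenRun w f = M.flattenRun w f' := by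
  induction w generalizing f f' with
  | nil => simp [flattenRun, h 0 (by simp)]
  | cons a w ih =>
    have h2 := ih (f := fun t => f (t + 1)) (f' := fun t => f' (t + 1))
      fun t ht => h (t + 1) (by simpa using ht)
    simp only [flattenRun, h 0 (by simp), h 1 (by simp), h2]

/-- An ε-transition at the front is added to the first ε-path; a letter at the front shifts the run
behind an empty ε-path. -/
theorem TransPath.exists_run {M : εNFA α σ} {p q : σ} {π : List (σ × Option α × σ)}
    (h : M.TransPath p π q) : ∃ f : ℕ → M.EpsPath, IsRun M.epsStep (pathLabel π) f ∧
      (f 0).origin = p ∧ M.flattenRun (pathLabel π) f = π := by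
  induction h with
  | nil p =>
    exact ⟨fun _ => EpsPath.refl M p, fun t ht => absurd ht (by simp), rfl, rfl⟩
  | @cons p q r a π hs h ih =>
    obtain ⟨f, hf, ho, hfl⟩ := ih
    cases a with
    | none =>
      subst ho
      refine ⟨fun t => if t = 0 then ⟨p, (f 0).dest, (p, none, (f 0).origin) :: (f 0).path,
        .cons hs (f 0).isPath, by simp [(f 0).label_eq_nil]⟩ else f t, ?_, by simp, ?_⟩
      · intro t ht
        have := hf t (by simpa using ht)
        rcases t with _ | t
        · simpa [epsStep] using this
        · simpa using this
      · rw [pathLabel_cons_none]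
        conv_rhs => rw [← hfl]
        cases pathLabel π with
        | nil => simp [flattenRun]
        | cons b w => simp [flattenRun]
    | some b =>
      refine ⟨fun t => if t = 0 then EpsPath.refl M p else f (t - 1), ?_, rfl, ?_⟩
      · intro t ht
        rcases t with _ | t
        · simpa [epsStep, ho, EpsPath.refl] using hs
        · have := hf t (by simpa using ht)
          simpa using this
      · rw [pathLabel_cons_some]
        simp [flattenRun, hfl, ho, EpsPath.refl]

/-- The path starts after `ρ` and stops before `ρ'`, so both its first and its last transition are
letters. The ε-paths at the ends can then be recovered from a concatenation. -/
theorem wordRel_epsStep_path {M : εNFA α σ} {a : α} {u : List α} {ρ ρ' : M.EpsPath}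
    (h : wordRel M.epsStep (a :: u) ρ ρ') : ∃ x X,
      M.TransPath ρ.dest ((ρ.dest, some a, x) :: X) ρ'.origin ∧
      pathLabel ((ρ.dest, some a, x) :: X) = a :: u ∧
      TailLength ((ρ.dest, some a, x) :: X) 0 := by
  induction u generalizing a ρ with
  | nil =>
    obtain ⟨r, hr, rfl⟩ := h
    exact ⟨r.origin, [], .cons hr (.nil _), by simp, [], _, [], rfl, by simp, rfl, rfl⟩
  | cons b u ih =>
    obtain ⟨r, hr, h⟩ := h
    obtain ⟨x, X, hX, hl, ht⟩ := ih h
    refine ⟨r.origin, r.path ++ (r.dest, some b, x) :: X, .cons hr (r.isPath.append hX), ?_, ?_⟩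
    · rw [pathLabel_cons_some, pathLabel_append, hl, r.label_eq_nil, List.nil_append]
    · exact ht.append_left ((ρ.dest, some a, r.origin) :: r.path)

/-- Both prefixes extend exactly up to the first letter of the path. -/
theorem eps_prefix_eq {τ τ' X X' : List (σ × Option α × σ)} {e e' : σ × Option α × σ}
    (hτ : pathLabel τ = []) (hτ' : pathLabel τ' = []) (he : e.2.1 ≠ none) (he' : e'.2.1 ≠ none)
    (h : τ ++ e :: X = τ' ++ e' :: X') : τ = τ' := by
  rcases List.append_eq_append_iff.1 h with ⟨δ, rfl, h'⟩ | ⟨δ, rfl, h'⟩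
  · cases δ with
    | nil => simp
    | cons y δ =>
      obtain ⟨rfl, -⟩ := List.cons.inj h'
      exact absurd (pathLabel_eq_nil_iff.1 hτ' e (by simp)) he
  · cases δ with
    | nil => simp
    | cons y δ =>
      obtain ⟨rfl, -⟩ := List.cons.inj h'
      exact absurd (pathLabel_eq_nil_iff.1 hτ e' (by simp)) he'

/-- Two such cycles flatten to cycles of `M` at the origin of `s` with the same label, which
coincide. The ε-paths `r` and `r'` stand at the same place, between the same two letters. -/
theorem PolyAmbiguous.unambiguousCycles {M : εNFA α σ} (hT : M.Trim) (hM : M.EpsCycleFree)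
    (hP : M.PolyAmbiguous) : UnambiguousCycles M.epsStep := by
  -- If one of the two words is empty, then `r` and `r'` are both `s`.
  rintro (_ | ⟨a, u⟩) (_ | ⟨b, v⟩) s r r' h₁ h₁' h₂ h₂'
  · exact h₁.symm.trans h₁'
  · exact h₁.symm.trans h₁'
  · exact Eq.trans h₂ (Eq.symm h₂')
  obtain ⟨x, X, hX, hXl, hXt⟩ := wordRel_epsStep_path h₁
  obtain ⟨x', X', hX', hXl', hXt'⟩ := wordRel_epsStep_path h₁'
  obtain ⟨y, Y, hY, hYl, -⟩ := wordRel_epsStep_path h₂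
  obtain ⟨y', Y', hY', hYl', -⟩ := wordRel_epsStep_path h₂'
  have heq := hP.subsingleton_paths hT hM s.origin (a :: u ++ b :: v)
    ⟨s.isPath.append (hX.append (r.isPath.append hY)), by
      rw [pathLabel_append, pathLabel_append, pathLabel_append, s.label_eq_nil, r.label_eq_nil,
        hXl, hYl]; rfl⟩
    ⟨s.isPath.append (hX'.append (r'.isPath.append hY')), by
      rw [pathLabel_append, pathLabel_append, pathLabel_append, s.label_eq_nil, r'.label_eq_nil,
        hXl', hYl']; rfl⟩
  have heq := List.append_cancel_left heq
  have hXX := hXt.prefix_eq hXt' (hXl.trans hXl'.symm) heq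
  rw [hXX] at heq hX
  exact EpsPath.eq_of_path_eq (hX.end_unique hX')
    (eps_prefix_eq r.label_eq_nil r'.label_eq_nil (by simp) (by simp)
      (List.append_cancel_left heq))

theorem wordRel_epsStep_reach {M : εNFA α σ} {a : α} {ρ ρ' : M.EpsPath}
    (h : M.epsStep a ρ ρ') : M.Reach ρ.origin ρ'.origin :=
  Reach.trans ⟨_, ρ.isPath⟩ (.single h)

/-- If no walk uses more than `d` letter-synchronized pairs, then the ambiguity is bounded by a
polynomial of degree `d`. -/
theorem PolyAmbiguous.exists_bound [Finite α] [Finite σ] {M : εNFA α σ} (hT : M.Trim)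
    (hM : M.EpsCycleFree) (hP : M.PolyAmbiguous) {d : ℕ}
    (hd : ∀ q m, M.EndWalk (M.SyncPair 0) q m → m ≤ d) :
    ∃ h : Polynomial ℕ, M.AmbiguityBound h ∧ h.natDegree ≤ d := by
  classical
  have hfin := hM.finite_epsPath
  have := Fintype.ofFinite M.EpsPath
  -- The grade of a state of the ε-free automaton is taken at the origin of the ε-path, since the
  -- cycles built below start there and end with a letter.
  let gr : σ → ℕ := fun q => sSup {m | M.EndWalk (M.SyncPair 0) q m}
  have hbdd : ∀ q, BddAbove {m | M.EndWalk (M.SyncPair 0) q m} := fun q => ⟨d, fun m hm => hd q m hm⟩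
  have hgr : ∀ q, M.EndWalk (M.SyncPair 0) q (gr q) := fun q =>
    Nat.sSup_mem ⟨0, .nil q⟩ (hbdd q)
  obtain ⟨K, hK⟩ := exists_run_code (step := M.epsStep) (fun ρ => gr ρ.origin) d
    (fun ρ => hd _ _ (hgr _))
    (fun a ρ ρ' h => le_csSup (hbdd _) ((hgr ρ.origin).reach (wordRel_epsStep_reach h)))
    (hP.unambiguousCycles hT hM) (by
      rintro (_ | ⟨a, u⟩) s s' hne h₁ h₂ h₃
      · exact absurd h₂ hne
      obtain ⟨x, X, hX, hXl, hXt⟩ := wordRel_epsStep_path h₁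
      obtain ⟨y, Y, hY, hYl, hYt⟩ := wordRel_epsStep_path h₂
      obtain ⟨z, Z, hZ, hZl, hZt⟩ := wordRel_epsStep_path h₃
      have e1 : pathLabel (s.path ++ (s.dest, some a, x) :: X) = a :: u := by
        rw [pathLabel_append, hXl, s.label_eq_nil]; rfl
      have e2 : pathLabel (s.path ++ (s.dest, some a, y) :: Y) = a :: u := by
        rw [pathLabel_append, hYl, s.label_eq_nil]; rfl
      have e3 : pathLabel (s'.path ++ (s'.dest, some a, z) :: Z) = a :: u := by
        rw [pathLabel_append, hZl, s'.label_eq_nil]; rfl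
      -- With a common origin, both cycles would be the only one with this label, and their initial
      -- ε-paths `s` and `s'` would coincide.
      have hpq : s.origin ≠ s'.origin := by
        intro ho
        have p1 := s.isPath.append hX
        have p3 := s'.isPath.append hZ
        rw [← ho] at p3
        have := hP.subsingleton_paths hT hM s.origin _ ⟨p1, e1⟩ ⟨p3, e3⟩
        exact hne (EpsPath.eq_of_path_eq ho
          (eps_prefix_eq s.label_eq_nil s'.label_eq_nil (by simp) (by simp) this))
      have hsync : M.SyncPair 0 s.origin s'.origin :=
        ⟨hpq, _, _, _, s.isPath.append hX, s.isPath.append hY, s'.isPath.append hZ,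
          e1.trans e2.symm, e2.trans e3.symm, hXt.append_left _, hYt.append_left _,
          hZt.append_left _⟩
      exact Nat.lt_of_succ_le (le_csSup (hbdd _) ((hgr s.origin).pair hsync)))
  -- This is the number of possible codes: `K` states and `d` numbers below `|x| + 2`.
  refine ⟨Polynomial.C (Fintype.card M.EpsPath ^ K) * (Polynomial.X + Polynomial.C 2) ^ d, ?_, ?_⟩
  · intro x
    obtain ⟨code, hcode⟩ := hK x
    have hrun : ∀ π : M.successfulPaths x, ∃ f : ℕ → M.EpsPath, IsRun M.epsStep x f ∧
        (f 0).origin = π.1.1 ∧ M.flattenRun x f = π.1.2 := by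
      rintro ⟨⟨i, π⟩, -, ⟨q, -, hπ⟩, rfl⟩
      exact hπ.exists_run
    choose F hF ho hfl using hrun
    have hinj : Function.Injective fun π => code (F π) := by
      intro π π' h
      have hag := hcode _ _ (hF π) (hF π') h
      refine Subtype.ext (Prod.ext ?_ ?_)
      · rw [← ho π, ← ho π', hag 0 (by simp)]
      · rw [← hfl π, ← hfl π', flattenRun_congr hag]
    have h1 := ENat.card_le_card_of_injective hinj
    rw [ENat.card_coe_set_eq] at h1
    refine h1.trans_eq ?_
    rw [ENat.card_eq_coe_fintype_card]
    simp
  · refine (Polynomial.natDegree_C_mul_le _ _).trans ?_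
    refine Polynomial.natDegree_pow_le.trans ?_
    rw [Polynomial.natDegree_X_add_C, mul_one]

end εNFA

namespace εNFA

variable {α σ : Type*}

/-! ### Paths in the intersection -/

/-- Only a letter brings the filter back to its initial state. If it is there at the end, all
ε-moves after the last letter were simultaneous, so the three tails have the same length. The clause
for empty labels covers the part after the last letter in the induction. -/
theorem TransPath.inter_project {σ₁ σ₂ : Type*} {M₁ : εNFA α σ₁} {M₂ : εNFA α σ₂}
    {s s' : σ₁ × FilterState × σ₂} {π} (h : (inter M₁ M₂).TransPath s π s') :
    ∃ π₁ π₂, M₁.TransPath s.1 π₁ s'.1 ∧ M₂.TransPath s.2.2 π₂ s'.2.2 ∧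
      pathLabel π₁ = pathLabel π ∧ pathLabel π₂ = pathLabel π ∧
      (s'.2.1 = .init → pathLabel π = [] →
        s.2.1 = .init ∧ π₁.length = π.length ∧ π₂.length = π.length) ∧
      (s'.2.1 = .init → pathLabel π ≠ [] →
        ∃ T, TailLength π T ∧ TailLength π₁ T ∧ TailLength π₂ T) := by
  induction h with
  | nil s => exact ⟨[], [], .nil _, .nil _, rfl, rfl, fun h _ => ⟨h, rfl, rfl⟩, fun _ h => absurd rfl h⟩
  | @cons s r s' a π hs h ih =>
    obtain ⟨π₁, π₂, h₁, h₂, l₁, l₂, hnil, hT⟩ := ih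
    cases a with
    | some a =>
      obtain ⟨hs₁, hsf, hs₂⟩ := hs
      refine ⟨(s.1, some a, r.1) :: π₁, (s.2.2, some a, r.2.2) :: π₂, .cons hs₁ h₁, .cons hs₂ h₂,
        by simp [l₁], by simp [l₂], fun _ h => by simp at h, fun hf _ => ?_⟩
      by_cases hl : pathLabel π = []
      · obtain ⟨-, e₁, e₂⟩ := hnil hf hl
        exact ⟨π.length, ⟨[], _, π, rfl, by simp, hl, rfl⟩,
          ⟨[], _, π₁, rfl, by simp, l₁.trans hl, e₁⟩, ⟨[], _, π₂, rfl, by simp, l₂.trans hl, e₂⟩⟩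
      · obtain ⟨T, t, t₁, t₂⟩ := hT hf hl
        exact ⟨T, t.append_left [_], t₁.append_left [_], t₂.append_left [_]⟩
    | none =>
      rcases hs with ⟨hf, hrf, hs₁, hs₂⟩ | ⟨hf, hrf, hs₁, hs₂⟩ | ⟨hf, hrf, hs₁, hs₂⟩
      · refine ⟨(s.1, none, r.1) :: π₁, (s.2.2, none, r.2.2) :: π₂, .cons hs₁ h₁, .cons hs₂ h₂,
          by simp [l₁], by simp [l₂], fun hf' hl => ?_, fun hf' hl => ?_⟩
        · obtain ⟨-, e₁, e₂⟩ := hnil hf' (by simpa using hl)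
          exact ⟨hf, by simp [e₁], by simp [e₂]⟩
        · obtain ⟨T, t, t₁, t₂⟩ := hT hf' (by simpa using hl)
          exact ⟨T, t.append_left [_], t₁.append_left [_], t₂.append_left [_]⟩
      · rw [hs₂] at h₂
        refine ⟨(s.1, none, r.1) :: π₁, π₂, .cons hs₁ h₁, h₂,
          by simp [l₁], by simp [l₂], fun hf' hl => ?_, fun hf' hl => ?_⟩
        · obtain ⟨e, -⟩ := hnil hf' (by simpa using hl)
          rw [hrf] at e
          cases e
        · obtain ⟨T, t, t₁, t₂⟩ := hT hf' (by simpa using hl)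
          exact ⟨T, t.append_left [_], t₁.append_left [_], t₂⟩
      · rw [hs₁] at h₁
        refine ⟨π₁, (s.2.2, none, r.2.2) :: π₂, h₁, .cons hs₂ h₂,
          by simp [l₁], by simp [l₂], fun hf' hl => ?_, fun hf' hl => ?_⟩
        · obtain ⟨e, -⟩ := hnil hf' (by simpa using hl)
          rw [hrf] at e
          cases e
        · obtain ⟨T, t, t₁, t₂⟩ := hT hf' (by simpa using hl)
          exact ⟨T, t.append_left [_], t₁, t₂.append_left [_]⟩

/-- Projecting twice splits a path of `A³` into three paths of `M`. The tail of the middle product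
path is unique, which makes the two tail lengths agree. -/
theorem IDAPair.syncPair {M : εNFA α σ} {p q : σ} (h : M.IDAPair p q) :
    ∃ t, M.SyncPair t p q := by
  obtain ⟨hpq, π, hπ, hl⟩ := h
  obtain ⟨π₁₂, π₃, h₁₂, h₃, l₁₂, l₃, -, hT⟩ := hπ.inter_project
  obtain ⟨T, -, t₁₂, t₃⟩ := hT rfl hl
  obtain ⟨π₁, π₂, h₁, h₂, l₁, l₂, -, hT'⟩ := h₁₂.inter_project
  obtain ⟨T', t, t₁, t₂⟩ := hT' rfl (by rwa [l₁₂])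
  obtain rfl := t.unique t₁₂
  exact ⟨T', hpq, π₁, π₂, π₃, h₁, h₂, h₃, l₁.trans l₂.symm, l₂.trans (l₁₂.trans l₃.symm),
    t₁, t₂, t₃⟩

/-- Some path consisting of ε-transitions leads from `p` to `q`. -/
def EpsReach (M : εNFA α σ) (p q : σ) : Prop :=
  ∃ π, M.TransPath p π q ∧ pathLabel π = []

theorem EpsReach.refl (M : εNFA α σ) (p : σ) : M.EpsReach p p := ⟨[], .nil p, rfl⟩

theorem EpsReach.head {M : εNFA α σ} {p q r : σ} (hs : q ∈ M.step p none) (h : M.EpsReach q r) :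
    M.EpsReach p r := by
  obtain ⟨π, h, hl⟩ := h
  exact ⟨_, .cons hs h, by simpa using hl⟩

/-- `M.LetterPath p w q`: some path labelled by `w` leads from `p` to `q` and does not end with an
ε-transition. -/
inductive LetterPath (M : εNFA α σ) : σ → List α → σ → Prop
  | nil (p : σ) : LetterPath M p [] p
  | cons {p q r s : σ} {a : α} {w : List α} :
      M.EpsReach p q → r ∈ M.step q (some a) → LetterPath M r w s → LetterPath M p (a :: w) s

theorem LetterPath.exists_path {M : εNFA α σ} {p q : σ} {w : List α} (h : M.LetterPath p w q) :
    ∃ π, M.TransPath p π q ∧ pathLabel π = w := by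
  induction h with
  | nil p => exact ⟨[], .nil p, rfl⟩
  | cons he hs _ ih =>
    obtain ⟨π, hπ, hl⟩ := ih
    obtain ⟨τ, hτ, hlτ⟩ := he
    exact ⟨τ ++ _ :: π, hτ.append (.cons hs hπ), by simp [hl, hlτ]⟩

/-- An ε-transition at the front joins the ε-part before the first letter; there is a first letter
because the word ends with `a`. -/
theorem TransPath.letterPath_snoc {M : εNFA α σ} {p r s : σ} {κ : List (σ × Option α × σ)} {a : α}
    (h : M.TransPath p κ r) (hs : s ∈ M.step r (some a)) :
    M.LetterPath p (pathLabel κ ++ [a]) s := by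
  induction h with
  | nil p => exact .cons (.refl M p) hs (.nil s)
  | @cons p q r b κ hb _ ih =>
    cases b with
    | some b => simpa using LetterPath.cons (.refl M p) hb (ih hs)
    | none =>
      rw [pathLabel_cons_none]
      have h2 := ih hs
      generalize hw : pathLabel κ ++ [a] = w at h2
      cases h2 with
      | nil => simp at hw
      | cons he hs' h3 => exact .cons (he.head hb) hs' h3

theorem TailLength.letterPath {M : εNFA α σ} {p q : σ} {π : List (σ × Option α × σ)}
    (ht : TailLength π 0) (h : M.TransPath p π q) : M.LetterPath p (pathLabel π) q := by
  obtain ⟨κ, ⟨x, a, y⟩, τ, rfl, he, -, hτ⟩ := ht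
  obtain rfl := List.length_eq_zero_iff.1 hτ
  obtain ⟨r, hκ, h⟩ := transPath_append_iff.1 h
  rw [transPath_cons_iff, transPath_nil_iff] at h
  obtain ⟨rfl, hs, rfl⟩ := h
  cases a with
  | none => exact absurd rfl he
  | some a => simpa using hκ.letterPath_snoc hs

section Inter

variable {σ₁ σ₂ : Type*} {M₁ : εNFA α σ₁} {M₂ : εNFA α σ₂}

theorem inter_left {s s' : σ₁} {π} (h : M₁.TransPath s π s') (hl : pathLabel π = []) (t : σ₂)
    (f : FilterState) (hf : f ≠ .right) : ∃ f', (inter M₁ M₂).EpsReach (s, f, t) (s', f', t) := by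
  induction h generalizing f with
  | nil s => exact ⟨f, .refl _ _⟩
  | @cons s r s' a π hs _ ih =>
    obtain rfl : a = none := pathLabel_eq_nil_iff.1 hl _ List.mem_cons_self
    obtain ⟨f', h⟩ := ih (by simpa using hl) .left (by simp)
    have hstep : (r, .left, t) ∈ (inter M₁ M₂).step (s, f, t) none :=
      Or.inr (Or.inl ⟨hf, rfl, hs, rfl⟩)
    exact ⟨f', h.head hstep⟩

theorem inter_right {t t' : σ₂} {π} (h : M₂.TransPath t π t') (hl : pathLabel π = []) (s : σ₁)
    (f : FilterState) (hf : f ≠ .left) : ∃ f', (inter M₁ M₂).EpsReach (s, f, t) (s, f', t') := by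
  induction h generalizing f with
  | nil s => exact ⟨f, .refl _ _⟩
  | @cons t r t' a π hs _ ih =>
    obtain rfl : a = none := pathLabel_eq_nil_iff.1 hl _ List.mem_cons_self
    obtain ⟨f', h⟩ := ih (by simpa using hl) .right (by simp)
    have hstep : (s, .right, r) ∈ (inter M₁ M₂).step (s, f, t) none :=
      Or.inr (Or.inr ⟨hf, rfl, rfl, hs⟩)
    exact ⟨f', h.head hstep⟩

/-- Simultaneous moves are made until one ε-path is exhausted; the rest of the other one is then
followed alone. This is the order that the filter permits. -/
theorem EpsReach.inter {s s' : σ₁} {t t' : σ₂} (h₁ : M₁.EpsReach s s') (h₂ : M₂.EpsReach t t') :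
    ∃ f, (inter M₁ M₂).EpsReach (s, .init, t) (s', f, t') := by
  obtain ⟨π, h₁, l₁⟩ := h₁
  induction h₁ generalizing t with
  | nil s =>
    obtain ⟨π', h₂, l₂⟩ := h₂
    exact inter_right h₂ l₂ s .init (by simp)
  | @cons s r s' a π hs h₁ ih =>
    obtain ⟨π', h₂, l₂⟩ := h₂
    cases h₂ with
    | nil => exact inter_left (.cons hs h₁) l₁ _ .init (by simp)
    | @cons _ u _ b π' hs' h₂ =>
      obtain rfl : a = none := pathLabel_eq_nil_iff.1 l₁ _ List.mem_cons_self
      obtain rfl : b = none := pathLabel_eq_nil_iff.1 l₂ _ List.mem_cons_self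
      obtain ⟨f, h⟩ := ih ⟨π', h₂, by simpa using l₂⟩ (by simpa using l₁)
      have hstep : (r, .init, u) ∈ (εNFA.inter M₁ M₂).step (s, .init, t) none :=
        Or.inl ⟨rfl, rfl, hs, hs'⟩
      exact ⟨f, h.head hstep⟩

/-- The paths have no ε-transitions after the last letter, so the filter ends in its initial state.
-/
theorem LetterPath.inter {s s' : σ₁} {t t' : σ₂} {w : List α} (h₁ : M₁.LetterPath s w s')
    (h₂ : M₂.LetterPath t w t') :
    (inter M₁ M₂).LetterPath (s, .init, t) w (s', .init, t') := by
  induction h₁ generalizing t with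
  | nil s => cases h₂; exact .nil _
  | @cons s r u s' a w he hs _ ih =>
    cases h₂ with
    | @cons _ r' u' _ _ _ he' hs' h₂ =>
      obtain ⟨f, hf⟩ := he.inter he'
      have hstep : (u, .init, u') ∈ (εNFA.inter M₁ M₂).step (r, f, r') (some a) := ⟨hs, rfl, hs'⟩
      exact .cons hf hstep (ih h₂)

end Inter

theorem SyncPair.idaPair {M : εNFA α σ} {p q : σ} (h : M.SyncPair 0 p q) : M.IDAPair p q := by
  obtain ⟨hpq, π₁, π₂, π₃, h₁, h₂, h₃, l₁, l₂, t₁, t₂, t₃⟩ := h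
  have e₁ := t₁.letterPath h₁
  have e₂ := t₂.letterPath h₂
  have e₃ := t₃.letterPath h₃
  rw [← l₂, ← l₁] at e₃
  rw [← l₁] at e₂
  obtain ⟨π, hπ, hl⟩ := ((e₁.inter e₂).inter e₃).exists_path
  exact ⟨hpq, π, hπ, by rw [hl]; exact t₁.label_ne_nil⟩

/-! ### The component graph -/

theorem ComponentPath.append {M : εNFA α σ} {c c' c'' : M.Component} {m m' : ℕ}
    (h : M.ComponentPath c c' m) (h' : M.ComponentPath c' c'' m') :
    M.ComponentPath c c'' (m + m') := by
  induction h with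
  | nil c => simpa using h'
  | edge hs hne _ ih => exact .edge hs hne (ih h')
  | hash hp _ ih =>
    rw [Nat.add_right_comm]
    exact .hash hp (ih h')

/-- Moving inside a component needs no pairs, so a walk can always reach the state at which the next
edge starts. -/
theorem ComponentPath.endWalk {M : εNFA α σ} {c c' : M.Component} {m : ℕ}
    (h : M.ComponentPath c c' m) {p : σ} {d : ℕ} (hp : M.component p = c)
    (hw : M.EndWalk M.IDAPair p d) : ∃ q, M.EndWalk M.IDAPair q (d + m) := by
  induction h generalizing p d with
  | nil c => exact ⟨p, hw⟩
  | @edge x y a c m hs _ _ ih =>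
    have hr : M.Reach p x := (Quotient.exact hp).1
    exact ih rfl ((hw.reach hr).step hs)
  | @hash x y c m hxy _ ih =>
    have hr : M.Reach p x := (Quotient.exact hp).1
    obtain ⟨q, hq⟩ := ih rfl ((hw.reach hr).pair hxy)
    exact ⟨q, by rwa [Nat.add_right_comm] at hq⟩

theorem EndWalk.componentPath {M : εNFA α σ} {q : σ} {m : ℕ} (h : M.EndWalk M.IDAPair q m) :
    ∃ c, M.ComponentPath c (M.component q) m := by
  induction h with
  | nil q => exact ⟨_, .nil _⟩
  | @step p q a d _ hs ih =>
    obtain ⟨c, hc⟩ := ih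
    by_cases hpq : M.component p = M.component q
    · exact ⟨c, hpq ▸ hc⟩
    · exact ⟨c, hc.append (.edge hs hpq (.nil _))⟩
  | pair _ hp ih =>
    obtain ⟨c, hc⟩ := ih
    exact ⟨c, hc.append (.hash hp (.nil _))⟩

/-! ### The degree as the greatest weight of a walk -/

/-- Pairs without trailing ε-transitions suffice for the upper bound, and pairs with any common
number of them give the lower bound, so `R` may be anything in between. The alternative `d = 0`
covers automata without states, where no walk exists. -/
theorem PolyAmbiguous.dpa_eq_of_isGreatest [Finite α] [Finite σ] {M : εNFA α σ} (hT : M.Trim)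
    (hM : M.EpsCycleFree) (hP : M.PolyAmbiguous) {R : σ → σ → Prop}
    (h₀ : ∀ p q, M.SyncPair 0 p q → R p q) (h₁ : ∀ p q, R p q → ∃ t, M.SyncPair t p q) {d : ℕ}
    (hd : d = 0 ∨ ∃ q, M.EndWalk R q d) (hmax : ∀ q m, M.EndWalk R q m → m ≤ d) :
    M.dpa = d := by
  refine le_antisymm ?_ (le_iInf₂ fun h hh => ?_)
  · obtain ⟨h, hh, hdeg⟩ := hP.exists_bound hT hM fun q m hw => hmax q m (hw.mono h₀)
    exact (iInf₂_le h hh).trans (by exact_mod_cast hdeg)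
  · rcases hd with rfl | ⟨q, hq⟩
    · simp
    · exact_mod_cast hq.le_natDegree hT hM hh h₁

theorem PolyAmbiguous.isGreatest_componentPath [Finite α] [Finite σ] [Nonempty σ] {M : εNFA α σ}
    (hT : M.Trim) (hM : M.EpsCycleFree) (hP : M.PolyAmbiguous) :
    ∃ d : ℕ, M.dpa = d ∧
      IsGreatest {m : ℕ | ∃ c c' : M.Component, M.ComponentPath c c' m} d := by
  classical
  obtain ⟨h, hh⟩ := id hP
  set B : Set ℕ := {m | ∃ q, M.EndWalk M.IDAPair q m} with hB
  -- Any polynomial bounding the ambiguity limits the number of pairs on a walk, so the supremum is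
  -- attained.
  have hbdd : BddAbove B := ⟨h.natDegree, by
    rintro m ⟨q, hq⟩
    exact hq.le_natDegree hT hM hh fun p q hpq => hpq.syncPair⟩
  obtain ⟨q₀⟩ := ‹Nonempty σ›
  have hmem : sSup B ∈ B := Nat.sSup_mem ⟨0, q₀, .nil q₀⟩ hbdd
  refine ⟨sSup B, hP.dpa_eq_of_isGreatest hT hM (R := M.IDAPair) (fun p q h => h.idaPair)
    (fun p q hpq => hpq.syncPair) (Or.inr hmem) (fun q m hw => le_csSup hbdd ⟨q, hw⟩), ?_, ?_⟩
  · obtain ⟨q, hq⟩ := hmem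
    obtain ⟨c, hc⟩ := hq.componentPath
    exact ⟨c, _, hc⟩
  · rintro m ⟨c, c', hc⟩
    induction c using Quotient.inductionOn with
    | _ p =>
      obtain ⟨q, hq⟩ := hc.endWalk (p := p) rfl (.nil p)
      exact le_csSup hbdd ⟨q, by simpa using hq⟩

end εNFA

namespace RAM

/-! ### A layer of named variables and arrays above the machine -/

/-- The variables of the program. -/
inductive Var
  | best | n | E | m | c | i | j | k | M | org | des | nbr | ptr | x | sp | oc | ri | lbl
  deriving DecidableEq

/-- The register holding a variable. -/
def Var.idx : Var → ℕ
  | best => 0 | n => 1 | E => 2 | m => 3 | c => 4 | i => 5 | j => 6 | k => 7 | M => 8 | org => 9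
  | des => 10 | nbr => 11 | ptr => 12 | x => 13 | sp => 14 | oc => 15 | ri => 16 | lbl => 17

/-- Registers below `39` are for variables, register `39` holds the address at which the arrays
begin, and those from `40` on are scratch. `best` lies in register `0`, where the output is
expected. -/
theorem Var.idx_lt (v : Var) : v.idx < 39 := by cases v <;> decide

theorem Var.idx_inj {v v' : Var} (h : v.idx = v'.idx) : v = v' := by
  cases v <;> cases v' <;> first | rfl | cases h

/-- The arrays of the program. -/
inductive Arr
  | src | lab | dst | hd | nx | tg | rhd | rnx | rtg | mark | rmark | stack | out | rout | grade
  deriving DecidableEq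

/-- The offset of an array. -/
def Arr.idx : Arr → ℕ
  | src => 0 | lab => 1 | dst => 2 | hd => 3 | nx => 4 | tg => 5 | rhd => 6 | rnx => 7 | rtg => 8
  | mark => 9 | rmark => 10 | stack => 11 | out => 12 | rout => 13 | grade => 14

/-- The arrays are interleaved with stride `16`, so they need no size limits and cells of different
arrays never collide. -/
theorem Arr.idx_lt (a : Arr) : a.idx < 16 := by cases a <;> decide

theorem Arr.idx_inj {a a' : Arr} (h : a.idx = a'.idx) : a = a' := by
  cases a <;> cases a' <;> first | rfl | cases h

/-- The values of the variables, the contents of the arrays, and the input. -/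
structure Store where
  reg : Var → ℕ
  arr : Arr → ℕ → ℕ
  inp : ℕ → ℕ

/-- Expressions. -/
inductive Expr
  | var (v : Var)
  | const (c : ℕ)
  | add (a b : Expr)
  | sub (a b : Expr)
  | mul (a b : Expr)
  | get (a : Arr) (e : Expr)
  | inp (e : Expr)

/-- Blocks of instructions without loops. -/
inductive Block
  | skip
  | set (v : Var) (e : Expr)
  | put (a : Arr) (i e : Expr)
  | seq (P P' : Block)
  | ite (e e' : Expr) (P P' : Block)

@[simp] def Expr.eval (s : Store) : Expr → ℕ
  | var v => s.reg v
  | const c => c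
  | add a b => a.eval s + b.eval s
  | sub a b => a.eval s - b.eval s
  | mul a b => a.eval s * b.eval s
  | get a e => s.arr a (e.eval s)
  | inp e => s.inp (e.eval s)

/-- The input is read only at addresses below `B`. -/
@[simp] def Expr.Ok (B : ℕ) (s : Store) : Expr → Prop
  | var _ => True
  | const _ => True
  | add a b => a.Ok B s ∧ b.Ok B s
  | sub a b => a.Ok B s ∧ b.Ok B s
  | mul a b => a.Ok B s ∧ b.Ok B s
  | get _ e => e.Ok B s
  | inp e => e.Ok B s ∧ e.eval s < B

/-- The effect of a block. -/
def Block.run (P : Block) (s : Store) : Store :=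
  match P with
  | skip => s
  | set v e => { s with reg := Function.update s.reg v (e.eval s) }
  | put a i e =>
      { s with arr := Function.update s.arr a (Function.update (s.arr a) (i.eval s) (e.eval s)) }
  | seq P P' => P'.run (P.run s)
  | ite e e' P P' => if e.eval s < e'.eval s then P.run s else P'.run s

/-- All assigned values are at most `V`. -/
def Block.Ok (B V : ℕ) (P : Block) (s : Store) : Prop :=
  match P with
  | skip => True
  | set _ e => e.Ok B s ∧ e.eval s ≤ V
  | put _ i e => i.Ok B s ∧ e.Ok B s ∧ e.eval s ≤ V
  | seq P P' => P.Ok B V s ∧ P'.Ok B V (P.run s)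
  | ite e e' P P' => e.Ok B s ∧ e'.Ok B s ∧
      (e.eval s < e'.eval s → P.Ok B V s) ∧ (¬ e.eval s < e'.eval s → P'.Ok B V s)

/-- All values in the store are at most `V`. -/
structure Store.Bdd (V : ℕ) (s : Store) : Prop where
  reg : ∀ v, s.reg v ≤ V
  arr : ∀ a i, s.arr a i ≤ V
  inp : ∀ i, s.inp i ≤ V

theorem Block.Ok.bdd {B V : ℕ} {P : Block} {s : Store} (h : P.Ok B V s) (hs : s.Bdd V) :
    (P.run s).Bdd V := by
  induction P generalizing s with
  | skip => exact hs
  | set v e =>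
    refine ⟨fun v' => ?_, hs.arr, hs.inp⟩
    simp only [Block.run, Function.update_apply]
    split_ifs
    · exact h.2
    · exact hs.reg _
  | put a i e =>
    refine ⟨hs.reg, fun a' i' => ?_, hs.inp⟩
    simp only [Block.run, Function.update_apply]
    split_ifs with h1
    · rw [Function.update_apply]
      split_ifs
      · exact h.2.2
      · exact hs.arr _ _
    · exact hs.arr _ _
  | seq P P' ih ih' => exact ih' h.2 (ih h.1 hs)
  | ite e e' P P' ih ih' =>
    simp only [Block.run]
    split_ifs with hc
    · exact ih (h.2.2.1 hc) hs
    · exact ih' (h.2.2.2 hc) hs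

/-- A bound for the numbers occurring in the evaluation of an expression. -/
def Expr.bd (V : ℕ) : Expr → ℕ
  | var _ => V
  | const c => c
  | add a b => a.bd V + b.bd V
  | sub a b => a.bd V + b.bd V
  | mul a b => a.bd V * b.bd V + (a.bd V + b.bd V)
  | get _ e => e.bd V * 16 + (V + 16 + V)
  | inp e => e.bd V + V

theorem Expr.eval_le_bd {V : ℕ} {s : Store} (hs : s.Bdd V) (e : Expr) : e.eval s ≤ e.bd V := by
  induction e with
  | var v => exact hs.reg v
  | const c => exact le_rfl
  | add a b iha ihb => exact Nat.add_le_add iha ihb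
  | sub a b iha ihb => simp only [eval, bd]; omega
  | mul a b iha ihb => exact (Nat.mul_le_mul iha ihb).trans (Nat.le_add_right _ _)
  | get a e ih =>
    have := hs.arr a (e.eval s)
    simp only [eval, bd]
    omega
  | inp e ih =>
    have := hs.inp (e.eval s)
    simp only [eval, bd]
    omega

/-- The address of a cell of the array `a`, the index being in the register `d`, is computed
in `d`. -/
def addr (a : Arr) (d t : ℕ) : Prog :=
  .seq (.const t 16) (.seq (.mul d d t) (.seq (.const t a.idx) (.seq (.add d d t) (.add d d 39))))

/-- The code evaluating an expression into the register `d`. -/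
def Expr.comp : Expr → ℕ → Prog
  | var v, d => .seq (.const d 0) (.add d d v.idx)
  | const c, d => .const d c
  | add a b, d => .seq (a.comp d) (.seq (b.comp (d + 1)) (.add d d (d + 1)))
  | sub a b, d => .seq (a.comp d) (.seq (b.comp (d + 1)) (.sub d d (d + 1)))
  | mul a b, d => .seq (a.comp d) (.seq (b.comp (d + 1)) (.mul d d (d + 1)))
  | get a e, d => .seq (e.comp d) (.seq (addr a d (d + 1)) (.load d d))
  | inp e, d => .seq (e.comp d) (.load d d)

def Expr.cost : Expr → ℕ
  | var _ => 2
  | const _ => 1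
  | add a b => a.cost + b.cost + 1
  | sub a b => a.cost + b.cost + 1
  | mul a b => a.cost + b.cost + 1
  | get _ e => e.cost + 6
  | inp e => e.cost + 1

/-- The state `s` of the machine represents the store `st`. -/
structure Rel (B : ℕ) (s : State) (st : Store) : Prop where
  reg : ∀ v : Var, s.reg v.idx = st.reg v
  base : s.reg 39 = B
  arr : ∀ (a : Arr) i, s.mem (i * 16 + a.idx + B) = st.arr a i
  inp : ∀ i < B, s.mem i = st.inp i

theorem Rel.congr {B : ℕ} {s s' : State} {st : Store} (h : Rel B s st)
    (hr : ∀ r < 40, s'.reg r = s.reg r) (hm : s'.mem = s.mem) : Rel B s' st where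
  reg v := by rw [hr _ (by have := v.idx_lt; omega), h.reg]
  base := by rw [hr _ (by omega), h.base]
  arr a i := by rw [hm, h.arr]
  inp i hi := by rw [hm, h.inp i hi]

theorem exec_addr {W B : ℕ} {s : State} (a : Arr) {d t : ℕ} (hd : 40 ≤ d) (hdt : d < t)
    (hB : s.reg 39 = B) (hW : s.reg d * 16 + 16 + B ≤ W) :
    ∃ s', Exec W (addr a d t) s 5 s' ∧ s'.reg d = s.reg d * 16 + a.idx + B ∧ s'.mem = s.mem ∧
      ∀ r, r ≠ d → r ≠ t → s'.reg r = s.reg r := by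
  have ha := a.idx_lt
  have h39d : (39 : ℕ) ≠ d := by omega
  have h39t : (39 : ℕ) ≠ t := by omega
  refine ⟨_, .seq (.const _ _ _ (by omega)) (.seq (.mul _ _ _ _ ?_) (.seq (.const _ _ _ (by omega))
    (.seq (.add _ _ _ _ ?_) (.add _ _ _ _ ?_)))), ?_, rfl, ?_⟩
  · simp [State.setReg, hdt.ne]; omega
  · simp [State.setReg, hdt.ne]; omega
  · simp [State.setReg, hdt.ne, h39d, h39t, hB]; omega
  · simp [State.setReg, hdt.ne, h39d, h39t, hB]
  · intro r hrd hrt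
    simp [State.setReg, hrd, hrt]

/-- Evaluation into `d` leaves all registers below `d` unchanged, so the first operand survives in
`d` while the second is computed in `d + 1`. -/
theorem Expr.exec_comp {W B V : ℕ} {st : Store} (hst : st.Bdd V) (hBV : B ≤ V) (e : Expr)
    (he : e.Ok B st) (hW : e.bd V ≤ W) {s : State} (hR : Rel B s st) {d : ℕ} (hd : 40 ≤ d) :
    ∃ s', Exec W (e.comp d) s e.cost s' ∧ s'.reg d = e.eval st ∧ s'.mem = s.mem ∧
      ∀ r < d, s'.reg r = s.reg r := by
  have hle := fun e : Expr => e.eval_le_bd hst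
  have bin : ∀ {a b : Expr}, (∀ {s : State}, Rel B s st → ∀ {d : ℕ}, 40 ≤ d →
      ∃ s', Exec W (a.comp d) s a.cost s' ∧ s'.reg d = a.eval st ∧ s'.mem = s.mem ∧
      ∀ r < d, s'.reg r = s.reg r) → (∀ {s : State}, Rel B s st → ∀ {d : ℕ}, 40 ≤ d →
      ∃ s', Exec W (b.comp d) s b.cost s' ∧ s'.reg d = b.eval st ∧ s'.mem = s.mem ∧
      ∀ r < d, s'.reg r = s.reg r) → ∀ {s : State}, Rel B s st → ∀ {d : ℕ}, 40 ≤ d →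
      ∃ s' s'', Exec W (a.comp d) s a.cost s' ∧ Exec W (b.comp (d + 1)) s' b.cost s'' ∧
      s''.reg d = a.eval st ∧ s''.reg (d + 1) = b.eval st ∧ s''.mem = s.mem ∧
      ∀ r < d, s''.reg r = s.reg r := by
    intro a b iha ihb s hR d hd
    obtain ⟨s', h1, h2, h3, h4⟩ := iha hR hd
    obtain ⟨s'', h1', h2', h3', h4'⟩ := ihb (hR.congr (fun r hr => h4 r (by omega)) h3)
      (d := d + 1) (by omega)
    exact ⟨s', s'', h1, h1', by rw [h4' d (by omega), h2], h2', h3'.trans h3,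
      fun r hr => (h4' r (by omega)).trans (h4 r hr)⟩
  induction e generalizing s d with
  | var v =>
    have hne : v.idx ≠ d := by have := v.idx_lt; omega
    refine ⟨_, .seq (.const _ _ _ (Nat.zero_le _)) (.add _ _ _ _ ?_), ?_, rfl, fun r hr => ?_⟩
    · simpa [State.setReg, hne, hR.reg] using (hst.reg v).trans hW
    · simp [State.setReg, hne, hR.reg]
    · simp [State.setReg, hr.ne]
  | const c =>
    exact ⟨_, .const _ _ _ hW, by simp [State.setReg], rfl, fun r hr => by
      simp [State.setReg, hr.ne]⟩
  | add a b iha ihb =>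
    obtain ⟨s', s'', h1, h1', h2, h2', h3, h4⟩ :=
      bin (fun h => iha he.1 ((Nat.le_add_right _ _).trans hW) h)
        (fun h => ihb he.2 ((Nat.le_add_left _ _).trans hW) h) hR hd
    have hb := hle (.add a b)
    rw [Expr.eval] at hb
    have hex := Exec.seq h1 (.seq h1' (.add s'' d d (d + 1) (by rw [h2, h2']; omega)))
    rw [← add_assoc] at hex
    exact ⟨_, hex, by simp [State.setReg, h2, h2'], h3, fun r hr => by
      simp [State.setReg, hr.ne, h4 r hr]⟩
  | sub a b iha ihb =>
    obtain ⟨s', s'', h1, h1', h2, h2', h3, h4⟩ :=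
      bin (fun h => iha he.1 ((Nat.le_add_right _ _).trans hW) h)
        (fun h => ihb he.2 ((Nat.le_add_left _ _).trans hW) h) hR hd
    have hb := hle (.sub a b)
    rw [Expr.eval] at hb
    have hex := Exec.seq h1 (.seq h1' (.sub s'' d d (d + 1) (by rw [h2, h2']; omega)))
    rw [← add_assoc] at hex
    exact ⟨_, hex, by simp [State.setReg, h2, h2'], h3, fun r hr => by
      simp [State.setReg, hr.ne, h4 r hr]⟩
  | mul a b iha ihb =>
    have hb := hle (.mul a b)
    rw [Expr.eval] at hb
    have hW' := hW
    rw [bd] at hW'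
    obtain ⟨s', s'', h1, h1', h2, h2', h3, h4⟩ :=
      bin (fun h => iha he.1 (by omega) h) (fun h => ihb he.2 (by omega) h) hR hd
    have hex := Exec.seq h1 (.seq h1' (.mul s'' d d (d + 1) (by rw [h2, h2']; omega)))
    rw [← add_assoc] at hex
    exact ⟨_, hex, by simp [State.setReg, h2, h2'], h3, fun r hr => by
      simp [State.setReg, hr.ne, h4 r hr]⟩
  | get a e ih =>
    have hb := hle e
    rw [bd] at hW
    obtain ⟨s', h1, h2, h3, h4⟩ := ih he (by omega) hR hd
    have hB' : s'.reg 39 = B := by rw [h4 _ (by omega), hR.base]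
    obtain ⟨s'', g1, g2, g3, g4⟩ := exec_addr (W := W) a hd (Nat.lt_succ_self d) hB' (by
      rw [h2]; omega)
    have hval : s''.mem (s''.reg d) = st.arr a (e.eval st) := by
      rw [g3, h3, g2, h2, hR.arr]
    have hv := hst.arr a (e.eval st)
    have ha := a.idx_lt
    refine ⟨_, .seq h1 (.seq g1 (.load _ _ _ ?_ ?_)), ?_, ?_, fun r hr => ?_⟩
    · rw [g2, h2]; omega
    · rw [hval]; omega
    · simp [State.setReg, hval]
    · simp [State.setReg, g3, h3]
    · simp [State.setReg, hr.ne, g4 r hr.ne (by omega), h4 r hr]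
  | inp e ih =>
    have hb := hle e
    rw [bd] at hW
    obtain ⟨s', h1, h2, h3, h4⟩ := ih he.1 (by omega) hR hd
    have hval : s'.mem (s'.reg d) = st.inp (e.eval st) := by
      rw [h3, h2, hR.inp _ he.2]
    have hv := hst.inp (e.eval st)
    refine ⟨_, .seq h1 (.load _ _ _ ?_ ?_), ?_, ?_, fun r hr => ?_⟩
    · rw [h2]; omega
    · rw [hval]; omega
    · simp [State.setReg, hval]
    · simp [State.setReg, h3]
    · simp [State.setReg, hr.ne, h4 r hr]

/-- The code evaluating two expressions into the registers `40` and `41`. -/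
def comp₂ (e e' : Expr) : Prog := .seq (e.comp 40) (e'.comp 41)

theorem exec_comp₂ {W B V : ℕ} {st : Store} (hst : st.Bdd V) (hBV : B ≤ V) {e e' : Expr}
    (he : e.Ok B st) (he' : e'.Ok B st) (hW : e.bd V + e'.bd V ≤ W) {s : State}
    (hR : Rel B s st) :
    ∃ s', Exec W (comp₂ e e') s (e.cost + e'.cost) s' ∧ s'.reg 40 = e.eval st ∧
      s'.reg 41 = e'.eval st ∧ s'.mem = s.mem ∧ Rel B s' st := by
  obtain ⟨s', h1, h2, h3, h4⟩ := e.exec_comp (W := W) hst hBV he (by omega) hR (d := 40)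
    (by omega)
  obtain ⟨s'', h1', h2', h3', h4'⟩ := e'.exec_comp hst hBV he' (by omega : e'.bd V ≤ W)
    (hR.congr h4 h3) (d := 41) (by omega)
  exact ⟨s'', .seq h1 h1', by rw [h4' 40 (by omega), h2], h2', h3'.trans h3,
    hR.congr (fun r hr => (h4' r (by omega)).trans (h4 r hr)) (h3'.trans h3)⟩

/-- The code of a block. -/
def Block.comp : Block → Prog
  | skip => .skip
  | set v e => .seq (e.comp 40) (.seq (.const 41 0) (.add v.idx 40 41))
  | put a i e => .seq (comp₂ i e) (.seq (addr a 40 42) (.store 40 41))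
  | seq P P' => .seq P.comp P'.comp
  | ite e e' P P' => .seq (comp₂ e e') (.ite 40 41 P.comp P'.comp)

def Block.cost : Block → ℕ
  | skip => 1
  | set _ e => e.cost + 2
  | put _ i e => i.cost + e.cost + 6
  | seq P P' => P.cost + P'.cost
  | ite e e' P P' => e.cost + e'.cost + (P.cost + P'.cost + 1)

def Block.bd (V : ℕ) : Block → ℕ
  | skip => 0
  | set _ e => e.bd V
  | put _ i e => (i.bd V + e.bd V) * 16 + 16 + V
  | seq P P' => P.bd V + P'.bd V
  | ite e e' P P' => e.bd V + e'.bd V + (P.bd V + P'.bd V)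

/-- A block has no loops, so its cost is a constant and the numbers occurring in it are bounded by a
fixed expression in `V`. -/
theorem Block.exec_comp {W B V : ℕ} (hBV : B ≤ V) (P : Block) (hW : P.bd V ≤ W) {st : Store}
    (hst : st.Bdd V) (hP : P.Ok B V st) {s : State} (hR : Rel B s st) :
    ∃ t s', Exec W P.comp s t s' ∧ t ≤ P.cost ∧ Rel B s' (P.run st) := by
  induction P generalizing s st with
  | skip => exact ⟨1, s, .skip s, le_rfl, hR⟩
  | set v e =>
    obtain ⟨s', h1, h2, h3, h4⟩ := e.exec_comp hst hBV hP.1 hW hR (d := 40) (by omega)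
    have hv := v.idx_lt
    have hb := e.eval_le_bd hst
    have hW' : e.bd V ≤ W := hW
    refine ⟨_, _, .seq h1 (.seq (.const _ _ _ (Nat.zero_le _)) (.add _ _ _ _ ?_)), le_rfl, ?_⟩
    · simp [State.setReg, h2]; omega
    · refine ⟨fun v' => ?_, ?_, fun a i => ?_, fun i hi => ?_⟩
      · have hv' := v'.idx_lt
        by_cases hvv : v' = v
        · subst hvv; simp [State.setReg, Block.run, h2]
        · have : v'.idx ≠ v.idx := fun h => hvv (Var.idx_inj h)
          have h41 : v'.idx ≠ 41 := by omega
          simp [State.setReg, Block.run, hvv, this, h41, h4 _ (by omega : v'.idx < 40), hR.reg]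
      · have : (39 : ℕ) ≠ v.idx := by omega
        simp [State.setReg, this, h4, hR.base]
      · simp [State.setReg, Block.run, h3, hR.arr]
      · simp [State.setReg, Block.run, h3, hR.inp i hi]
  | put a i e =>
    obtain ⟨hi, he, hV⟩ := hP
    rw [bd] at hW
    have hbi := i.eval_le_bd hst
    have hbe := e.eval_le_bd hst
    obtain ⟨s', h1, h2, h3, h4, hR'⟩ := exec_comp₂ hst hBV hi he (by omega) hR (W := W)
    obtain ⟨s'', g1, g2, g3, g4⟩ := exec_addr (W := W) a le_rfl (by omega : 40 < 42)
      hR'.base (by omega)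
    have ha := a.idx_lt
    have g41 : s''.reg 41 = e.eval st := by rw [g4 _ (by omega) (by omega), h3]
    refine ⟨_, _, .seq h1 (.seq g1 (.store _ _ _ ?_ ?_)), le_rfl, ?_⟩
    · rw [g2, h2]; omega
    · rw [g41]; omega
    · refine ⟨fun v' => ?_, ?_, fun a' i' => ?_, fun i' hi' => ?_⟩
      · have hv' := v'.idx_lt
        simp only [State.setMem, Block.run]
        rw [g4 _ (by omega) (by omega), hR'.reg]
      · simp only [State.setMem]
        rw [g4 _ (by omega) (by omega), hR'.base]
      · have ha' := a'.idx_lt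
        simp only [State.setMem, Block.run, g2, h2, g3, g41, Function.update_apply, hR'.arr]
        by_cases haa : a' = a
        · subst haa
          by_cases hii : i' = i.eval st
          · subst hii; simp
          · simp [hii]
        · have : ¬ (i' * 16 + a'.idx + B = i.eval st * 16 + a.idx + B) := by
            intro h
            have : a'.idx = a.idx := by omega
            exact haa (Arr.idx_inj this)
          simp only [this, haa, if_false]
      · have : ¬ (i' = i.eval st * 16 + a.idx + B) := by omega
        simp only [State.setMem, Block.run, g2, h2, g3, Function.update_apply, this, if_false]
        rw [hR'.inp i' hi']
  | seq P P' ih ih' =>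
    rw [bd] at hW
    obtain ⟨t, s', h1, h2, h3⟩ := ih (by omega) hst hP.1 hR
    obtain ⟨t', s'', h1', h2', h3'⟩ := ih' (by omega) (hP.1.bdd hst) hP.2 h3
    exact ⟨_, _, .seq h1 h1', Nat.add_le_add h2 h2', h3'⟩
  | ite e e' P P' ih ih' =>
    rw [bd] at hW
    obtain ⟨he, he', hP1, hP2⟩ := hP
    obtain ⟨s', h1, h2, h3, h4, hR'⟩ := exec_comp₂ hst hBV he he' (by omega) hR (W := W)
    by_cases hc : e.eval st < e'.eval st
    · obtain ⟨t, s'', g1, g2, g3⟩ := ih (by omega) hst (hP1 hc) hR'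
      exact ⟨_, _, .seq h1 (.ite_true (by rwa [h2, h3]) g1), by simp only [cost]; omega,
        by simpa [Block.run, hc] using g3⟩
    · obtain ⟨t, s'', g1, g2, g3⟩ := ih' (by omega) hst (hP2 hc) hR'
      exact ⟨_, _, .seq h1 (.ite_false (by rwa [h2, h3]) g1), by simp only [cost]; omega,
        by simpa [Block.run, hc] using g3⟩

/-! ### Programs with loops and their running time -/

/-- Programs: blocks, and loops whose bodies are blocks. -/
inductive Code
  | block (P : Block)
  | loop (e e' : Expr) (P : Block)
  | seq (P P' : Code)

/-- The machine loop compares two registers, so both sides of the condition are evaluated into `40`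
and `41` before the loop and again after each pass. -/
def Code.comp : Code → Prog
  | block P => P.comp
  | loop e e' P => .seq (comp₂ e e') (.while 40 41 (.seq P.comp (comp₂ e e')))
  | seq P P' => .seq P.comp P'.comp

def Code.bd (V : ℕ) : Code → ℕ
  | block P => P.bd V
  | loop e e' P => e.bd V + e'.bd V + P.bd V
  | seq P P' => P.bd V + P'.bd V

/-- On words up to `W`, started in the store `st`, the program halts after at most `T` steps in a
store satisfying `Q`. -/
def Code.Runs (B V W : ℕ) (P : Code) (st : Store) (T : ℕ) (Q : Store → Prop) : Prop :=
  ∀ s, Rel B s st → ∃ t s' st', Exec W P.comp s t s' ∧ t ≤ T ∧ Rel B s' st' ∧ st'.Bdd V ∧ Q st'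

theorem Code.Runs.seq {B V W : ℕ} {P P' : Code} {st : Store} {T T' : ℕ} {Q Q' : Store → Prop}
    (h : P.Runs B V W st T Q) (h' : ∀ st', st'.Bdd V → Q st' → P'.Runs B V W st' T' Q') :
    (Code.seq P P').Runs B V W st (T + T') Q' := by
  intro s hR
  obtain ⟨t, s', st', h1, h2, h3, h4, h5⟩ := h s hR
  obtain ⟨t', s'', st'', g1, g2, g3, g4, g5⟩ := h' st' h4 h5 s' h3
  exact ⟨_, _, _, .seq h1 g1, Nat.add_le_add h2 g2, g3, g4, g5⟩

theorem Code.Runs.block {B V W : ℕ} (hBV : B ≤ V) {P : Block} (hW : P.bd V ≤ W) {st : Store}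
    (hst : st.Bdd V) (hP : P.Ok B V st) {Q : Store → Prop} (hQ : Q (P.run st)) :
    (Code.block P).Runs B V W st P.cost Q := by
  intro s hR
  obtain ⟨t, s', h1, h2, h3⟩ := P.exec_comp hBV hW hst hP hR
  exact ⟨t, s', _, h1, h2, h3, hP.bdd hst, hQ⟩

/-- The first argument of the invariant strictly decreases, so there are at most `N` passes, each of
constant cost; the extra one pays for the first evaluation and the last test. -/
theorem Code.Runs.loop {B V W : ℕ} (hBV : B ≤ V) {e e' : Expr} {P : Block}
    (hW : e.bd V + e'.bd V + P.bd V ≤ W) (I : ℕ → Store → Prop)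
    (he : ∀ st, e.Ok B st ∧ e'.Ok B st)
    (hI : ∀ m st, st.Bdd V → I m st → e.eval st < e'.eval st →
      P.Ok B V st ∧ ∃ m' < m, I m' (P.run st))
    {st : Store} (hst : st.Bdd V) {N : ℕ} (h0 : I N st) :
    (Code.loop e e' P).Runs B V W st ((N + 1) * (P.cost + (e.cost + e'.cost) + 1))
      (fun st' => (∃ m, I m st') ∧ ¬ e.eval st' < e'.eval st') := by
  have key : ∀ (N m : ℕ) (st : Store) (s : State), m ≤ N → st.Bdd V → I m st → Rel B s st →
      s.reg 40 = e.eval st → s.reg 41 = e'.eval st → ∃ t s' st',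
      Exec W (.while 40 41 (.seq P.comp (comp₂ e e'))) s t s' ∧
      t ≤ N * (P.cost + (e.cost + e'.cost) + 1) + 1 ∧ Rel B s' st' ∧ st'.Bdd V ∧
      (∃ m, I m st') ∧ ¬ e.eval st' < e'.eval st' := by
    intro N
    induction N with
    | zero =>
      intro m st s hm hst h0 hR h40 h41
      by_cases hc : e.eval st < e'.eval st
      · obtain ⟨m', hm', -⟩ := (hI m st hst h0 hc).2
        omega
      · exact ⟨1, s, st, .while_false (by rwa [h40, h41]), by omega, hR, hst, ⟨m, h0⟩, hc⟩
    | succ N ih =>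
      intro m st s hm hst h0 hR h40 h41
      by_cases hc : e.eval st < e'.eval st
      · obtain ⟨hok, m', hm', hI'⟩ := hI m st hst h0 hc
        obtain ⟨t, s', h1, h2, h3⟩ := P.exec_comp hBV (by omega) hst hok hR (W := W)
        obtain ⟨s'', g1, g2, g3, g4, g5⟩ := exec_comp₂ (hok.bdd hst) hBV (he _).1 (he _).2
          (by omega : _ ≤ W) h3
        obtain ⟨t', s₃, st₃, k1, k2, k3⟩ :=
          ih m' (P.run st) s'' (by omega) (hok.bdd hst) hI' g5 g2 g3
        refine ⟨_, s₃, st₃, .while_true (by rwa [h40, h41]) (.seq h1 g1) k1, ?_, k3⟩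
        rw [Nat.succ_mul]
        omega
      · exact ⟨1, s, st, .while_false (by rwa [h40, h41]), by omega, hR, hst, ⟨m, h0⟩, hc⟩
  intro s hR
  obtain ⟨s', g1, g2, g3, g4, g5⟩ := exec_comp₂ hst hBV (he _).1 (he _).2 (by omega : _ ≤ W) hR
  obtain ⟨t, s₃, st₃, k1, k2, k3, k4, k5⟩ := key N N st s' le_rfl hst h0 g5 g2 g3
  refine ⟨_, s₃, st₃, .seq g1 k1, ?_, k3, k4, k5⟩
  rw [Nat.succ_mul]
  omega

/-! ### Polynomial bounds for the word size -/

/-- Polynomially bounded functions. -/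
def PolyBounded (f : ℕ → ℕ) : Prop := ∃ C, ∀ N, 1 ≤ N → f N ≤ C * N ^ C

/-- For `N ≥ 1` the coefficient and the exponent may both be enlarged to the common value `a + b`.
-/
theorem PolyBounded.of_le {f : ℕ → ℕ} (a b : ℕ) (h : ∀ N, 1 ≤ N → f N ≤ a * N ^ b) :
    PolyBounded f :=
  ⟨a + b, fun N hN => (h N hN).trans
    (Nat.mul_le_mul (Nat.le_add_right _ _) (Nat.pow_le_pow_right hN (Nat.le_add_left _ _)))⟩

theorem PolyBounded.const (c : ℕ) : PolyBounded fun _ => c := .of_le c 0 (by simp)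

theorem PolyBounded.add {f g : ℕ → ℕ} (hf : PolyBounded f) (hg : PolyBounded g) :
    PolyBounded fun N => f N + g N := by
  obtain ⟨C, hC⟩ := hf
  obtain ⟨D, hD⟩ := hg
  refine .of_le (C + D) (C + D) fun N hN => ?_
  rw [add_mul]
  exact Nat.add_le_add
    ((hC N hN).trans (Nat.mul_le_mul_left _ (Nat.pow_le_pow_right hN (Nat.le_add_right _ _))))
    ((hD N hN).trans (Nat.mul_le_mul_left _ (Nat.pow_le_pow_right hN (Nat.le_add_left _ _))))

theorem PolyBounded.mul {f g : ℕ → ℕ} (hf : PolyBounded f) (hg : PolyBounded g) :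
    PolyBounded fun N => f N * g N := by
  obtain ⟨C, hC⟩ := hf
  obtain ⟨D, hD⟩ := hg
  refine .of_le (C * D) (C + D) fun N hN => ?_
  calc f N * g N ≤ (C * N ^ C) * (D * N ^ D) := Nat.mul_le_mul (hC N hN) (hD N hN)
    _ = _ := by rw [pow_add]; ring

theorem PolyBounded.expr {V : ℕ → ℕ} (hV : PolyBounded V) (e : Expr) :
    PolyBounded fun N => e.bd (V N) := by
  induction e with
  | var v => exact hV
  | const c => exact .const c
  | add a b iha ihb => exact iha.add ihb
  | sub a b iha ihb => exact iha.add ihb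
  | mul a b iha ihb => exact (iha.mul ihb).add (iha.add ihb)
  | get a e ih => exact (ih.mul (.const 16)).add ((hV.add (.const 16)).add hV)
  | inp e ih => exact ih.add hV

theorem PolyBounded.block {V : ℕ → ℕ} (hV : PolyBounded V) (P : Block) :
    PolyBounded fun N => P.bd (V N) := by
  induction P with
  | skip => exact .const 0
  | set v e => exact hV.expr e
  | put a i e => exact ((((hV.expr i).add (hV.expr e)).mul (.const 16)).add (.const 16)).add hV
  | seq P P' ih ih' => exact ih.add ih'
  | ite e e' P P' ih ih' => exact ((hV.expr e).add (hV.expr e')).add (ih.add ih')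

theorem PolyBounded.code {V : ℕ → ℕ} (hV : PolyBounded V) (P : Code) :
    PolyBounded fun N => P.bd (V N) := by
  induction P with
  | block P => exact hV.block P
  | loop e e' P => exact ((hV.expr e).add (hV.expr e')).add (hV.block P)
  | seq P P' ih ih' => exact ih.add ih'

end RAM

/-! ### Depth-first search -/

namespace DFS

/-- Reachability in the graph with the list `G` of edges. -/
def Reach (G : List (ℕ × ℕ)) : ℕ → ℕ → Prop :=
  Relation.ReflTransGen fun u v => (u, v) ∈ G

/-- The state of a depth-first search: the roots still to be tried, the stack, the marks of the
visited vertices, the edges still to be followed, the finished vertices (the last one first), and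
the current mark. -/
structure St where
  roots : List ℕ
  stack : List ℕ
  mark : ℕ → ℕ
  rem : ℕ → List ℕ
  out : List ℕ
  lbl : ℕ

/-- One step of a depth-first search. -/
def St.step (s : St) : St :=
  match s.stack with
  | [] =>
    match s.roots with
    | [] => s
    | r :: rs =>
      if s.mark r = 0 then
        { s with roots := rs, stack := [r], mark := Function.update s.mark r (r + 1), lbl := r + 1 }
      else { s with roots := rs }
  | v :: st =>
    match s.rem v with
    | [] => { s with stack := st, out := v :: s.out }
    | w :: l =>
      if s.mark w = 0 then
        { s with
          stack := w :: v :: st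
          rem := Function.update s.rem v l
          mark := Function.update s.mark w s.lbl }
      else { s with rem := Function.update s.rem v l }

open Classical in
/-- The first vertex of `P` from which `v` is reachable. -/
noncomputable def firstRoot (G : List (ℕ × ℕ)) (P : List ℕ) (v : ℕ) : Option ℕ :=
  P.find? fun r => decide (Reach G r v)

/-- `u` and `v` are strongly connected. -/
def Scc (G : List (ℕ × ℕ)) (u v : ℕ) : Prop := Reach G u v ∧ Reach G v u

/-- The invariant of a depth-first search, `P` being the list of the roots tried so far. -/
structure Inv (G : List (ℕ × ℕ)) (P : List ℕ) (s : St) : Prop where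
  mark_iff : ∀ v, s.mark v ≠ 0 ↔ v ∈ s.stack ∨ v ∈ s.out
  disj : ∀ v ∈ s.stack, v ∉ s.out
  nodup : s.stack.Nodup
  edge : ∀ v x, (v, x) ∈ G → x ∈ s.rem v ∨ s.mark x ≠ 0
  done : ∀ v ∈ s.out, s.rem v = []
  rem_edge : ∀ v, ∀ x ∈ s.rem v, (v, x) ∈ G
  path : s.stack.Pairwise fun a b => Reach G b a
  label : ∀ v, s.mark v ≠ 0 → ∃ r, s.mark v = r + 1 ∧ firstRoot G P v = some r
  current : s.stack ≠ [] → ∃ P' r, P = P' ++ [r] ∧ s.lbl = r + 1 ∧ (∀ v ∈ s.stack, Reach G r v) ∧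
    ∀ r' ∈ P', ∀ x, Reach G r' x → s.mark x ≠ 0
  roots : ∀ r ∈ P, s.mark r ≠ 0
  escape : ∀ w ∈ s.out, ∀ y, Reach G w y → y ∉ s.out → ∃ z ∈ s.stack, Scc G w z
  order : ∀ l₁ v l₂, s.out = l₁ ++ v :: l₂ → ∀ w ∈ s.out, Reach G w v →
    ∃ w', Scc G w w' ∧ (w' ∈ s.stack ∨ w' ∈ l₁ ∨ w' = v)

/-- With an empty stack all marked vertices are finished, and no edge of theirs remains to be
followed. -/
theorem Inv.closed {G : List (ℕ × ℕ)} {P : List ℕ} {s : St} (h : Inv G P s) (hs : s.stack = [])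
    {v x : ℕ} (hv : s.mark v ≠ 0) (hx : Reach G v x) : s.mark x ≠ 0 := by
  induction hx with
  | refl => exact hv
  | @tail b c _ hbc ih =>
    have hb : b ∈ s.out := by simpa [hs] using (h.mark_iff b).1 ih
    simpa [h.done b hb] using h.edge b c hbc

theorem firstRoot_append_singleton_of_some {G : List (ℕ × ℕ)} {P : List ℕ} {v r r' : ℕ}
    (h : firstRoot G P v = some r) : firstRoot G (P ++ [r']) v = some r := by
  unfold firstRoot at h ⊢
  rw [List.find?_append, h]
  rfl

theorem firstRoot_append_singleton {G : List (ℕ × ℕ)} {P : List ℕ} {v r : ℕ}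
    (h : ∀ r' ∈ P, ¬ Reach G r' v) (hr : Reach G r v) : firstRoot G (P ++ [r]) v = some r := by
  unfold firstRoot
  rw [List.find?_append, List.find?_eq_none.2 (by simpa using h)]
  simp [hr]

/-- The marked vertices are closed under reachability at this moment, so an unmarked `r` is not
reachable from earlier roots and is its own first root. A root that is already marked changes no
label, as earlier roots take precedence. -/
theorem Inv.step_root {G : List (ℕ × ℕ)} {P : List ℕ} {s : St} (h : Inv G P s)
    (hs : s.stack = []) {r : ℕ} {rs : List ℕ} (hr : s.roots = r :: rs) :
    Inv G (P ++ [r]) s.step := by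
  have hclosed := fun {v x} => h.closed hs (v := v) (x := x)
  by_cases hm : s.mark r = 0
  · have hstep : s.step = { s with
        roots := rs, stack := [r], mark := Function.update s.mark r (r + 1), lbl := r + 1 } := by
      simp [St.step, hs, hr, hm]
    have hmark : ∀ x, s.mark x ≠ 0 → Function.update s.mark r (r + 1) x ≠ 0 := by
      intro x hx
      rw [Function.update_apply]
      split_ifs <;> simp [hx]
    have hrout : r ∉ s.out := fun h' => (h.mark_iff r).2 (Or.inr h') hm
    have hnr : ∀ r' ∈ P, ¬ Reach G r' r := fun r' hr' hre => hclosed (h.roots r' hr') hre hm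
    rw [hstep]
    refine ⟨fun v => ?_, ?_, by simp, fun v x hvx => ?_, h.done, h.rem_edge, by simp, fun v hv => ?_,
      fun _ => ⟨P, r, rfl, rfl, ?_, fun r' hr' x hx => hmark x (hclosed (h.roots r' hr') hx)⟩,
      fun r' hr' => ?_, fun w hw y hwy hy => ?_, fun l₁ v l₂ hl w hw hwv => ?_⟩
    · have := h.mark_iff v
      rw [hs] at this
      by_cases hv : v = r
      · simp [hv]
      · simpa [Function.update_apply, hv] using this
    · intro v hv
      obtain rfl : v = r := by simpa using hv
      exact hrout
    · exact (h.edge v x hvx).imp_right (hmark x)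
    · by_cases hvr : v = r
      · subst hvr
        exact ⟨v, by simp, firstRoot_append_singleton hnr .refl⟩
      · simp only [Function.update_apply, hvr, if_false] at hv ⊢
        obtain ⟨r', h1, h2⟩ := h.label v hv
        exact ⟨r', h1, firstRoot_append_singleton_of_some h2⟩
    · intro v hv
      obtain rfl : v = r := by simpa using hv
      exact .refl
    · rcases List.mem_append.1 hr' with hr' | hr'
      · exact hmark _ (h.roots r' hr')
      · obtain rfl : r' = r := by simpa using hr'
        simp
    · obtain ⟨z, hz, -⟩ := h.escape w hw y hwy hy
      simp [hs] at hz
    · obtain ⟨w', h1, h2⟩ := h.order l₁ v l₂ hl w hw hwv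
      exact ⟨w', h1, Or.inr (by simpa [hs] using h2)⟩
  · have hstep : s.step = { s with roots := rs } := by
      simp [St.step, hs, hr, hm]
    rw [hstep]
    refine ⟨h.mark_iff, h.disj, h.nodup, h.edge, h.done, h.rem_edge, h.path, fun v hv => ?_,
      fun h' => absurd hs h', fun r' hr' => ?_, h.escape, h.order⟩
    · obtain ⟨r', h1, h2⟩ := h.label v hv
      exact ⟨r', h1, firstRoot_append_singleton_of_some h2⟩
    · rcases List.mem_append.1 hr' with hr' | hr'
      · exact h.roots r' hr'
      · obtain rfl : r' = r := by simpa using hr'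
        exact hm

/-- Everything depends on `hgst`: if the popped vertex still reaches something unfinished, it is
strongly connected to a vertex below it on the stack. -/
theorem Inv.step_pop {G : List (ℕ × ℕ)} {P : List ℕ} {s : St} (h : Inv G P s)
    {g : ℕ} {st : List ℕ} (hs : s.stack = g :: st) (hr : s.rem g = []) :
    Inv G P s.step := by
  have hstep : s.step = { s with stack := st, out := g :: s.out } := by
    simp [St.step, hs, hr]
  have hg : g ∉ s.out := h.disj g (by simp [hs])
  have hnd := h.nodup
  have hpath := h.path
  rw [hs, List.nodup_cons] at hnd
  rw [hs, List.pairwise_cons] at hpath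
  -- All edges of finished vertices and of `g` have been followed, so the first unfinished vertex on
  -- the path is marked and lies on the stack, from where `g` is reachable.
  have hgst : ∀ y, Reach G g y → y ∉ g :: s.out → ∃ z ∈ st, Scc G g z := by
    intro y hgy
    -- follow the path to the first vertex that is not finished
    have : ∀ b, b ∈ g :: s.out → Reach G g b → Reach G b y → y ∉ g :: s.out →
        ∃ z ∈ st, Reach G g z := by
      intro b hb hgb hby hy
      induction hby using Relation.ReflTransGen.head_induction_on with
      | refl => exact absurd hb hy
      | @head b c hbc _ ih =>
        by_cases hc : c ∈ g :: s.out
        · exact ih hc (hgb.tail hbc)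
        · have hrem : s.rem b = [] := by
            rcases List.mem_cons.1 hb with rfl | hb
            · exact hr
            · exact h.done b hb
          have hmc : s.mark c ≠ 0 := by simpa [hrem] using h.edge b c hbc
          have := (h.mark_iff c).1 hmc
          simp only [hs, List.mem_cons, not_or] at this hc
          exact ⟨c, by tauto, hgb.tail hbc⟩
    intro hy
    obtain ⟨z, hz, hgz⟩ := this g (by simp) .refl hgy hy
    exact ⟨z, hz, hgz, hpath.1 z hz⟩
  rw [hstep]
  refine ⟨fun v => ?_, fun v hv => ?_, hnd.2, h.edge, fun v hv => ?_, h.rem_edge, hpath.2, h.label,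
    fun hne => ?_, h.roots, fun w hw y hwy hy => ?_, fun l₁ v l₂ hl w hw hwv => ?_⟩
  · rw [h.mark_iff, hs]
    simp only [List.mem_cons]
    tauto
  · rw [List.mem_cons, not_or]
    exact ⟨fun hvg => hnd.1 (hvg ▸ hv), h.disj v (by simp [hs, hv])⟩
  · rcases List.mem_cons.1 hv with rfl | hv
    · exact hr
    · exact h.done v hv
  · obtain ⟨P', r, h1, h2, h3, h4⟩ := h.current (by simp [hs])
    exact ⟨P', r, h1, h2, fun v hv => h3 v (by simp [hs, hv]), h4⟩
  · rcases List.mem_cons.1 hw with rfl | hw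
    · exact hgst y hwy hy
    · obtain ⟨z, hz, h1, h2⟩ := h.escape w hw y hwy (fun h' => hy (List.mem_cons_of_mem _ h'))
      rw [hs] at hz
      rcases List.mem_cons.1 hz with rfl | hz
      -- The stack vertex that `w` was connected to is the popped one itself; it is replaced by one
      -- further down.
      · obtain ⟨z', hz', h3, h4⟩ := hgst y (h2.trans hwy) hy
        exact ⟨z', hz', h1.trans h3, h4.trans h2⟩
      · exact ⟨z, hz, h1, h2⟩
  · dsimp only at hl hw ⊢
    cases l₁ with
    | nil =>
      obtain ⟨rfl, -⟩ := List.cons.inj hl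
      rcases List.mem_cons.1 hw with rfl | hw
      · exact ⟨w, ⟨.refl, .refl⟩, by simp⟩
      · obtain ⟨z, hz, hwz⟩ := h.escape w hw g hwv hg
        rw [hs] at hz
        rcases List.mem_cons.1 hz with rfl | hz
        · exact ⟨z, hwz, by simp⟩
        · exact ⟨z, hwz, by simp [hz]⟩
    | cons x l₁ =>
      obtain ⟨rfl, hl'⟩ := List.cons.inj hl
      rcases List.mem_cons.1 hw with rfl | hw
      · exact ⟨w, ⟨.refl, .refl⟩, by simp⟩
      · obtain ⟨w', h1, h2⟩ := h.order l₁ v l₂ hl' w hw hwv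
        refine ⟨w', h1, ?_⟩
        rw [hs] at h2
        simp only [List.mem_cons] at h2 ⊢
        tauto

/-- Everything reachable from the earlier roots is already marked, so the current root is the first
one from which an unmarked `w` is reachable. The new stack vertex is reachable from those below it
through the followed edge. -/
theorem Inv.step_edge {G : List (ℕ × ℕ)} {P : List ℕ} {s : St} (h : Inv G P s)
    {v w : ℕ} {st l : List ℕ} (hs : s.stack = v :: st) (hr : s.rem v = w :: l) :
    Inv G P s.step := by
  have hv : v ∉ s.out := h.disj v (by simp [hs])
  have hvw : (v, w) ∈ G := h.rem_edge v w (by simp [hr])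
  have hdone : ∀ x ∈ s.out, Function.update s.rem v l x = [] := by
    intro x hx
    have : x ≠ v := fun h' => hv (h' ▸ hx)
    simpa [Function.update_apply, this] using h.done x hx
  have hrem : ∀ x, ∀ y ∈ Function.update s.rem v l x, (x, y) ∈ G := by
    intro x y hy
    by_cases hx : x = v
    · subst hx
      rw [Function.update_self] at hy
      exact h.rem_edge x y (by simp [hr, hy])
    · rw [Function.update_of_ne hx] at hy
      exact h.rem_edge x y hy
  have hedge : ∀ x y, (x, y) ∈ G → y ∈ Function.update s.rem v l x ∨ s.mark y ≠ 0 ∨ y = w := by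
    intro x y hxy
    rcases h.edge x y hxy with h' | h'
    · by_cases hx : x = v
      · subst hx
        rw [hr] at h'
        rw [Function.update_self]
        rcases List.mem_cons.1 h' with h' | h'
        · exact Or.inr (Or.inr h')
        · exact Or.inl h'
      · rw [Function.update_of_ne hx]
        exact Or.inl h'
    · exact Or.inr (Or.inl h')
  by_cases hm : s.mark w = 0
  · have hstep : s.step = { s with
        stack := w :: v :: st
        rem := Function.update s.rem v l
        mark := Function.update s.mark w s.lbl } := by
      simp [St.step, hs, hr, hm]
    obtain ⟨P', r, hP, hlbl, hreach, hP'⟩ := h.current (by simp [hs])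
    have hmark : ∀ x, s.mark x ≠ 0 → Function.update s.mark w s.lbl x ≠ 0 := by
      intro x hx
      rw [Function.update_apply]
      split_ifs <;> simp [hx, hlbl]
    have hwout : ¬ (w ∈ s.stack ∨ w ∈ s.out) := fun h' => (h.mark_iff w).2 h' hm
    rw [not_or] at hwout
    have hrw : Reach G r w := (hreach v (by simp [hs])).tail hvw
    have hpath := h.path
    rw [hstep]
    refine ⟨fun x => ?_, fun x hx => ?_, ?_, fun x y hxy => ?_, hdone, hrem, ?_, fun x hx => ?_,
      fun _ => ⟨P', r, hP, hlbl, fun x hx => ?_, fun r' hr' x hx => hmark x (hP' r' hr' x hx)⟩,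
      fun r' hr' => hmark _ (h.roots r' hr'), fun x hx y hxy hy => ?_,
      fun l₁ x l₂ hl y hy hyx => ?_⟩
    · have := h.mark_iff x
      rw [hs] at this
      by_cases hx : x = w
      · subst hx; simp [hlbl]
      · simpa [Function.update_apply, hx] using this
    · rcases List.mem_cons.1 hx with rfl | hx
      · exact hwout.2
      · exact h.disj x (by rwa [hs])
    · rw [List.nodup_cons, ← hs]
      exact ⟨hwout.1, h.nodup⟩
    · rcases hedge x y hxy with h' | h' | rfl
      · exact Or.inl h'
      · exact Or.inr (hmark y h')
      · exact Or.inr (by simp [hlbl])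
    · rw [List.pairwise_cons, ← hs]
      refine ⟨fun b hb => ?_, hpath⟩
      rw [hs] at hb hpath
      rcases List.mem_cons.1 hb with rfl | hb
      · exact .single hvw
      · exact ((List.pairwise_cons.1 hpath).1 b hb).tail hvw
    · by_cases hxw : x = w
      · subst hxw
        refine ⟨r, by simp [hlbl], ?_⟩
        rw [hP]
        exact firstRoot_append_singleton (fun r' hr' hre => hP' r' hr' _ hre hm) hrw
      · simp only [Function.update_apply, hxw, if_false] at hx ⊢
        exact h.label x hx
    · rcases List.mem_cons.1 hx with rfl | hx
      · exact hrw
      · exact hreach x (by rwa [hs])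
    · obtain ⟨z, hz, hxz⟩ := h.escape x hx y hxy hy
      exact ⟨z, by rw [hs] at hz; exact List.mem_cons_of_mem _ hz, hxz⟩
    · obtain ⟨w', h1, h2⟩ := h.order l₁ x l₂ hl y hy hyx
      refine ⟨w', h1, h2.imp_left fun h3 => ?_⟩
      rw [hs] at h3
      exact List.mem_cons_of_mem _ h3
  · have hstep : s.step = { s with rem := Function.update s.rem v l } := by
      simp [St.step, hs, hr, hm]
    rw [hstep]
    refine ⟨h.mark_iff, h.disj, h.nodup, fun x y hxy => ?_, hdone, hrem, h.path, h.label, h.current,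
      h.roots, h.escape, h.order⟩
    rcases hedge x y hxy with h' | h' | rfl
    · exact Or.inl h'
    · exact Or.inr h'
    · exact Or.inr hm

theorem Inv.step {G : List (ℕ × ℕ)} {P : List ℕ} {s : St} (h : Inv G P s) :
    ∃ P', Inv G P' s.step ∧ P' ++ s.step.roots = P ++ s.roots := by
  rcases hs : s.stack with _ | ⟨v, st⟩
  · rcases hr : s.roots with _ | ⟨r, rs⟩
    · have : s.step = s := by simp [St.step, hs, hr]
      exact ⟨P, by rwa [this], by rw [this, hr]⟩
    · refine ⟨P ++ [r], h.step_root hs hr, ?_⟩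
      have : s.step.roots = rs := by
        by_cases hm : s.mark r = 0 <;> simp [St.step, hs, hr, hm]
      simp [this]
  · rcases hr : s.rem v with _ | ⟨w, l⟩
    · exact ⟨P, h.step_pop hs hr, by simp [St.step, hs, hr]⟩
    · refine ⟨P, h.step_edge hs hr, ?_⟩
      by_cases hm : s.mark w = 0 <;> simp [St.step, hs, hr, hm]

/-- The number of edges still to be followed. -/
def St.work (N : ℕ) (s : St) : ℕ := ∑ v ∈ Finset.range N, (s.rem v).length

theorem work_update {N : ℕ} {rem : ℕ → List ℕ} {v w : ℕ} {l : List ℕ} (hv : v < N)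
    (hr : rem v = w :: l) :
    ∑ x ∈ Finset.range N, (rem x).length =
      ∑ x ∈ Finset.range N, (Function.update rem v l x).length + 1 := by
  have hmem := Finset.mem_range.2 hv
  rw [← Finset.add_sum_erase _ _ hmem, ← Finset.add_sum_erase _ (fun x => (Function.update rem v l x).length) hmem]
  have : ∑ x ∈ (Finset.range N).erase v, (Function.update rem v l x).length =
      ∑ x ∈ (Finset.range N).erase v, (rem x).length := by
    refine Finset.sum_congr rfl fun x hx => ?_
    rw [Function.update_of_ne (Finset.ne_of_mem_erase hx)]
  rw [this]
  simp [hr]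
  omega

/-- Each root or edge is used up once and pushes at most one vertex; its weight `2` pays for this
push and the later pop. The second inequality bounds the number of finished vertices. -/
theorem St.step_measure (N : ℕ) (s : St) (hN : ∀ v ∈ s.stack, v < N)
    (hs : s.roots ≠ [] ∨ s.stack ≠ []) :
    2 * s.step.roots.length + 2 * s.step.work N + s.step.stack.length <
      2 * s.roots.length + 2 * s.work N + s.stack.length ∧
    s.step.roots.length + s.step.work N + s.step.stack.length + s.step.out.length ≤
      s.roots.length + s.work N + s.stack.length + s.out.length := by
  rcases hst : s.stack with _ | ⟨v, st⟩
  · rcases hr : s.roots with _ | ⟨r, rs⟩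
    · simp [hst, hr] at hs
    · by_cases hm : s.mark r = 0
      · simp only [St.step, hst, hr, hm, if_true, St.work, List.length_cons, List.length_nil]
        omega
      · simp only [St.step, hst, hr, hm, if_false, St.work, List.length_cons, List.length_nil]
        omega
  · rcases hr : s.rem v with _ | ⟨w, l⟩
    · simp only [St.step, hst, hr, St.work, List.length_cons]
      omega
    · have hw := work_update (hN v (by simp [hst])) hr
      by_cases hm : s.mark w = 0
      · simp only [St.step, hst, hr, hm, if_true, St.work, List.length_cons]
        omega
      · simp only [St.step, hst, hr, hm, if_false, St.work, List.length_cons]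
        omega

/-- The initial state of a depth-first search. -/
def init (roots : List ℕ) (rem : ℕ → List ℕ) (lbl : ℕ) : St :=
  ⟨roots, [], fun _ => 0, rem, [], lbl⟩

theorem inv_init {G : List (ℕ × ℕ)} {roots : List ℕ} {rem : ℕ → List ℕ} {lbl : ℕ}
    (hrem : ∀ v x, x ∈ rem v ↔ (v, x) ∈ G) : Inv G [] (init roots rem lbl) where
  mark_iff := by simp [init]
  disj := by simp [init]
  nodup := by simp [init]
  edge v x h := Or.inl ((hrem v x).2 h)
  done := by simp [init]
  rem_edge v x h := (hrem v x).1 h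
  path := by simp [init]
  label := by simp [init]
  current := by simp [init]
  roots := by simp
  escape := by simp [init]
  order := by simp [init]

theorem Inv.lt_of_mark {G : List (ℕ × ℕ)} {P : List ℕ} {s : St} (h : Inv G P s) {N : ℕ}
    (hG : ∀ e ∈ G, e.1 < N ∧ e.2 < N) (hP : ∀ r ∈ P, r < N) {v : ℕ} (hv : s.mark v ≠ 0) : v < N := by
  obtain ⟨r, -, hr⟩ := h.label v hv
  have hrP : r ∈ P := List.mem_of_find?_eq_some hr
  have hreach : Reach G r v := by simpa using List.find?_some hr
  cases hreach with
  | refl => exact hP _ hrP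
  | tail _ h => exact (hG _ h).2

/-! ### Kosaraju's algorithm -/

/-- The order in which a depth-first search finishes the vertices, the last one first: a vertex
that reaches `v` is strongly connected to a vertex that comes before `v` or to `v` itself. -/
def FinishOrder (G : List (ℕ × ℕ)) (L : List ℕ) : Prop :=
  (∀ u v, u ∈ L → Reach G u v → v ∈ L) ∧
  ∀ l₁ v l₂, L = l₁ ++ v :: l₂ → ∀ w ∈ L, Reach G w v → ∃ w', Scc G w w' ∧ (w' ∈ l₁ ∨ w' = v)

theorem Inv.finishOrder {G : List (ℕ × ℕ)} {P : List ℕ} {s : St} (h : Inv G P s)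
    (hs : s.stack = []) : FinishOrder G s.out ∧ ∀ r ∈ P, r ∈ s.out := by
  have hmem : ∀ v, s.mark v ≠ 0 ↔ v ∈ s.out := fun v => by simpa [hs] using h.mark_iff v
  refine ⟨⟨fun u v hu huv => (hmem v).1 (h.closed hs ((hmem u).2 hu) huv),
    fun l₁ v l₂ hl w hw hwv => ?_⟩, fun r hr => (hmem r).1 (h.roots r hr)⟩
  obtain ⟨w', h1, h2⟩ := h.order l₁ v l₂ hl w hw hwv
  exact ⟨w', h1, by simpa [hs] using h2⟩

theorem reach_swap {G : List (ℕ × ℕ)} {u v : ℕ} :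
    Reach (G.map Prod.swap) u v ↔ Reach G v u := by
  have key : ∀ (G : List (ℕ × ℕ)) (u v : ℕ), Reach G v u → Reach (G.map Prod.swap) u v := by
    intro G u v h
    induction h with
    | refl => exact .refl
    | @tail b c _ hbc ih =>
      refine .head ?_ ih
      exact List.mem_map.2 ⟨(b, c), hbc, rfl⟩
  refine ⟨fun h => ?_, key G u v⟩
  have := key _ _ _ h
  simpa [List.map_map, Function.comp_def] using this

/-- In Kosaraju's algorithm, two vertices are marked in the same way by the second search if and
only if they are strongly connected. -/
theorem Inv.mark_eq_iff {G : List (ℕ × ℕ)} {L : List ℕ} (hL : FinishOrder G L) {s : St}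
    (h : Inv (G.map Prod.swap) L s) (hs : s.stack = []) {u v : ℕ} (hu : u ∈ L) (hv : v ∈ L) :
    s.mark u = s.mark v ↔ Scc G u v := by
  classical
  have hroot : ∀ v ∈ L, ∃ r, s.mark v = r + 1 ∧ firstRoot (G.map Prod.swap) L v = some r ∧
      Scc G v r := by
    intro v hv
    obtain ⟨r, h1, h2⟩ := h.label v (h.closed hs (h.roots v hv) .refl)
    refine ⟨r, h1, h2, ?_⟩
    obtain ⟨hr, l₁, l₂, hl, hfirst⟩ := List.find?_eq_some_iff_append.1 h2
    -- The root `r` is the first vertex of `L` that `v` reaches in `G`. The finishing order gives a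
    -- vertex strongly connected to `v` that precedes `r` or equals it; as `v` reaches that vertex,
    -- it cannot precede `r`.
    have hvr : Reach G v r := reach_swap.1 (by simpa using hr)
    obtain ⟨w', ⟨h3, h4⟩, hw'⟩ := hL.2 l₁ r l₂ hl v hv hvr
    rcases hw' with hw' | rfl
    · have := hfirst w' hw'
      simp [reach_swap, h3] at this
    · exact ⟨h3, h4⟩
  obtain ⟨r, h1, h2, h3⟩ := hroot u hu
  obtain ⟨r', h1', h2', h3'⟩ := hroot v hv
  constructor
  · intro heq
    obtain rfl : r = r' := by omega
    exact ⟨h3.1.trans h3'.2, h3'.1.trans h3.2⟩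
  · intro huv
    have : firstRoot (G.map Prod.swap) L u = firstRoot (G.map Prod.swap) L v := by
      unfold firstRoot
      congr 1
      funext r
      rw [decide_eq_decide, reach_swap, reach_swap]
      exact ⟨fun h => huv.2.trans h, fun h => huv.1.trans h⟩
    rw [h2, h2'] at this
    rw [h1, h1', Option.some.inj this]

end DFS

/-! ### The product graph -/

/-- The number of a vertex of the product graph. -/
def nodeCode (n x y z φ : ℕ) : ℕ := ((x * n + y) * n + z) * 2 + φ

theorem mul_add_inj {n a b c d : ℕ} (hb : b < n) (hd : d < n) (h : a * n + b = c * n + d) :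
    a = c ∧ b = d := by
  have hn : 0 < n := by omega
  have h1 : (n * a + b) / n = a := by
    rw [Nat.mul_add_div hn, Nat.div_eq_of_lt hb, add_zero]
  have h2 : (n * c + d) / n = c := by
    rw [Nat.mul_add_div hn, Nat.div_eq_of_lt hd, add_zero]
  have h3 : a = c := by rw [← h1, ← h2, mul_comm n a, mul_comm n c, h]
  subst h3
  exact ⟨rfl, by omega⟩

theorem nodeCode_inj {n x y z φ x' y' z' φ' : ℕ} (hy : y < n) (hz : z < n) (hφ : φ < 2)
    (hy' : y' < n) (hz' : z' < n) (hφ' : φ' < 2)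
    (h : nodeCode n x y z φ = nodeCode n x' y' z' φ') : x = x' ∧ y = y' ∧ z = z' ∧ φ = φ' := by
  unfold nodeCode at h
  obtain ⟨h1, h2⟩ : (x * n + y) * n + z = (x' * n + y') * n + z' ∧ φ = φ' := by omega
  obtain ⟨h3, h4⟩ := mul_add_inj hz hz' h1
  obtain ⟨h5, h6⟩ := mul_add_inj hy hy' h3
  exact ⟨h5, h6, h4, h2⟩

theorem nodeCode_lt {n x y z φ : ℕ} (hx : x < n) (hy : y < n) (hz : z < n) (hφ : φ < 2) :
    nodeCode n x y z φ < 2 * n ^ 3 := by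
  have h1 : x * n + y + 1 ≤ n * n := by nlinarith
  have h2 : (x * n + y) * n + z + 1 ≤ n * n * n := by nlinarith
  unfold nodeCode
  have : n ^ 3 = n * n * n := by ring
  omega

/-- The target of the edges given by three transitions with the origins `S`, the labels `L` and
the destinations `D`. -/
def edgeTarget (n : ℕ) (S L D : ℕ → ℕ) (i j k : ℕ) : ℕ :=
  if L i = L j ∧ L j = L k then nodeCode n (D i) (D j) (D k) (if 0 < L i then 0 else 1)
  -- Labels that do not match still give an edge, which moves no state and at most forgets that a
  -- letter was just read. Every triple then contributes exactly three edges.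
  else nodeCode n (S i) (S j) (S k) 1

/-- The edges of the product graph given by three transitions. The last coordinate of a vertex
is `0` immediately after a letter has been read. The second edge closes the cycles searched for. -/
def edgesAt (n : ℕ) (S L D : ℕ → ℕ) (i j k : ℕ) : List (ℕ × ℕ) :=
  [(nodeCode n (S i) (S j) (S j) 0, nodeCode n (S i) (S i) (S j) 0),
    (nodeCode n (S i) (S j) (S k) 1, edgeTarget n S L D i j k),
    (nodeCode n (S i) (S j) (S k) 0, edgeTarget n S L D i j k)]

namespace εNFA

theorem encodeLabel_inj {k : ℕ} {a b : Option (Fin k)} :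
    encodeLabel a = encodeLabel b ↔ a = b := by
  cases a <;> cases b <;> simp [encodeLabel, Fin.ext_iff]

theorem encodeLabel_le {k : ℕ} (a : Option (Fin k)) : encodeLabel a ≤ k := by
  cases a with
  | none => simp [encodeLabel]
  | some a => simp only [encodeLabel]; omega

variable {n k : ℕ}

/-- The list `T` consists of transitions of `A` and of triples `(x, ε, x)`. It contains
all transitions, and the triples for their origins and destinations. -/
structure StayList (A : εNFA (Fin k) (Fin n)) (T : List (Fin n × Option (Fin k) × Fin n)) :
    Prop where
  step_or_stay : ∀ e ∈ T, e.2.2 ∈ A.step e.1 e.2.1 ∨ (e.2.1 = none ∧ e.1 = e.2.2)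
  step : ∀ x a y, y ∈ A.step x a → (x, a, y) ∈ T
  stay_origin : ∀ e ∈ T, (e.1, none, e.1) ∈ T
  stay_dest : ∀ e ∈ T, (e.2.2, none, e.2.2) ∈ T

/-- The arrays `S`, `L`, `D` hold the list `T`. -/
def Holds (T : List (Fin n × Option (Fin k) × Fin n)) (S L D : ℕ → ℕ) : Prop :=
  ∀ i (h : i < T.length), S i = T[i].1 ∧ L i = encodeLabel T[i].2.1 ∧ D i = T[i].2.2

/-- The list `G` consists of all edges of the product graph. -/
def ProductGraph (n m : ℕ) (S L D : ℕ → ℕ) (G : List (ℕ × ℕ)) : Prop :=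
  ∀ e, e ∈ G ↔ ∃ i < m, ∃ j < m, ∃ k < m, e ∈ edgesAt n S L D i j k

section

variable {A : εNFA (Fin k) (Fin n)} {T : List (Fin n × Option (Fin k) × Fin n)} {S L D : ℕ → ℕ}
  {G : List (ℕ × ℕ)}

/-- Paths from `p`, `p`, `q` to `x`, `y`, `z` with the same label. If `φ = 0`, they all end with a
letter or are all empty. -/
def TriplePath (A : εNFA (Fin k) (Fin n)) (p q x y z : Fin n) (φ : ℕ) : Prop :=
  ∃ π₁ π₂ π₃, A.TransPath p π₁ x ∧ A.TransPath p π₂ y ∧ A.TransPath q π₃ z ∧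
    pathLabel π₁ = pathLabel π₂ ∧ pathLabel π₂ = pathLabel π₃ ∧
    (φ = 0 → (TailLength π₁ 0 ∧ TailLength π₂ 0 ∧ TailLength π₃ 0) ∨
      (π₁ = [] ∧ π₂ = [] ∧ π₃ = []))

theorem StayList.exists_path (hT : StayList A T) {e : Fin n × Option (Fin k) × Fin n}
    (he : e ∈ T) : ∃ π, A.TransPath e.1 π e.2.2 ∧ pathLabel π = e.2.1.toList ∧
      (e.2.1 ≠ none → TailLength π 0) := by
  obtain ⟨x, a, y⟩ := e
  rcases hT.step_or_stay _ he with h | ⟨h1, h2⟩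
  · refine ⟨[(x, a, y)], .cons h (.nil y), by cases a <;> simp, fun ha => ?_⟩
    exact ⟨[], _, [], rfl, ha, rfl, rfl⟩
  · obtain rfl : a = none := h1
    obtain rfl : x = y := h2
    exact ⟨[], .nil x, rfl, fun h => absurd rfl h⟩

/-- Every edge preserves the existence of three paths with equal labels, including the edges added
only for returning. -/
theorem triplePath_of_reach (hT : StayList A T) (hS : Holds T S L D)
    (hG : ProductGraph n T.length S L D G) {p q : Fin n} {v : ℕ}
    (h : DFS.Reach G (nodeCode n p p q 0) v) :
    ∃ (x y z : Fin n) (φ : ℕ), φ < 2 ∧ v = nodeCode n x y z φ ∧ TriplePath A p q x y z φ := by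
  induction h with
  | refl => exact ⟨p, p, q, 0, by omega, rfl, [], [], [], .nil p, .nil p, .nil q, rfl, rfl,
      fun _ => Or.inr ⟨rfl, rfl, rfl⟩⟩
  | @tail u v _ huv ih =>
    obtain ⟨x, y, z, φ, hφ, rfl, π₁, π₂, π₃, h₁, h₂, h₃, l₁, l₂, ht⟩ := ih
    obtain ⟨i, hi, j, hj, k', hk, he⟩ := (hG _).1 huv
    obtain ⟨hi1, hi2, hi3⟩ := hS i hi
    obtain ⟨hj1, hj2, hj3⟩ := hS j hj
    obtain ⟨hk1, hk2, hk3⟩ := hS k' hk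
    have hmi := List.getElem_mem hi
    have hmj := List.getElem_mem hj
    have hmk := List.getElem_mem hk
    have key : ∀ ψ < 2, nodeCode n x y z φ = nodeCode n (S i) (S j) (S k') ψ →
        v = edgeTarget n S L D i j k' → ∃ (x y z : Fin n) (φ : ℕ), φ < 2 ∧
        v = nodeCode n x y z φ ∧ TriplePath A p q x y z φ := by
      intro ψ hψ hcode hv
      rw [hi1, hj1, hk1] at hcode
      obtain ⟨e1, e2, e3, -⟩ := nodeCode_inj y.2 z.2 hφ (Fin.is_lt _) (Fin.is_lt _) hψ hcode
      rw [Fin.val_inj] at e1 e2 e3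
      subst e1 e2 e3
      unfold edgeTarget at hv
      split_ifs at hv with hL h0
      · refine ⟨T[i].2.2, T[j].2.2, T[k'].2.2, 0, by omega, by rw [hv, hi3, hj3, hk3], ?_⟩
        rw [hi2, hj2, hk2, encodeLabel_inj, encodeLabel_inj] at hL
        rw [hi2] at h0
        obtain ⟨X, hX, hXl, hXt⟩ := hT.exists_path hmi
        obtain ⟨Y, hY, hYl, hYt⟩ := hT.exists_path hmj
        obtain ⟨Z, hZ, hZl, hZt⟩ := hT.exists_path hmk
        have hne : T[i].2.1 ≠ none := by
          intro h
          rw [h] at h0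
          exact absurd h0 (by simp [encodeLabel])
        refine ⟨π₁ ++ X, π₂ ++ Y, π₃ ++ Z, h₁.append hX, h₂.append hY, h₃.append hZ,
          by simp [l₁, hXl, hYl, hL.1], by simp [l₂, hYl, hZl, hL.2], fun _ => Or.inl ?_⟩
        exact ⟨(hXt hne).append_left _, (hYt (hL.1 ▸ hne)).append_left _,
          (hZt (hL.2 ▸ hL.1 ▸ hne)).append_left _⟩
      · refine ⟨T[i].2.2, T[j].2.2, T[k'].2.2, 1, by omega, by rw [hv, hi3, hj3, hk3], ?_⟩
        rw [hi2, hj2, hk2, encodeLabel_inj, encodeLabel_inj] at hL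
        obtain ⟨X, hX, hXl, -⟩ := hT.exists_path hmi
        obtain ⟨Y, hY, hYl, -⟩ := hT.exists_path hmj
        obtain ⟨Z, hZ, hZl, -⟩ := hT.exists_path hmk
        exact ⟨π₁ ++ X, π₂ ++ Y, π₃ ++ Z, h₁.append hX, h₂.append hY, h₃.append hZ,
          by simp [l₁, hXl, hYl, hL.1], by simp [l₂, hYl, hZl, hL.2], fun h => by omega⟩
      · exact ⟨T[i].1, T[j].1, T[k'].1, 1, by omega, by rw [hv, hi1, hj1, hk1],
          π₁, π₂, π₃, h₁, h₂, h₃, l₁, l₂, fun h => by omega⟩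
    simp only [edgesAt, List.mem_cons, Prod.mk.injEq, List.not_mem_nil, or_false] at he
    rcases he with ⟨hc, hv⟩ | ⟨hc, hv⟩ | ⟨hc, hv⟩
    · rw [hi1, hj1] at hc
      obtain ⟨e1, e2, e3, e4⟩ := nodeCode_inj y.2 z.2 hφ (Fin.is_lt _) (Fin.is_lt _) (by omega) hc
      rw [Fin.val_inj] at e1 e2 e3
      subst e4
      -- A closing edge starts with equal second and third states and replaces the second path by a
      -- copy of the first. This is why closing the cycles creates no false pairs.
      refine ⟨x, x, z, 0, by omega, by rw [hv, hi1, hj1, e1, e3], π₁, π₁, π₃, h₁, h₁, h₃, rfl,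
        l₁.trans l₂, fun _ => ?_⟩
      rcases ht rfl with ht | ht
      · exact Or.inl ⟨ht.1, ht.1, ht.2.2⟩
      · exact Or.inr ⟨ht.1, ht.1, ht.2.2⟩
    · exact key 1 (by omega) hc hv
    · exact key 0 (by omega) hc hv

theorem reach_of_mem (hS : Holds T S L D) (hG : ProductGraph n T.length S L D G)
    {e₁ e₂ e₃ : Fin n × Option (Fin k) × Fin n} (h₁ : e₁ ∈ T) (h₂ : e₂ ∈ T) (h₃ : e₃ ∈ T)
    (h₁₂ : e₁.2.1 = e₂.2.1) (h₂₃ : e₂.2.1 = e₃.2.1) {φ : ℕ} (hφ : φ < 2) :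
    DFS.Reach G (nodeCode n e₁.1 e₂.1 e₃.1 φ)
      (nodeCode n e₁.2.2 e₂.2.2 e₃.2.2 (if e₁.2.1 = none then 1 else 0)) := by
  obtain ⟨i, hi, rfl⟩ := List.getElem_of_mem h₁
  obtain ⟨j, hj, rfl⟩ := List.getElem_of_mem h₂
  obtain ⟨k', hk, rfl⟩ := List.getElem_of_mem h₃
  refine .single ((hG _).2 ⟨i, hi, j, hj, k', hk, ?_⟩)
  obtain ⟨hi1, hi2, hi3⟩ := hS i hi
  obtain ⟨hj1, hj2, hj3⟩ := hS j hj
  obtain ⟨hk1, hk2, hk3⟩ := hS k' hk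
  have ht : edgeTarget n S L D i j k' = nodeCode n T[i].2.2 T[j].2.2 T[k'].2.2
      (if T[i].2.1 = none then 1 else 0) := by
    unfold edgeTarget
    rw [if_pos ⟨by rw [hi2, hj2, h₁₂], by rw [hj2, hk2, h₂₃]⟩, hi2, hi3, hj3, hk3]
    cases T[i].2.1 <;> simp [encodeLabel]
  rw [edgesAt, ht, hi1, hj1, hk1]
  obtain rfl | rfl : φ = 0 ∨ φ = 1 := by omega
  · simp
  · simp

/-- The three ε-paths are followed one after the other, the other two coordinates using their stay
triples; no filter is needed. -/
theorem reach_of_epsReach (hT : StayList A T) (hS : Holds T S L D)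
    (hG : ProductGraph n T.length S L D G) {x x' y y' z z' : Fin n} (hx : A.EpsReach x x')
    (hy : A.EpsReach y y') (hz : A.EpsReach z z') (sx : (x, none, x) ∈ T) (sy : (y, none, y) ∈ T)
    (sz : (z, none, z) ∈ T) :
    DFS.Reach G (nodeCode n x y z 0) (nodeCode n x' y' z' 1) ∧
      (x', none, x') ∈ T ∧ (y', none, y') ∈ T ∧ (z', none, z') ∈ T := by
  -- Three simultaneous stays change the last coordinate from `0` to `1`, so the ε-moves can be made
  -- at `1` throughout.
  have h0 := reach_of_mem hS hG sx sy sz rfl rfl (φ := 0) (by omega)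
  have hx' : ∀ {x}, A.EpsReach x x' → (x, none, x) ∈ T →
      DFS.Reach G (nodeCode n x y z 1) (nodeCode n x' y z 1) ∧ (x', none, x') ∈ T := by
    rintro x ⟨π, hπ, hl⟩ sx
    induction hπ with
    | nil => exact ⟨.refl, sx⟩
    | @cons p r _ a π hs _ ih =>
      obtain rfl : a = none := pathLabel_eq_nil_iff.1 hl _ List.mem_cons_self
      have hm := hT.step _ _ _ hs
      obtain ⟨h1, h2⟩ := ih hx (by simpa using hl) (hT.stay_dest _ hm)
      exact ⟨.trans (reach_of_mem hS hG hm sy sz rfl rfl (by omega)) h1, h2⟩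
  have hy' : ∀ {y}, A.EpsReach y y' → (y, none, y) ∈ T → (x', none, x') ∈ T →
      DFS.Reach G (nodeCode n x' y z 1) (nodeCode n x' y' z 1) ∧ (y', none, y') ∈ T := by
    rintro y ⟨π, hπ, hl⟩ sy sx
    clear hx' h0
    induction hπ with
    | nil => exact ⟨.refl, sy⟩
    | @cons p r _ a π hs _ ih =>
      obtain rfl : a = none := pathLabel_eq_nil_iff.1 hl _ List.mem_cons_self
      have hm := hT.step _ _ _ hs
      obtain ⟨h1, h2⟩ := ih hy (by simpa using hl) (hT.stay_dest _ hm)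
      exact ⟨.trans (reach_of_mem hS hG sx hm sz rfl rfl (by omega)) h1, h2⟩
  have hz' : ∀ {z}, A.EpsReach z z' → (z, none, z) ∈ T → (x', none, x') ∈ T →
      (y', none, y') ∈ T →
      DFS.Reach G (nodeCode n x' y' z 1) (nodeCode n x' y' z' 1) ∧ (z', none, z') ∈ T := by
    rintro z ⟨π, hπ, hl⟩ sz sx sy
    clear hx' hy' h0
    induction hπ with
    | nil => exact ⟨.refl, sz⟩
    | @cons p r _ a π hs _ ih =>
      obtain rfl : a = none := pathLabel_eq_nil_iff.1 hl _ List.mem_cons_self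
      have hm := hT.step _ _ _ hs
      obtain ⟨h1, h2⟩ := ih hz (by simpa using hl) (hT.stay_dest _ hm)
      exact ⟨.trans (reach_of_mem hS hG sx sy hm rfl rfl (by omega)) h1, h2⟩
  obtain ⟨rx, sx'⟩ := hx' hx sx
  obtain ⟨ry, sy'⟩ := hy' hy sy sx'
  obtain ⟨rz, sz'⟩ := hz' hz sz sx' sy'
  exact ⟨.trans h0 (.trans rx (.trans ry rz)), sx', sy', sz'⟩

theorem reach_of_letterPath (hT : StayList A T) (hS : Holds T S L D)
    (hG : ProductGraph n T.length S L D G) {w : List (Fin k)} {x x' y y' z z' : Fin n}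
    (hx : A.LetterPath x w x') (hy : A.LetterPath y w y') (hz : A.LetterPath z w z')
    (sx : (x, none, x) ∈ T) (sy : (y, none, y) ∈ T) (sz : (z, none, z) ∈ T) :
    DFS.Reach G (nodeCode n x y z 0) (nodeCode n x' y' z' 0) := by
  induction w generalizing x y z with
  | nil =>
    cases hx
    cases hy
    cases hz
    exact .refl
  | cons a w ih =>
    cases hx with
    | cons ex tx hx =>
      cases hy with
      | cons ey ty hy =>
        cases hz with
        | cons ez tz hz =>
          obtain ⟨h1, -, -, -⟩ := reach_of_epsReach hT hS hG ex ey ez sx sy sz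
          have mx := hT.step _ _ _ tx
          have my := hT.step _ _ _ ty
          have mz := hT.step _ _ _ tz
          have h2 := reach_of_mem hS hG mx my mz rfl rfl (φ := 1) (by omega)
          exact .trans h1 (.trans h2 (ih hx hy hz (hT.stay_dest _ mx) (hT.stay_dest _ my)
            (hT.stay_dest _ mz)))

/-- The synchronized pairs correspond to strongly connected vertices of the product graph. -/
theorem scc_iff_syncPair (hT : StayList A T) (hS : Holds T S L D)
    (hG : ProductGraph n T.length S L D G) {p q : Fin n} (hp : (p, none, p) ∈ T)
    (hq : (q, none, q) ∈ T) (hpq : p ≠ q) :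
    DFS.Scc G (nodeCode n p p q 0) (nodeCode n p q q 0) ↔ A.SyncPair 0 p q := by
  constructor
  · rintro ⟨h, -⟩
    obtain ⟨x, y, z, φ, hφ, hv, π₁, π₂, π₃, h₁, h₂, h₃, l₁, l₂, ht⟩ :=
      triplePath_of_reach hT hS hG h
    obtain ⟨e1, e2, e3, e4⟩ := nodeCode_inj q.2 q.2 (by omega) y.2 z.2 hφ hv
    rw [Fin.val_inj] at e1 e2 e3
    subst e1 e2 e3 e4
    rcases ht rfl with ht | ⟨-, rfl, -⟩
    · exact ⟨hpq, π₁, π₂, π₃, h₁, h₂, h₃, l₁, l₂, ht⟩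
    · exact absurd (transPath_nil_iff.1 h₂) hpq
  · rintro ⟨-, π₁, π₂, π₃, h₁, h₂, h₃, l₁, l₂, t₁, t₂, t₃⟩
    have e₁ := t₁.letterPath h₁
    have e₂ := t₂.letterPath h₂
    have e₃ := t₃.letterPath h₃
    rw [← l₂, ← l₁] at e₃
    rw [← l₁] at e₂
    -- The return from `(p, q, q)` to `(p, p, q)` is a closing edge, so only the forward direction
    -- says something about the automaton.
    refine ⟨reach_of_letterPath hT hS hG e₁ e₂ e₃ hp hp hq, .single ((hG _).2 ?_)⟩
    obtain ⟨i, hi, hpi⟩ := List.getElem_of_mem hp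
    obtain ⟨j, hj, hqj⟩ := List.getElem_of_mem hq
    refine ⟨i, hi, j, hj, j, hj, ?_⟩
    have hi1 := (hS i hi).1
    have hj1 := (hS j hj).1
    rw [hpi] at hi1
    rw [hqj] at hj1
    simp [edgesAt, hi1, hj1]

/-- The list of transitions, with the triples `(x, ε, x)` for their origins and destinations. -/
def stays (l : List (Fin n × Option (Fin k) × Fin n)) : List (Fin n × Option (Fin k) × Fin n) :=
  l.flatMap fun e => [e, (e.1, none, e.1), (e.2.2, none, e.2.2)]

theorem stayList_stays {l : List (Fin n × Option (Fin k) × Fin n)}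
    (hl : ∀ e, e ∈ l ↔ e ∈ A.transitions) : StayList A (stays l) where
  step_or_stay e he := by
    obtain ⟨e', he', h⟩ := List.mem_flatMap.1 he
    simp only [List.mem_cons, List.not_mem_nil, or_false] at h
    rcases h with rfl | rfl | rfl
    · exact Or.inl ((hl e).1 he')
    · exact Or.inr ⟨rfl, rfl⟩
    · exact Or.inr ⟨rfl, rfl⟩
  step x a y h := List.mem_flatMap.2 ⟨(x, a, y), (hl _).2 h, by simp⟩
  stay_origin e he := by
    obtain ⟨e', he', h⟩ := List.mem_flatMap.1 he
    refine List.mem_flatMap.2 ⟨e', he', ?_⟩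
    simp only [List.mem_cons, List.not_mem_nil, or_false] at h ⊢
    rcases h with rfl | rfl | rfl <;> simp
  stay_dest e he := by
    obtain ⟨e', he', h⟩ := List.mem_flatMap.1 he
    refine List.mem_flatMap.2 ⟨e', he', ?_⟩
    simp only [List.mem_cons, List.not_mem_nil, or_false] at h ⊢
    rcases h with rfl | rfl | rfl <;> simp

theorem length_stays (l : List (Fin n × Option (Fin k) × Fin n)) :
    (stays l).length = 3 * l.length := by
  induction l with
  | nil => rfl
  | cons e l ih =>
    have : stays (e :: l) = [e, (e.1, none, e.1), (e.2.2, none, e.2.2)] ++ stays l := rfl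
    rw [this, List.length_append, ih]
    simp
    omega

end

end εNFA

namespace RAM

/-! ### The parts of the store changed by a block -/

/-- The variables assigned by a block. -/
def Block.vars : Block → List Var
  | skip => []
  | set v _ => [v]
  | put _ _ _ => []
  | seq P P' => P.vars ++ P'.vars
  | ite _ _ P P' => P.vars ++ P'.vars

/-- The arrays changed by a block. -/
def Block.arrs : Block → List Arr
  | skip => []
  | set _ _ => []
  | put a _ _ => [a]
  | seq P P' => P.arrs ++ P'.arrs
  | ite _ _ P P' => P.arrs ++ P'.arrs

/-- The stores `st₀` and `st` differ only where the block `P` may write. -/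
structure Block.Frame (P : Block) (st₀ st : Store) : Prop where
  reg : ∀ v ∉ P.vars, st.reg v = st₀.reg v
  arr : ∀ a ∉ P.arrs, st.arr a = st₀.arr a
  inp : st.inp = st₀.inp

theorem Block.Frame.refl (P : Block) (st : Store) : P.Frame st st :=
  ⟨fun _ _ => rfl, fun _ _ => rfl, rfl⟩

theorem Block.Frame.trans {P : Block} {st st' st'' : Store} (h : P.Frame st st')
    (h' : P.Frame st' st'') : P.Frame st st'' :=
  ⟨fun v hv => (h'.reg v hv).trans (h.reg v hv), fun a ha => (h'.arr a ha).trans (h.arr a ha),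
    h'.inp.trans h.inp⟩

theorem Block.frame_run (P : Block) (st : Store) : P.Frame st (P.run st) := by
  induction P generalizing st with
  | skip => exact .refl _ _
  | set v e =>
    refine ⟨fun v' hv => ?_, fun _ _ => rfl, rfl⟩
    have : v' ≠ v := by simpa [vars] using hv
    simp [run, this]
  | put a i e =>
    refine ⟨fun _ _ => rfl, fun a' ha => ?_, rfl⟩
    have : a' ≠ a := by simpa [arrs] using ha
    simp [run, this]
  | seq P P' ih ih' =>
    refine ⟨fun v hv => ?_, fun a ha => ?_, ?_⟩
    · simp only [vars, List.mem_append, not_or] at hv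
      exact ((ih' _).reg v hv.2).trans ((ih _).reg v hv.1)
    · simp only [arrs, List.mem_append, not_or] at ha
      exact ((ih' _).arr a ha.2).trans ((ih _).arr a ha.1)
    · exact (ih' _).inp.trans (ih _).inp
  | ite e e' P P' ih ih' =>
    simp only [run]
    split_ifs
    · refine ⟨fun v hv => (ih _).reg v ?_, fun a ha => (ih _).arr a ?_, (ih _).inp⟩
      · simp only [vars, List.mem_append, not_or] at hv
        exact hv.1
      · simp only [arrs, List.mem_append, not_or] at ha
        exact ha.1
    · refine ⟨fun v hv => (ih' _).reg v ?_, fun a ha => (ih' _).arr a ?_, (ih' _).inp⟩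
      · simp only [vars, List.mem_append, not_or] at hv
        exact hv.2
      · simp only [arrs, List.mem_append, not_or] at ha
        exact ha.2

/-- The rule for loops, with the information on what the loop does not change. -/
theorem Code.Runs.loop_frame {B V W : ℕ} (hBV : B ≤ V) {e e' : Expr} {P : Block}
    (hW : (Code.loop e e' P).bd V ≤ W) (he : ∀ st, e.Ok B st ∧ e'.Ok B st)
    {st₀ : Store} (hst : st₀.Bdd V) (I : ℕ → Store → Prop)
    (hI : ∀ m st, st.Bdd V → P.Frame st₀ st → I m st → e.eval st < e'.eval st →
      P.Ok B V st ∧ ∃ m' < m, I m' (P.run st))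
    {N : ℕ} (h0 : I N st₀) :
    (Code.loop e e' P).Runs B V W st₀ ((N + 1) * (P.cost + (e.cost + e'.cost) + 1))
      (fun st' => P.Frame st₀ st' ∧ (∃ m, I m st') ∧ ¬ e.eval st' < e'.eval st') := by
  have h := Code.Runs.loop hBV (W := W) hW (fun m st => P.Frame st₀ st ∧ I m st) he
    (fun m st hb hI' hc => by
      obtain ⟨h1, m', hm', h2⟩ := hI m st hb hI'.1 hI'.2 hc
      exact ⟨h1, m', hm', hI'.1.trans (P.frame_run st), h2⟩) hst ⟨.refl _ _, h0⟩
  intro s hR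
  obtain ⟨t, s', st', h1, h2, h3, h4, ⟨m, h5, h6⟩, h7⟩ := h s hR
  exact ⟨t, s', st', h1, h2, h3, h4, h5, ⟨m, h6⟩, h7⟩

/-! ### Lists in memory -/

/-- The list of the entries of an array with the indices `n, n - 1, …, 1`. -/
def downList (a : ℕ → ℕ) : ℕ → List ℕ
  | 0 => []
  | n + 1 => a (n + 1) :: downList a n

@[simp] theorem length_downList (a : ℕ → ℕ) (n : ℕ) : (downList a n).length = n := by
  induction n with
  | zero => rfl
  | succ n ih => simp [downList, ih]

theorem downList_update (a : ℕ → ℕ) {n m : ℕ} (h : n < m) (x : ℕ) :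
    downList (Function.update a m x) n = downList a n := by
  induction n with
  | zero => rfl
  | succ n ih => simp [downList, ih (by omega), h.ne]

theorem downList_update_succ (a : ℕ → ℕ) (n x : ℕ) :
    downList (Function.update a (n + 1) x) (n + 1) = x :: downList a n := by
  simp [downList, downList_update]

/-- Starting with `e`, the linked list with the successors `nx` and the entries `tg` represents a
list; only addresses from `1` to `M` are used. -/
def Chain (M : ℕ) (nx tg : ℕ → ℕ) : ℕ → List ℕ → Prop
  | e, [] => e = 0
  | e, w :: l => 0 < e ∧ e ≤ M ∧ tg e = w ∧ Chain M nx tg (nx e) l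

/-- The new cell `M + 1` lies beyond all addresses used so far. Since addresses start at `1`, zero
can serve as the end of a list. -/
theorem Chain.update {M : ℕ} {nx tg : ℕ → ℕ} {e : ℕ} {l : List ℕ} (h : Chain M nx tg e l)
    (x y : ℕ) : Chain (M + 1) (Function.update nx (M + 1) x) (Function.update tg (M + 1) y) e l := by
  induction l generalizing e with
  | nil => exact h
  | cons w l ih =>
    obtain ⟨h1, h2, h3, h4⟩ := h
    have hne : e ≠ M + 1 := by omega
    refine ⟨h1, by omega, by simpa [hne] using h3, ?_⟩
    rw [Function.update_of_ne hne]
    exact ih h4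

/-- The targets of the edges with a given origin. -/
def adj (G : List (ℕ × ℕ)) (v : ℕ) : List ℕ := (G.filter fun e => e.1 = v).map Prod.snd

theorem mem_adj {G : List (ℕ × ℕ)} {v x : ℕ} : x ∈ adj G v ↔ (v, x) ∈ G := by
  simp [adj]

/-- The work of a search at its beginning is thus the number of edges. -/
theorem sum_length_adj {G : List (ℕ × ℕ)} {N : ℕ} (hG : ∀ e ∈ G, e.1 < N) :
    ∑ v ∈ Finset.range N, (adj G v).length = G.length := by
  induction G with
  | nil => simp [adj]
  | cons e G ih =>
    have h1 : ∀ v, (adj (e :: G) v).length = (adj G v).length + if e.1 = v then 1 else 0 := by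
      intro v
      by_cases h : e.1 = v <;> simp [adj, h]
    simp only [h1, Finset.sum_add_distrib]
    rw [ih fun e he => hG e (List.mem_cons_of_mem _ he), Finset.sum_ite_eq,
      if_pos (Finset.mem_range.2 (hG e List.mem_cons_self)), List.length_cons]

/-- The adjacency lists of the graph `G` are stored as linked lists. -/
def Linked (M : ℕ) (nx tg hd : ℕ → ℕ) (G : List (ℕ × ℕ)) : Prop :=
  ∀ v, Chain M nx tg (hd v) (adj G v)

theorem Linked.cons {M : ℕ} {nx tg hd : ℕ → ℕ} {G : List (ℕ × ℕ)} (h : Linked M nx tg hd G)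
    (u w : ℕ) : Linked (M + 1) (Function.update nx (M + 1) (hd u)) (Function.update tg (M + 1) w)
      (Function.update hd u (M + 1)) ((u, w) :: G) := by
  intro v
  by_cases hv : v = u
  · subst hv
    have : adj ((v, w) :: G) v = w :: adj G v := by simp [adj]
    rw [this, Function.update_self]
    exact ⟨by omega, le_rfl, by simp, by simpa using (h v).update _ _⟩
  · have : adj ((u, w) :: G) v = adj G v := by simp [adj, Ne.symm hv]
    rw [this, Function.update_of_ne hv]
    exact (h v).update _ _

/-! ### The depth-first search -/

set_option linter.constructorNameAsVariable false

infixr:60 " ;; " => Block.seq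

/-- One step of a depth-first search on the adjacency lists `hd`, `nx`, `tg`, with the roots `R`,
the marks `mk` and the list `out` of the finished vertices. -/
def dfsBlock (hd nx tg mk out R : Arr) : Block :=
  .ite (.const 0) (.var .sp)
    (.set .org (.get .stack (.var .sp)) ;;
      .set .ptr (.get hd (.var .org)) ;;
      .ite (.const 0) (.var .ptr)
        (.put hd (.var .org) (.get nx (.var .ptr)) ;;
          .set .nbr (.get tg (.var .ptr)) ;;
          .ite (.const 0) (.get mk (.var .nbr)) .skip
            (.put mk (.var .nbr) (.var .lbl) ;;
              .set .sp (.add (.var .sp) (.const 1)) ;;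
              .put .stack (.var .sp) (.var .nbr)))
        (.set .sp (.sub (.var .sp) (.const 1)) ;;
          .set .oc (.add (.var .oc) (.const 1)) ;;
          .put out (.var .oc) (.var .org)))
    (.set .nbr (.get R (.var .ri)) ;;
      .set .ri (.sub (.var .ri) (.const 1)) ;;
      .ite (.const 0) (.get mk (.var .nbr)) .skip
        (.set .lbl (.add (.var .nbr) (.const 1)) ;;
          .put mk (.var .nbr) (.var .lbl) ;;
          .set .sp (.const 1) ;;
          .put .stack (.const 1) (.var .nbr)))

/-- The store `st` represents the state `s` of a depth-first search. -/
structure Rep (M : ℕ) (hd nx tg mk out R : Arr) (st : Store) (s : DFS.St) : Prop where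
  roots : s.roots = downList (st.arr R) (st.reg .ri)
  stack : s.stack = downList (st.arr .stack) (st.reg .sp)
  out : s.out = downList (st.arr out) (st.reg .oc)
  mark : s.mark = st.arr mk
  rem : ∀ v, Chain M (st.arr nx) (st.arr tg) (st.arr hd v) (s.rem v)
  lbl : s.lbl = st.reg .lbl

/-- The branches of the program correspond to the cases of the abstract step; distinctness of the
arrays keeps their writes from interfering. Following an edge advances the head pointer of its list.
-/
theorem Rep.step {M : ℕ} {hd nx tg mk out R : Arr}
    (hne : [hd, nx, tg, mk, out, R, .stack].Nodup) {st : Store} {s : DFS.St}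
    (h : Rep M hd nx tg mk out R st s) (hc : 0 < st.reg .ri + st.reg .sp) :
    Rep M hd nx tg mk out R ((dfsBlock hd nx tg mk out R).run st) s.step := by
  simp only [List.nodup_cons, List.mem_cons, not_or, List.not_mem_nil, not_false_eq_true,
    List.nodup_nil, and_true] at hne
  obtain ⟨⟨a1, a2, a3, a4, a5, a6⟩, ⟨b1, b2, b3, b4, b5⟩, ⟨c1, c2, c3, c4⟩, ⟨d1, d2, d3⟩,
    ⟨e1, e2⟩, f1⟩ := hne
  rcases Nat.eq_zero_or_pos (st.reg .sp) with hsp | hsp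
  · obtain ⟨r, hr⟩ : ∃ r, st.reg .ri = r + 1 := ⟨st.reg .ri - 1, by omega⟩
    have hs : s.stack = [] := by rw [h.stack, hsp]; rfl
    have hroots : s.roots = st.arr R (r + 1) :: downList (st.arr R) r := by rw [h.roots, hr]; rfl
    by_cases hm : st.arr mk (st.arr R (r + 1)) = 0
    · have hrun : (dfsBlock hd nx tg mk out R).run st = ⟨Function.update (Function.update
          (Function.update (Function.update st.reg .nbr (st.arr R (r + 1))) .ri r) .lbl
          (st.arr R (r + 1) + 1)) .sp 1, Function.update (Function.update st.arr mk
          (Function.update (st.arr mk) (st.arr R (r + 1)) (st.arr R (r + 1) + 1))) .stack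
          (Function.update (st.arr .stack) 1 (st.arr R (r + 1))), st.inp⟩ := by
        simp [dfsBlock, Block.run, hsp, hr, hm, Ne.symm d3]
      have hstep : s.step = { s with
          roots := downList (st.arr R) r, stack := [st.arr R (r + 1)],
          mark := Function.update s.mark (st.arr R (r + 1)) (st.arr R (r + 1) + 1),
          lbl := st.arr R (r + 1) + 1 } := by
        simp [DFS.St.step, hs, hroots, h.mark, hm]
      rw [hrun, hstep]
      refine ⟨?_, ?_, ?_, ?_, fun v => ?_, ?_⟩
      · simp [f1, Ne.symm d2]
      · simp [downList]
      · simp [e2, Ne.symm d1, h.out]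
      · simp [d3, h.mark]
      · simpa [a6, b5, c4, a3, b2, c1] using h.rem v
      · simp
    · have hrun : (dfsBlock hd nx tg mk out R).run st = ⟨(Function.update
          (Function.update st.reg .nbr (st.arr R (r + 1))) .ri r), st.arr, st.inp⟩ := by
        simp [dfsBlock, Block.run, hsp, hr, Nat.pos_of_ne_zero hm]
      have hstep : s.step = { s with roots := downList (st.arr R) r } := by
        simp [DFS.St.step, hs, hroots, h.mark, hm]
      rw [hrun, hstep]
      exact ⟨by simp, by simpa using h.stack, by simpa using h.out, h.mark, h.rem,
        by simpa using h.lbl⟩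
  · obtain ⟨r, hr⟩ : ∃ r, st.reg .sp = r + 1 := ⟨st.reg .sp - 1, by omega⟩
    set v := st.arr .stack (r + 1) with hv
    have hs : s.stack = v :: downList (st.arr .stack) r := by rw [h.stack, hr]; rfl
    have hrem := h.rem v
    rcases hl : s.rem v with _ | ⟨w, l⟩
    · rw [hl] at hrem
      have hptr : st.arr hd v = 0 := hrem
      have hrun : (dfsBlock hd nx tg mk out R).run st = ⟨Function.update (Function.update
          (Function.update (Function.update st.reg .org v) .ptr 0) .sp r) .oc (st.reg .oc + 1),
          Function.update st.arr out (Function.update (st.arr out) (st.reg .oc + 1) v),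
          st.inp⟩ := by
        simp [dfsBlock, Block.run, hr, ← hv, hptr]
      have hstep : s.step = { s with stack := downList (st.arr .stack) r, out := v :: s.out } := by
        simp [DFS.St.step, hs, hl]
      rw [hrun, hstep]
      refine ⟨?_, ?_, ?_, ?_, fun x => ?_, ?_⟩
      · simp [Ne.symm e1, h.roots]
      · simp [Ne.symm e2]
      · simp [downList_update_succ, h.out]
      · simp [d1, h.mark]
      · simpa [a4, b3, c2] using h.rem x
      · simp [h.lbl]
    · rw [hl] at hrem
      obtain ⟨h1, -, h3, h4⟩ := hrem
      by_cases hm : st.arr mk w = 0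
      · have hrun : (dfsBlock hd nx tg mk out R).run st = ⟨Function.update (Function.update
            (Function.update (Function.update st.reg .org v) .ptr (st.arr hd v)) .nbr w)
            .sp (r + 2), Function.update (Function.update (Function.update st.arr hd
            (Function.update (st.arr hd) v (st.arr nx (st.arr hd v)))) mk
            (Function.update (st.arr mk) w (st.reg .lbl))) .stack
            (Function.update (st.arr .stack) (r + 2) w), st.inp⟩ := by
          simp [dfsBlock, Block.run, hr, ← hv, h1, h3, hm, Ne.symm a2, Ne.symm a3, Ne.symm a6,
            Ne.symm d3]
        have hstep : s.step = { s with
            stack := w :: v :: downList (st.arr .stack) r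
            rem := Function.update s.rem v l
            mark := Function.update s.mark w s.lbl } := by
          simp [DFS.St.step, hs, hl, h.mark, hm]
        rw [hrun, hstep]
        refine ⟨?_, ?_, ?_, ?_, fun x => ?_, ?_⟩
        · simp [f1, Ne.symm d2, Ne.symm a5, h.roots]
        · simp [downList_update_succ]
          simp [downList, hv]
        · simp [e2, Ne.symm d1, Ne.symm a4, h.out]
        · simp [d3, h.mark, h.lbl]
        · by_cases hx : x = v
          · subst hx
            simpa [a6, b5, c4, a3, b2, c1, Ne.symm a1, Ne.symm a2] using h4
          · simpa [a6, b5, c4, a3, b2, c1, Ne.symm a1, Ne.symm a2, hx] using h.rem x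
        · simp [h.lbl]
      · have hrun : (dfsBlock hd nx tg mk out R).run st = ⟨Function.update
            (Function.update (Function.update st.reg .org v) .ptr (st.arr hd v)) .nbr w, Function.update st.arr hd
            (Function.update (st.arr hd) v (st.arr nx (st.arr hd v))), st.inp⟩ := by
          simp [dfsBlock, Block.run, hr, ← hv, h1, h3, Nat.pos_of_ne_zero hm,
            Ne.symm a2, Ne.symm a3]
        have hstep : s.step = { s with rem := Function.update s.rem v l } := by
          simp [DFS.St.step, hs, hl, h.mark, hm]
        rw [hrun, hstep]
        refine ⟨?_, ?_, ?_, ?_, fun x => ?_, ?_⟩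
        · simp [Ne.symm a5, h.roots]
        · simp [Ne.symm a6, h.stack]
        · simp [Ne.symm a4, h.out]
        · simp [Ne.symm a3, h.mark]
        · by_cases hx : x = v
          · subst hx
            simpa [Ne.symm a1, Ne.symm a2] using h4
          · simpa [Ne.symm a1, Ne.symm a2, hx] using h.rem x
        · simp [h.lbl]

theorem dfsBlock_ok {B V M : ℕ} {hd nx tg mk out R : Arr}
    (hne : [hd, nx, tg, mk, out, R, .stack].Nodup) {st : Store} (hb : st.Bdd V) {s : DFS.St}
    (h : Rep M hd nx tg mk out R st s) (hc : 0 < st.reg .ri + st.reg .sp)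
    (hsp : st.reg .sp + 1 ≤ V) (hoc : st.reg .oc + 1 ≤ V) (hroots : ∀ r ∈ s.roots, r + 1 ≤ V) :
    (dfsBlock hd nx tg mk out R).Ok B V st := by
  simp only [List.nodup_cons, List.mem_cons, not_or, List.not_mem_nil, not_false_eq_true,
    List.nodup_nil, and_true] at hne
  obtain ⟨⟨a1, a2, a3, a4, a5, a6⟩, ⟨b1, b2, b3, b4, b5⟩, ⟨c1, c2, c3, c4⟩, ⟨d1, d2, d3⟩,
    ⟨e1, e2⟩, f1⟩ := hne
  have hr := hb.reg
  have ha := hb.arr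
  rcases Nat.eq_zero_or_pos (st.reg .sp) with hsp0 | hsp0
  · obtain ⟨r, hri⟩ : ∃ r, st.reg .ri = r + 1 := ⟨st.reg .ri - 1, by omega⟩
    have h1 := hroots (st.arr R (r + 1)) (by rw [h.roots, hri, downList]; simp)
    have h2 := hr .ri
    have h3 := ha R (r + 1)
    simp only [dfsBlock, Block.Ok, Block.run, Expr.Ok, Expr.eval, hsp0, lt_irrefl, false_imp_iff,
      not_false_eq_true, true_imp_iff, true_and, and_true, Function.update_self, hri]
    simp
    refine ⟨h3, by omega, fun _ => ⟨h1, by omega⟩⟩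
  · have h1 := hr .sp
    have h2 := ha hd (st.arr .stack (st.reg .sp))
    have h3 := ha nx (st.arr hd (st.arr .stack (st.reg .sp)))
    have h4 := ha tg (st.arr hd (st.arr .stack (st.reg .sp)))
    simp [dfsBlock, Block.Ok, Block.run, hsp0, ha, hr, hoc, hsp, Ne.symm a2]
    omega

/-- The depth-first search as a program. -/
def dfsCode (hd nx tg mk out R : Arr) : Code :=
  .loop (.const 0) (.add (.var .ri) (.var .sp)) (dfsBlock hd nx tg mk out R)

def dfsCost (hd nx tg mk out R : Arr) : ℕ := (dfsBlock hd nx tg mk out R).cost + 7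

/-- `Z` bounds the roots and edges together, hence also the stack and the finished list; `2 * Z`
bounds the decreasing measure and so the number of passes. -/
theorem dfsCode_runs {B V W M N : ℕ} (hBV : B ≤ V) {hd nx tg mk out R : Arr}
    (hne : [hd, nx, tg, mk, out, R, .stack].Nodup) (hW : (dfsCode hd nx tg mk out R).bd V ≤ W)
    {st₀ : Store} (hst : st₀.Bdd V) {G : List (ℕ × ℕ)} (hG : ∀ e ∈ G, e.1 < N ∧ e.2 < N)
    (hN : N ≤ V) (hlink : Linked M (st₀.arr nx) (st₀.arr tg) (st₀.arr hd) G)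
    (hmk : ∀ i, st₀.arr mk i = 0) (hsp : st₀.reg .sp = 0) (hoc : st₀.reg .oc = 0)
    (hroots : ∀ r ∈ downList (st₀.arr R) (st₀.reg .ri), r < N)
    {Z : ℕ} (hZ : st₀.reg .ri + G.length ≤ Z) (hZV : Z < V) :
    (dfsCode hd nx tg mk out R).Runs B V W st₀ ((2 * Z + 1) * dfsCost hd nx tg mk out R)
      (fun st' => (dfsBlock hd nx tg mk out R).Frame st₀ st' ∧ st'.reg .oc ≤ Z ∧
        ∃ s, DFS.Inv G (downList (st₀.arr R) (st₀.reg .ri)) s ∧ s.stack = [] ∧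
          s.out = downList (st'.arr out) (st'.reg .oc) ∧ s.mark = st'.arr mk) := by
  set roots := downList (st₀.arr R) (st₀.reg .ri) with hrootsdef
  let I : ℕ → Store → Prop := fun m st => ∃ s P, Rep M hd nx tg mk out R st s ∧ DFS.Inv G P s ∧
    P ++ s.roots = roots ∧ s.roots.length + s.work N + s.stack.length + s.out.length ≤ Z ∧
    2 * s.roots.length + 2 * s.work N + s.stack.length ≤ m
  have hstack : ∀ {P : List ℕ} {s : DFS.St}, DFS.Inv G P s → P ++ s.roots = roots →
      ∀ v ∈ s.stack, v < N := by
    intro P s hInv hP v hv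
    exact hInv.lt_of_mark hG (fun r hr => hroots r (by rw [← hP]; exact List.mem_append_left _ hr))
      ((hInv.mark_iff v).2 (Or.inl hv))
  have h0 : I (2 * Z) st₀ := by
    refine ⟨DFS.init roots (adj G) (st₀.reg .lbl), [], ⟨rfl, by rw [hsp]; rfl, by rw [hoc]; rfl,
      (funext hmk).symm, hlink, rfl⟩, DFS.inv_init fun v x => mem_adj, rfl, ?_, ?_⟩
    · simp only [DFS.init, DFS.St.work, List.length_nil, hrootsdef, length_downList]
      rw [sum_length_adj fun e he => (hG e he).1]
      omega
    · simp only [DFS.init, DFS.St.work, List.length_nil, hrootsdef, length_downList]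
      rw [sum_length_adj fun e he => (hG e he).1]
      omega
  have h := Code.Runs.loop_frame hBV (W := W) hW (fun _ => by simp) hst I ?_ h0
  · intro s hR
    obtain ⟨t, s', st', h1, h2, h3, h4, h5, ⟨m, s₁, P, g1, g2, g3, g4, -⟩, h7⟩ := h s hR
    refine ⟨t, s', st', h1, h2, h3, h4, h5, ?_, s₁, ?_, ?_, g1.out, g1.mark⟩
    · rw [g1.out, length_downList] at g4
      omega
    · have : s₁.roots = [] := by
        have hri : st'.reg .ri = 0 := by simp at h7; omega
        rw [g1.roots, hri]
        rfl
      rw [this, List.append_nil] at g3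
      rwa [← g3]
    · have hsp' : st'.reg .sp = 0 := by simp at h7; omega
      rw [g1.stack, hsp']
      rfl
  · rintro m st hb - ⟨s, P, hRep, hInv, hP, hlen, hm⟩ hc
    have hc' : 0 < st.reg .ri + st.reg .sp := by simpa using hc
    have hmeas := s.step_measure N (hstack hInv hP) (by
      rcases Nat.eq_zero_or_pos (st.reg .sp) with h | h
      · left
        rw [hRep.roots, ← List.length_pos_iff, length_downList]
        omega
      · right
        rwa [hRep.stack, ← List.length_pos_iff, length_downList])
    obtain ⟨P', hInv', hP'⟩ := hInv.step
    have hl1 := congrArg List.length hRep.stack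
    have hl2 := congrArg List.length hRep.out
    rw [length_downList] at hl1 hl2
    refine ⟨dfsBlock_ok hne hb hRep hc' (by omega) (by omega) fun r hr => ?_,
      2 * s.step.roots.length + 2 * s.step.work N + s.step.stack.length, by omega,
      s.step, P', hRep.step hne hc', hInv', hP'.trans hP, by omega, le_rfl⟩
    have := hroots r (by rw [← hP]; exact List.mem_append_right _ hr)
    omega

end RAM

namespace RAM

set_option linter.constructorNameAsVariable false

/-! ### Copying the transitions -/

/-- It is used with the offsets `3`, `4`, `5`, because three header cells precede the transitions in
the input. -/
def inpAt (d : ℕ) : Expr := .inp (.add (.mul (.const 3) (.var .c)) (.const d))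

def tripleAt (d : ℕ) : Expr := .add (.mul (.const 3) (.var .c)) (.const d)

/-- The transition number `c` is copied, together with the triples `(x, ε, x)` for its origin and
its destination. -/
def copyBlock : Block :=
  .put .src (tripleAt 0) (inpAt 3) ;; .put .lab (tripleAt 0) (inpAt 4) ;;
  .put .dst (tripleAt 0) (inpAt 5) ;;
  .put .src (tripleAt 1) (inpAt 3) ;; .put .lab (tripleAt 1) (.const 0) ;;
  .put .dst (tripleAt 1) (inpAt 3) ;;
  .put .src (tripleAt 2) (inpAt 5) ;; .put .lab (tripleAt 2) (.const 0) ;;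
  .put .dst (tripleAt 2) (inpAt 5) ;;
  .set .c (.add (.var .c) (.const 1))

/-- The transition number `e` has been copied. -/
def Copied (st : Store) (e : ℕ) : Prop :=
  (st.arr .src (3 * e) = st.inp (3 * e + 3) ∧ st.arr .lab (3 * e) = st.inp (3 * e + 4) ∧
    st.arr .dst (3 * e) = st.inp (3 * e + 5)) ∧
  (st.arr .src (3 * e + 1) = st.inp (3 * e + 3) ∧ st.arr .lab (3 * e + 1) = 0 ∧
    st.arr .dst (3 * e + 1) = st.inp (3 * e + 3)) ∧
  (st.arr .src (3 * e + 2) = st.inp (3 * e + 5) ∧ st.arr .lab (3 * e + 2) = 0 ∧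
    st.arr .dst (3 * e + 2) = st.inp (3 * e + 5))

def copyCode : Code := .loop (.var .c) (.var .E) copyBlock

theorem copyBlock_run (st : Store) : (copyBlock.run st).reg .c = st.reg .c + 1 ∧
    Copied (copyBlock.run st) (st.reg .c) ∧
    ∀ e < st.reg .c, Copied st e → Copied (copyBlock.run st) e := by
  refine ⟨by simp [copyBlock, Block.run], ?_, fun e he h => ?_⟩
  · simp [copyBlock, Block.run, Copied, tripleAt, inpAt]
  · have h0 : ∀ a b, a < 3 → b < 3 → 3 * e + a ≠ 3 * st.reg .c + b := by omega
    have h1 := h0 0 0 (by omega) (by omega)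
    have h2 := h0 0 1 (by omega) (by omega)
    have h3 := h0 0 2 (by omega) (by omega)
    have h4 := h0 1 0 (by omega) (by omega)
    have h5 := h0 1 1 (by omega) (by omega)
    have h6 := h0 1 2 (by omega) (by omega)
    have h7 := h0 2 0 (by omega) (by omega)
    have h8 := h0 2 1 (by omega) (by omega)
    have h9 := h0 2 2 (by omega) (by omega)
    have h10 : e ≠ st.reg .c := by omega
    simp only [add_zero] at h1 h2 h3 h4 h7
    simpa [copyBlock, Block.run, Copied, tripleAt, inpAt, Function.update_apply, h1, h2, h3, h4, h5,
      h6, h7, h8, h9, h10] using h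

theorem copyCode_runs {B V W : ℕ} (hBV : B ≤ V) (hW : copyCode.bd V ≤ W) {st₀ : Store}
    (hst : st₀.Bdd V) (hc : st₀.reg .c = 0) (hB : 3 * st₀.reg .E + 3 ≤ B) :
    copyCode.Runs B V W st₀ ((st₀.reg .E + 1) * (copyBlock.cost + 5))
      (fun st' => copyBlock.Frame st₀ st' ∧ ∀ e < st₀.reg .E, Copied st' e) := by
  let I : ℕ → Store → Prop := fun m st => m + st.reg .c = st₀.reg .E ∧ ∀ e < st.reg .c, Copied st e
  have h := Code.Runs.loop_frame hBV (W := W) (N := st₀.reg .E) hW (fun _ => by simp) hst I ?_ ?_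
  · intro s hR
    obtain ⟨t, s', st', h1, h2, h3, h4, h5, ⟨m, g1, g2⟩, h7⟩ := h s hR
    refine ⟨t, s', st', h1, h2, h3, h4, h5, fun e he => g2 e ?_⟩
    have hE : st'.reg .E = st₀.reg .E := h5.reg _ (by decide)
    simp only [Expr.eval, hE] at h7
    omega
  · rintro m st hb hF ⟨g1, g2⟩ hlt
    have hE : st.reg .E = st₀.reg .E := hF.reg _ (by decide)
    simp only [Expr.eval, hE] at hlt
    obtain ⟨r1, r2, r3⟩ := copyBlock_run st
    have hi := hb.inp
    refine ⟨?_, m - 1, by omega, by omega, fun e he => ?_⟩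
    · have := hb.reg .E
      simp [copyBlock, Block.Ok, Block.run, tripleAt, inpAt, hi]
      omega
    · rcases (show e < st.reg .c ∨ e = st.reg .c by omega) with he | rfl
      · exact r3 e he (g2 e he)
      · exact r2
  · exact ⟨by omega, by omega⟩

/-! ### Counting in a system with three digits -/

/-- The counter `c` and its digits `i`, `j`, `k` to the base `m` are advanced. -/
def advance : Block :=
  .set .c (.add (.var .c) (.const 1)) ;; .set .k (.add (.var .k) (.const 1)) ;;
  .ite (.var .k) (.var .m) .skip
    (.set .k (.const 0) ;; .set .j (.add (.var .j) (.const 1)) ;;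
      .ite (.var .j) (.var .m) .skip
        (.set .j (.const 0) ;; .set .i (.add (.var .i) (.const 1))))

/-- The variables `i`, `j`, `k` are the digits of `c` to the base `m`. -/
def Digits (st : Store) : Prop :=
  st.reg .c = (st.reg .i * st.reg .m + st.reg .j) * st.reg .m + st.reg .k ∧
    (0 < st.reg .m → st.reg .j < st.reg .m ∧ st.reg .k < st.reg .m)

theorem Digits.lt {st : Store} (h : Digits st)
    (hc : st.reg .c < st.reg .m * st.reg .m * st.reg .m) :
    0 < st.reg .m ∧ st.reg .i < st.reg .m ∧ st.reg .j < st.reg .m ∧ st.reg .k < st.reg .m := by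
  have hm : 0 < st.reg .m := by
    rcases Nat.eq_zero_or_pos (st.reg .m) with h0 | h0
    · rw [h0] at hc
      omega
    · exact h0
  refine ⟨hm, ?_, h.2 hm⟩
  by_contra hi
  push Not at hi
  have h1 : st.reg .m * st.reg .m * st.reg .m ≤ st.reg .i * st.reg .m * st.reg .m :=
    Nat.mul_le_mul_right _ (Nat.mul_le_mul_right _ hi)
  have h2 := h.1
  rw [add_mul] at h2
  omega

/-- Keeping the digits along with `c` lets a single loop enumerate all triples without division. -/
theorem advance_digits {st : Store} (hc : st.reg .c < st.reg .m * st.reg .m * st.reg .m)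
    (h : Digits st) : Digits (advance.run st) ∧ (advance.run st).reg .c = st.reg .c + 1 := by
  obtain ⟨hm, -, hj, hk⟩ := h.lt hc
  obtain ⟨h1, -⟩ := h
  by_cases hk' : st.reg .k + 1 < st.reg .m
  · simp [Digits, advance, Block.run, hk', hj, h1]
    ring
  · obtain hk'' : st.reg .m = st.reg .k + 1 := by omega
    by_cases hj' : st.reg .j + 1 < st.reg .m
    · simp [Digits, advance, Block.run, hk', hj', h1, hm]
      rw [add_assoc, ← hk'']
      ring
    · have hj'' : st.reg .m = st.reg .j + 1 := by omega
      simp [Digits, advance, Block.run, hk', hj', h1, hm]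
      rw [add_assoc, ← hk'']
      have : (st.reg .i + 1) * st.reg .m = st.reg .i * st.reg .m + (st.reg .j + 1) := by
        rw [← hj'']
        ring
      rw [this]
      ring

theorem advance_ok {B V : ℕ} {st : Store} (hb : st.Bdd V)
    (h : Digits st) (hc : st.reg .c < st.reg .m * st.reg .m * st.reg .m)
    (hV : st.reg .m * st.reg .m * st.reg .m ≤ V) : advance.Ok B V st := by
  obtain ⟨hm, hi, hj, hk⟩ := h.lt hc
  have := hb.reg .m
  have hi1 := hb.reg .i
  simp only [advance, Block.Ok, Block.run, Expr.Ok, Expr.eval, and_true, true_and]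
  simp
  omega

/-! ### Building the product graph -/

/-- The edge from `org` to `des` is added to the graph. -/
def addEdge : Block :=
  .set .M (.add (.var .M) (.const 1)) ;;
  .put .tg (.var .M) (.var .des) ;; .put .nx (.var .M) (.get .hd (.var .org)) ;;
  .put .hd (.var .org) (.var .M) ;;
  .put .rtg (.var .M) (.var .org) ;; .put .rnx (.var .M) (.get .rhd (.var .des)) ;;
  .put .rhd (.var .des) (.var .M)

/-- The store holds the graph `G`. -/
structure HoldsGraph (st : Store) (G : List (ℕ × ℕ)) : Prop where
  fwd : Linked (st.reg .M) (st.arr .nx) (st.arr .tg) (st.arr .hd) G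
  bwd : Linked (st.reg .M) (st.arr .rnx) (st.arr .rtg) (st.arr .rhd) (G.map Prod.swap)
  length : st.reg .M = G.length
  origins : downList (st.arr .rtg) (st.reg .M) = G.map Prod.fst

theorem HoldsGraph.congr {st st' : Store} {G : List (ℕ × ℕ)} (h : HoldsGraph st G)
    (ha : st'.arr = st.arr) (hM : st'.reg .M = st.reg .M) : HoldsGraph st' G := by
  obtain ⟨h1, h2, h3, h4⟩ := h
  exact ⟨by rwa [ha, hM], by rwa [ha, hM], by rwa [hM], by rwa [ha, hM]⟩

/-- The array `rtg` has two uses: it holds the targets of the reversed lists, and read downwards it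
lists the origins of all edges, which are the roots of the first search. -/
theorem HoldsGraph.addEdge {st : Store} {G : List (ℕ × ℕ)} (h : HoldsGraph st G) :
    HoldsGraph (addEdge.run st) ((st.reg .org, st.reg .des) :: G) := by
  have h1 := h.fwd.cons (st.reg .org) (st.reg .des)
  have h2 := h.bwd.cons (st.reg .des) (st.reg .org)
  refine ⟨?_, ?_, ?_, ?_⟩
  · simpa [RAM.addEdge, Block.run] using h1
  · simpa [RAM.addEdge, Block.run] using h2
  · simp [RAM.addEdge, Block.run, h.length]
  · simpa [RAM.addEdge, Block.run, downList_update_succ] using h.origins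

theorem addEdge_ok {B V : ℕ} {st : Store} (hb : st.Bdd V) (hM : st.reg .M + 1 ≤ V) :
    addEdge.Ok B V st := by
  have hr := hb.reg
  have ha := hb.arr
  simp [addEdge, Block.Ok, Block.run, hr, ha, hM]

/-- The number of a vertex of the product graph as an expression. -/
def codeExpr (x y z : Expr) (φ : ℕ) : Expr :=
  .add (.mul (.add (.mul (.add (.mul x (.var .n)) y) (.var .n)) z) (.const 2)) (.const φ)

def srcAt (v : Var) : Expr := .get .src (.var v)
def labAt (v : Var) : Expr := .get .lab (.var v)
def dstAt (v : Var) : Expr := .get .dst (.var v)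

/-- The target of the edges given by the transitions `i`, `j`, `k` is computed in `des`. -/
def targetBlock : Block :=
  .set .des (codeExpr (srcAt .i) (srcAt .j) (srcAt .k) 1) ;;
  .ite (labAt .i) (labAt .j) .skip (.ite (labAt .j) (labAt .i) .skip
    (.ite (labAt .j) (labAt .k) .skip (.ite (labAt .k) (labAt .j) .skip
      (.ite (.const 0) (labAt .i)
        (.set .des (codeExpr (dstAt .i) (dstAt .j) (dstAt .k) 0))
        (.set .des (codeExpr (dstAt .i) (dstAt .j) (dstAt .k) 1))))))

theorem targetBlock_run (st : Store) : targetBlock.run st =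
    { st with reg := Function.update st.reg .des (edgeTarget (st.reg .n) (st.arr .src) (st.arr .lab)
        (st.arr .dst) (st.reg .i) (st.reg .j) (st.reg .k)) } := by
  -- The block can only compare with `<`, so each equality of labels is tested by two comparisons.
  have h1 : ∀ a b : ℕ, a = b ↔ ¬ a < b ∧ ¬ b < a := by omega
  simp only [targetBlock, Block.run, edgeTarget, codeExpr, srcAt, labAt, dstAt, Expr.eval,
    nodeCode, h1]
  simp
  split_ifs <;> first | rfl | (exfalso; omega)

/-- The first of the edges given by the transitions `i`, `j`, `k` is added. -/
def closingBlock : Block :=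
  .set .org (codeExpr (srcAt .i) (srcAt .j) (srcAt .j) 0) ;;
  .set .des (codeExpr (srcAt .i) (srcAt .i) (srcAt .j) 0) ;; addEdge

/-- The second of the edges given by the transitions `i`, `j`, `k` is added. -/
def moveBlock : Block :=
  .set .org (codeExpr (srcAt .i) (srcAt .j) (srcAt .k) 1) ;; targetBlock ;; addEdge

/-- The third of the edges given by the transitions `i`, `j`, `k` is added. -/
def startBlock : Block :=
  .set .org (codeExpr (srcAt .i) (srcAt .j) (srcAt .k) 0) ;; addEdge

/-- The three edges given by the transitions `i`, `j`, `k` are added. -/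
def edgesBlock : Block := closingBlock ;; moveBlock ;; startBlock

theorem HoldsGraph.set {st : Store} {G : List (ℕ × ℕ)} (h : HoldsGraph st G) (v : Var) (hv : v ≠ .M)
    (e : Expr) : HoldsGraph ((Block.set v e).run st) G :=
  h.congr rfl (by simp [Block.run, Ne.symm hv])

theorem HoldsGraph.targetBlock {st : Store} {G : List (ℕ × ℕ)} (h : HoldsGraph st G) :
    HoldsGraph (targetBlock.run st) G := by
  rw [targetBlock_run]
  exact h.congr rfl (by simp)

theorem HoldsGraph.edgesBlock {st : Store} {G : List (ℕ × ℕ)} (h : HoldsGraph st G) :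
    HoldsGraph (edgesBlock.run st) ((edgesAt (st.reg .n) (st.arr .src) (st.arr .lab) (st.arr .dst)
      (st.reg .i) (st.reg .j) (st.reg .k)).reverse ++ G) := by
  have h1 : HoldsGraph (closingBlock.run st) _ := ((h.set .org (by decide) (codeExpr (srcAt .i)
    (srcAt .j) (srcAt .j) 0)).set .des (by decide)
    (codeExpr (srcAt .i) (srcAt .i) (srcAt .j) 0)).addEdge
  have f1 := closingBlock.frame_run st
  have h2 : HoldsGraph (moveBlock.run (closingBlock.run st)) _ := ((h1.set .org (by decide)
    (codeExpr (srcAt .i) (srcAt .j) (srcAt .k) 1)).targetBlock).addEdge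
  have f2 := moveBlock.frame_run (closingBlock.run st)
  have d2 : (moveBlock.run (closingBlock.run st)).reg .des = edgeTarget (st.reg .n) (st.arr .src)
      (st.arr .lab) (st.arr .dst) (st.reg .i) (st.reg .j) (st.reg .k) := by
    simp only [moveBlock, Block.run, targetBlock_run, RAM.addEdge]
    simp [f1.reg .n (by decide), f1.reg .i (by decide), f1.reg .j (by decide),
      f1.reg .k (by decide), f1.arr .src (by decide), f1.arr .lab (by decide),
      f1.arr .dst (by decide)]
  have h3 : HoldsGraph (startBlock.run (moveBlock.run (closingBlock.run st))) _ :=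
    (h2.set .org (by decide) (codeExpr (srcAt .i) (srcAt .j) (srcAt .k) 0)).addEdge
  change HoldsGraph (startBlock.run (moveBlock.run (closingBlock.run st))) _
  convert h3 using 1
  simp [edgesAt, targetBlock_run, Block.run, codeExpr, srcAt, nodeCode, d2,
    f1.reg .n (by decide), f1.reg .i (by decide), f1.reg .j (by decide), f1.reg .k (by decide),
    f1.arr .src (by decide), f1.arr .lab (by decide), f1.arr .dst (by decide),
    f2.reg .n (by decide), f2.reg .i (by decide), f2.reg .j (by decide), f2.reg .k (by decide),
    f2.arr .src (by decide)]

theorem edgeTarget_lt {n m : ℕ} {S L D : ℕ → ℕ} (hSD : ∀ t < m, S t < n ∧ D t < n) {i j k : ℕ}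
    (hi : i < m) (hj : j < m) (hk : k < m) : edgeTarget n S L D i j k < 2 * n ^ 3 := by
  unfold edgeTarget
  split_ifs
  · exact nodeCode_lt (hSD i hi).2 (hSD j hj).2 (hSD k hk).2 (by omega)
  · exact nodeCode_lt (hSD i hi).2 (hSD j hj).2 (hSD k hk).2 (by omega)
  · exact nodeCode_lt (hSD i hi).1 (hSD j hj).1 (hSD k hk).1 (by omega)

theorem edgesAt_lt {n m : ℕ} {S L D : ℕ → ℕ} (hSD : ∀ t < m, S t < n ∧ D t < n) {i j k : ℕ}
    (hi : i < m) (hj : j < m) (hk : k < m) :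
    ∀ e ∈ edgesAt n S L D i j k, e.1 < 2 * n ^ 3 ∧ e.2 < 2 * n ^ 3 := by
  have h0 := edgeTarget_lt hSD hi hj hk (L := L)
  simp only [edgesAt, List.mem_cons, List.not_mem_nil, or_false]
  rintro e (rfl | rfl | rfl)
  · exact ⟨nodeCode_lt (hSD i hi).1 (hSD j hj).1 (hSD j hj).1 (by omega),
      nodeCode_lt (hSD i hi).1 (hSD i hi).1 (hSD j hj).1 (by omega)⟩
  · exact ⟨nodeCode_lt (hSD i hi).1 (hSD j hj).1 (hSD k hk).1 (by omega), h0⟩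
  · exact ⟨nodeCode_lt (hSD i hi).1 (hSD j hj).1 (hSD k hk).1 (by omega), h0⟩

/-- The entries of the digits in the arrays of origins and destinations are below `n`. -/
structure Small (st : Store) : Prop where
  i : st.arr .src (st.reg .i) < st.reg .n ∧ st.arr .dst (st.reg .i) < st.reg .n
  j : st.arr .src (st.reg .j) < st.reg .n ∧ st.arr .dst (st.reg .j) < st.reg .n
  k : st.arr .src (st.reg .k) < st.reg .n ∧ st.arr .dst (st.reg .k) < st.reg .n

theorem Small.congr {P : Block} {st st' : Store} (h : Small st) (hF : P.Frame st st')
    (hv : ∀ v ∈ [Var.n, .i, .j, .k], v ∉ P.vars) (ha : ∀ a ∈ [Arr.src, .dst], a ∉ P.arrs) :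
    Small st' := by
  obtain ⟨h1, h2, h3⟩ := h
  have e1 := hF.reg .n (hv _ (by decide))
  have e2 := hF.reg .i (hv _ (by decide))
  have e3 := hF.reg .j (hv _ (by decide))
  have e4 := hF.reg .k (hv _ (by decide))
  have e5 := hF.arr .src (ha _ (by decide))
  have e6 := hF.arr .dst (ha _ (by decide))
  exact ⟨by rwa [e1, e2, e5, e6], by rwa [e1, e3, e5, e6], by rwa [e1, e4, e5, e6]⟩

theorem targetBlock_ok {B V : ℕ} {st : Store} (h : Small st) (hV : 2 * st.reg .n ^ 3 ≤ V) :
    targetBlock.Ok B V st := by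
  have h1 := fun φ hφ => nodeCode_lt (φ := φ) h.i.1 h.j.1 h.k.1 hφ
  have h2 := fun φ hφ => nodeCode_lt (φ := φ) h.i.2 h.j.2 h.k.2 hφ
  have h3 := h1 1 (by omega)
  have h4 := h2 0 (by omega)
  have h5 := h2 1 (by omega)
  unfold nodeCode at h3 h4 h5
  simp [targetBlock, Block.Ok, Block.run, codeExpr, srcAt, labAt, dstAt]
  omega

theorem edgesBlock_ok {B V : ℕ} {st : Store} (hb : st.Bdd V) (h : Small st)
    (hV : 2 * st.reg .n ^ 3 ≤ V) (hM : st.reg .M + 3 ≤ V) : edgesBlock.Ok B V st := by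
  have key : ∀ {st : Store}, Small st → 2 * st.reg .n ^ 3 ≤ V → ∀ {x y z : Var},
      x ∈ [Var.i, .j, .k] → y ∈ [Var.i, .j, .k] → z ∈ [Var.i, .j, .k] → ∀ {φ}, φ < 2 → ∀ v,
      (Block.set v (codeExpr (srcAt x) (srcAt y) (srcAt z) φ)).Ok B V st := by
    intro st h hV x y z hx hy hz φ hφ v
    have hs : ∀ {x}, x ∈ [Var.i, .j, .k] → st.arr .src (st.reg x) < st.reg .n := by
      intro x hx
      simp only [List.mem_cons, List.not_mem_nil, or_false] at hx
      rcases hx with rfl | rfl | rfl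
      exacts [h.i.1, h.j.1, h.k.1]
    have := nodeCode_lt (hs hx) (hs hy) (hs hz) hφ
    unfold nodeCode at this
    simp [Block.Ok, codeExpr, srcAt]
    omega
  have o1 : closingBlock.Ok B V st := by
    have q1 := key h hV (x := .i) (y := .j) (z := .j) (by decide) (by decide) (by decide)
      (φ := 0) (by omega) .org
    have g1 := h.congr (Block.frame_run _ _) (by decide) (by decide)
      (P := .set .org (codeExpr (srcAt .i) (srcAt .j) (srcAt .j) 0))
    have q2 := key g1 hV (x := .i) (y := .i) (z := .j) (by decide) (by decide) (by decide)
      (φ := 0) (by omega) .des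
    exact ⟨q1, q2, addEdge_ok (q2.bdd (q1.bdd hb)) (by simp [Block.run]; omega)⟩
  have f1 := closingBlock.frame_run st
  have s1 := h.congr f1 (by decide) (by decide)
  have b1 := o1.bdd hb
  have n1 := f1.reg .n (by decide)
  have M1 : (closingBlock.run st).reg .M = st.reg .M + 1 := by
    simp [closingBlock, Block.run, addEdge]
  have o2 : moveBlock.Ok B V (closingBlock.run st) := by
    have q1 := key s1 (by rwa [n1]) (x := .i) (y := .j) (z := .k) (by decide) (by decide)
      (by decide) (φ := 1) (by omega) .org
    have g1 := s1.congr (Block.frame_run _ _) (by decide) (by decide)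
      (P := .set .org (codeExpr (srcAt .i) (srcAt .j) (srcAt .k) 1))
    have q2 := targetBlock_ok (B := B) (V := V) g1 (by simpa [Block.run, n1] using hV)
    refine ⟨q1, q2, addEdge_ok (q2.bdd (q1.bdd b1)) ?_⟩
    rw [targetBlock_run]
    simp [Block.run]
    omega
  have f2 := moveBlock.frame_run (closingBlock.run st)
  have s2 := s1.congr f2 (by decide) (by decide)
  have b2 := o2.bdd b1
  have n2 := (f2.reg .n (by decide)).trans n1
  have M2 : (moveBlock.run (closingBlock.run st)).reg .M = st.reg .M + 2 := by
    rw [show st.reg .M + 2 = st.reg .M + 1 + 1 from rfl, ← M1]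
    simp only [moveBlock, Block.run, targetBlock_run, addEdge]
    simp
  have o3 : startBlock.Ok B V (moveBlock.run (closingBlock.run st)) := by
    have q1 := key s2 (by rwa [n2]) (x := .i) (y := .j) (z := .k) (by decide) (by decide)
      (by decide) (φ := 0) (by omega) .org
    exact ⟨q1, addEdge_ok (q1.bdd b2) (by simp [Block.run]; omega)⟩
  exact ⟨o1, o2, o3⟩

/-- The program building the product graph. -/
def buildCode : Code :=
  .loop (.var .c) (.mul (.mul (.var .m) (.var .m)) (.var .m)) (edgesBlock ;; advance)

theorem buildCode_runs {B V W : ℕ} (hBV : B ≤ V) (hW : buildCode.bd V ≤ W) {st₀ : Store}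
    (hst : st₀.Bdd V) (hc : st₀.reg .c = 0) (hi : st₀.reg .i = 0) (hj : st₀.reg .j = 0)
    (hk : st₀.reg .k = 0) (hM : st₀.reg .M = 0) (hhd : ∀ v, st₀.arr .hd v = 0)
    (hrhd : ∀ v, st₀.arr .rhd v = 0)
    (hSD : ∀ t < st₀.reg .m, st₀.arr .src t < st₀.reg .n ∧ st₀.arr .dst t < st₀.reg .n)
    (hn : 2 * st₀.reg .n ^ 3 ≤ V) (hm : 3 * (st₀.reg .m * st₀.reg .m * st₀.reg .m) ≤ V) :
    buildCode.Runs B V W st₀ ((st₀.reg .m * st₀.reg .m * st₀.reg .m + 1) *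
        ((edgesBlock ;; advance).cost + 11))
      (fun st' => (edgesBlock ;; advance).Frame st₀ st' ∧ ∃ G, HoldsGraph st' G ∧
        G.length = 3 * (st₀.reg .m * st₀.reg .m * st₀.reg .m) ∧
        εNFA.ProductGraph (st₀.reg .n) (st₀.reg .m) (st₀.arr .src) (st₀.arr .lab) (st₀.arr .dst) G) := by
  -- The graph built so far consists of the edges of exactly those triples whose number is below the
  -- counter.
  let I : ℕ → Store → Prop := fun m st =>
    m + st.reg .c = st₀.reg .m * st₀.reg .m * st₀.reg .m ∧ Digits st ∧ ∃ G, HoldsGraph st G ∧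
    G.length = 3 * st.reg .c ∧ ∀ e, e ∈ G ↔ ∃ i < st₀.reg .m, ∃ j < st₀.reg .m, ∃ k < st₀.reg .m,
      (i * st₀.reg .m + j) * st₀.reg .m + k < st.reg .c ∧
      e ∈ edgesAt (st₀.reg .n) (st₀.arr .src) (st₀.arr .lab) (st₀.arr .dst) i j k
  have h := Code.Runs.loop_frame hBV (W := W) (N := st₀.reg .m * st₀.reg .m * st₀.reg .m) hW
    (fun _ => by simp) hst I ?_ ?_
  · intro s hR
    obtain ⟨t, s', st', h1, h2, h3, h4, h5, ⟨m, g1, g2, G, g3, g4, g5⟩, h7⟩ := h s hR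
    have hm' : st'.reg .m = st₀.reg .m := h5.reg _ (by decide)
    simp only [Expr.eval, hm'] at h7
    refine ⟨t, s', st', h1, h2, h3, h4, h5, G, g3, by omega, fun e => ?_⟩
    rw [g5]
    constructor
    · rintro ⟨i, hi, j, hj, k, hk, -, he⟩
      exact ⟨i, hi, j, hj, k, hk, he⟩
    · rintro ⟨i, hi, j, hj, k, hk, he⟩
      refine ⟨i, hi, j, hj, k, hk, ?_, he⟩
      have a1 : i * st₀.reg .m + j + 1 ≤ st₀.reg .m * st₀.reg .m := by nlinarith
      have a2 : (i * st₀.reg .m + j) * st₀.reg .m + k + 1 ≤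
          st₀.reg .m * st₀.reg .m * st₀.reg .m := by nlinarith
      omega
  · rintro m st hb hF ⟨g1, g2, G, g3, g4, g5⟩ hlt
    have em : st.reg .m = st₀.reg .m := hF.reg _ (by decide)
    have en : st.reg .n = st₀.reg .n := hF.reg _ (by decide)
    have es : st.arr .src = st₀.arr .src := hF.arr _ (by decide)
    have el : st.arr .lab = st₀.arr .lab := hF.arr _ (by decide)
    have ed : st.arr .dst = st₀.arr .dst := hF.arr _ (by decide)
    have hlt' : st.reg .c < st.reg .m * st.reg .m * st.reg .m := hlt
    obtain ⟨hm0, hi, hj, hk⟩ := g2.lt hlt'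
    rw [em] at hi hj hk
    have hsm : Small st := by
      refine ⟨?_, ?_, ?_⟩ <;> rw [es, ed, en]
      exacts [hSD _ hi, hSD _ hj, hSD _ hk]
    have hMc := g3.length
    rw [em] at hlt'
    have o1 : edgesBlock.Ok B V st := edgesBlock_ok hb hsm (by rwa [en]) (by omega)
    have f := edgesBlock.frame_run st
    have fm := f.reg .m (by decide)
    have fc := f.reg .c (by decide)
    have fi := f.reg .i (by decide)
    have fj := f.reg .j (by decide)
    have fk := f.reg .k (by decide)
    have g2' : Digits (edgesBlock.run st) := by
      unfold Digits
      rw [fm, fc, fi, fj, fk]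
      exact g2
    have hlt2 : (edgesBlock.run st).reg .c < (edgesBlock.run st).reg .m *
        (edgesBlock.run st).reg .m * (edgesBlock.run st).reg .m := by
      rw [fm, fc, em]
      exact hlt'
    obtain ⟨a1, a2⟩ := advance_digits hlt2 g2'
    have fa := advance.frame_run (edgesBlock.run st)
    refine ⟨⟨o1, advance_ok (o1.bdd hb) g2' hlt2 (by rw [fm, em]; omega)⟩, m - 1, by omega, ?_, a1,
      _, g3.edgesBlock.congr (by funext a; exact fa.arr a (by simp [advance, Block.arrs]))
        (fa.reg .M (by decide)), ?_, fun e => ?_⟩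
    · change m - 1 + (advance.run (edgesBlock.run st)).reg .c = _
      rw [a2, fc]
      omega
    · change _ = 3 * (advance.run (edgesBlock.run st)).reg .c
      rw [a2, fc]
      simp [edgesAt, g4]
      ring
    · change _ ↔ ∃ i < st₀.reg .m, ∃ j < st₀.reg .m, ∃ k < st₀.reg .m, _ <
        (advance.run (edgesBlock.run st)).reg .c ∧ _
      rw [a2, fc, List.mem_append, List.mem_reverse, g5, en, es, el, ed]
      have hdig := g2.1
      rw [em] at hdig
      constructor
      · rintro (he | ⟨i, hi', j, hj', k, hk', h1, h2⟩)
        · exact ⟨_, hi, _, hj, _, hk, by omega, he⟩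
        · exact ⟨i, hi', j, hj', k, hk', by omega, h2⟩
      · rintro ⟨i, hi', j, hj', k, hk', h1, h2⟩
        rcases Nat.lt_succ_iff_lt_or_eq.1 h1 with h1 | h1
        · exact Or.inr ⟨i, hi', j, hj', k, hk', h1, h2⟩
        · left
          rw [hdig] at h1
          obtain ⟨e1, e2⟩ := mul_add_inj hk' hk h1
          obtain ⟨e3, e4⟩ := mul_add_inj hj' hj e1
          rwa [← e2, ← e3, ← e4]
  · refine ⟨by omega, ⟨?_, fun h => ?_⟩, [], ⟨?_, ?_, hM, by rw [hM]; rfl⟩, by simp [hc], ?_⟩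
    · simp [hc, hi, hj, hk]
    · omega
    · exact fun v => hhd v
    · exact fun v => hrhd v
    · simp [hc]

end RAM

namespace εNFA

/-! ### The greatest weights of walks, by relaxation -/

/-- `gr v` is the greatest weight of a walk ending in `v`. -/
def Grades {α σ : Type*} (M : εNFA α σ) (R : σ → σ → Prop) (gr : σ → ℕ) : Prop :=
  ∀ v, IsGreatest {d | EndWalk M R v d} (gr v)

theorem exists_grades {α σ : Type*} {M : εNFA α σ} {R : σ → σ → Prop} {b : ℕ}
    (hb : ∀ v d, EndWalk M R v d → d ≤ b) : ∃ gr, Grades M R gr := by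
  classical
  refine ⟨fun v => Nat.findGreatest (fun d => EndWalk M R v d) b, fun v => ⟨?_, fun d hd => ?_⟩⟩
  · exact Nat.findGreatest_spec (P := fun d => EndWalk M R v d) (Nat.zero_le b) (.nil v)
  · exact Nat.le_findGreatest (hb v d hd) hd

/-- An optimal walk to a vertex of `U` is followed backwards while it stays in `U`. All its prefixes
are optimal, and it must come from outside, since a walk starts with weight `0` and grades in `U`
are positive. -/
theorem Grades.exists_entering {α σ : Type*} {M : εNFA α σ} {R : σ → σ → Prop} {gr : σ → ℕ}
    (h : Grades M R gr) {U : Set σ} (hU : ∀ v ∈ U, 0 < gr v) (hne : U.Nonempty) :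
    ∃ p ∉ U, ∃ v ∈ U, (∃ a, v ∈ M.step p a ∧ gr v = gr p) ∨ (R p v ∧ gr v = gr p + 1) := by
  obtain ⟨v, hv⟩ := hne
  obtain ⟨d, hd⟩ : ∃ d, gr v = d := ⟨_, rfl⟩
  have hw : EndWalk M R v d := hd ▸ (h v).1
  induction hw with
  | nil q => exact absurd (hU q hv) (by omega)
  | @step p q a d hw hs ih =>
    have h1 : d ≤ gr p := (h p).2 hw
    have h2 : gr p ≤ gr q := (h q).2 (EndWalk.step (h p).1 hs)
    by_cases hp : p ∈ U
    · exact ih hp (by omega)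
    · exact ⟨p, hp, q, hv, .inl ⟨a, hs, by omega⟩⟩
  | @pair p q d hw hR ih =>
    have h1 : d ≤ gr p := (h p).2 hw
    have h2 : gr p + 1 ≤ gr q := (h q).2 (EndWalk.pair (h p).1 hR)
    by_cases hp : p ∈ U
    · exact ih hp (by omega)
    · exact ⟨p, hp, q, hv, .inr ⟨hR, by omega⟩⟩

variable {n k : ℕ} {A : εNFA (Fin k) (Fin n)} {T : List (Fin n × Option (Fin k) × Fin n)}
  {R : Fin n → Fin n → Prop} {gr : Fin n → ℕ}

/-- The estimate `g` of the grades, with the maximum `best`, after `i` rounds of relaxation and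
`b` further steps. -/
structure Estimate (A : εNFA (Fin k) (Fin n)) (T : List (Fin n × Option (Fin k) × Fin n))
    (R : Fin n → Fin n → Prop) (gr : Fin n → ℕ) (i b : ℕ) (g : Fin n → ℕ) (best : ℕ) : Prop where
  walk : ∀ v, EndWalk A R v (g v)
  best_walk : best = 0 ∨ ∃ q, EndWalk A R q best
  le_best : ∀ v, g v ≤ best
  exact : ∃ U : Finset (Fin n), U.card + i ≤ T.length ∧ (∀ v, g v < gr v → v ∈ U) ∧
    ∀ j k' (_ : j < T.length) (_ : k' < T.length), j * T.length + k' < b → T[j].1 ∉ U →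
      gr T[j].1 ≤ g T[j].2.2 ∧ (R T[j].1 T[k'].1 → gr T[j].1 + 1 ≤ g T[k'].1)

/-- The estimate `0` is wrong only at vertices of positive grade. Such a vertex ends a transition or
a pair, so its stay triple makes it an origin in `T`. -/
theorem Estimate.init (hT : StayList A T) (hR : ∀ p q, R p q → (q, none, q) ∈ T)
    (hgr : Grades A R gr) : Estimate A T R gr 0 0 (fun _ => 0) 0 where
  walk v := .nil v
  best_walk := .inl rfl
  le_best _ := le_rfl
  exact := by
    classical
    refine ⟨(T.map Prod.fst).toFinset, ?_, fun v hv => ?_, fun _ _ _ _ h => absurd h (by omega)⟩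
    · simpa using List.toFinset_card_le (T.map Prod.fst)
    · have hw := (hgr v).1
      have : (v, none, v) ∈ T := by
        generalize gr v = d at hv hw
        cases hw with
        | nil => omega
        | step _ hs => exact hT.stay_dest _ (hT.step _ _ _ hs)
        | pair _ h => exact hR _ _ h
      exact List.mem_toFinset.2 (List.mem_map.2 ⟨_, this, rfl⟩)

/-- Estimates only grow and are always attained by walks. An origin outside `U` has its exact grade
from the start of the round, so relaxing its transition or pair brings the target up to what this
edge demands. -/
theorem Estimate.relax (hT : StayList A T) {i j k' : ℕ} {g : Fin n → ℕ}
    {best : ℕ} (hj : j < T.length) (hk : k' < T.length)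
    (h : Estimate A T R gr i (j * T.length + k') g best) {g₁ g₂ : Fin n → ℕ} {best' : ℕ}
    (h₁ : g₁ = Function.update g T[j].2.2 (max (g T[j].2.2) (g T[j].1)))
    (h₂ : R T[j].1 T[k'].1 → g₂ = Function.update g₁ T[k'].1 (max (g₁ T[k'].1) (g₁ T[j].1 + 1)) ∧
      best' = max best (g₁ T[j].1 + 1))
    (h₃ : ¬ R T[j].1 T[k'].1 → g₂ = g₁ ∧ best' = best) :
    Estimate A T R gr i (j * T.length + k' + 1) g₂ best' := by
  have w₁ : ∀ v, EndWalk A R v (g₁ v) := by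
    intro v
    rw [h₁, Function.update_apply]
    split_ifs with hv
    · subst hv
      rcases max_choice (g T[j].2.2) (g T[j].1) with hm | hm <;> rw [hm]
      · exact h.walk _
      · rcases hT.step_or_stay _ (List.getElem_mem hj) with hs | ⟨-, hs⟩
        · exact .step (h.walk _) hs
        · rw [← hs]
          exact h.walk _
    · exact h.walk v
  have m₁ : ∀ v, g v ≤ g₁ v := by
    intro v
    rw [h₁, Function.update_apply]
    split_ifs with hv
    · subst hv
      exact le_max_left _ _
    · exact le_rfl
  have b₁ : ∀ v, g₁ v ≤ best := by
    intro v
    rw [h₁, Function.update_apply]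
    split_ifs with hv
    · exact max_le (h.le_best _) (h.le_best _)
    · exact h.le_best v
  have m₂ : ∀ v, g₁ v ≤ g₂ v := by
    intro v
    by_cases hR : R T[j].1 T[k'].1
    · rw [(h₂ hR).1, Function.update_apply]
      split_ifs with hv
      · subst hv
        exact le_max_left _ _
      · exact le_rfl
    · rw [(h₃ hR).1]
  have d₁ : g T[j].1 ≤ g₁ T[j].2.2 := by
    rw [h₁, Function.update_self]
    exact le_max_right _ _
  refine ⟨fun v => ?_, ?_, fun v => ?_, ?_⟩
  · by_cases hR : R T[j].1 T[k'].1
    · rw [(h₂ hR).1, Function.update_apply]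
      split_ifs with hv
      · subst hv
        rcases max_choice (g₁ T[k'].1) (g₁ T[j].1 + 1) with hm | hm <;> rw [hm]
        · exact w₁ _
        · exact .pair (w₁ _) hR
      · exact w₁ v
    · rw [(h₃ hR).1]
      exact w₁ v
  · by_cases hR : R T[j].1 T[k'].1
    · rw [(h₂ hR).2]
      rcases max_choice best (g₁ T[j].1 + 1) with hm | hm <;> rw [hm]
      · exact h.best_walk
      · exact .inr ⟨_, .pair (w₁ _) hR⟩
    · rw [(h₃ hR).2]
      exact h.best_walk
  · by_cases hR : R T[j].1 T[k'].1
    · rw [(h₂ hR).1, (h₂ hR).2, Function.update_apply]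
      split_ifs with hv
      · exact max_le_max (b₁ _) le_rfl
      · exact le_max_of_le_left (b₁ v)
    · rw [(h₃ hR).1, (h₃ hR).2]
      exact b₁ v
  · obtain ⟨U, u1, u2, u3⟩ := h.exact
    refine ⟨U, u1, fun v hv => u2 v (lt_of_le_of_lt ((m₁ v).trans (m₂ v)) hv),
      fun j₁ k₁ hj₁ hk₁ hlt hU => ?_⟩
    rcases Nat.lt_succ_iff_lt_or_eq.1 hlt with hlt | heq
    · obtain ⟨a1, a2⟩ := u3 j₁ k₁ hj₁ hk₁ hlt hU
      exact ⟨a1.trans ((m₁ _).trans (m₂ _)), fun hR => (a2 hR).trans ((m₁ _).trans (m₂ _))⟩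
    · obtain ⟨rfl, rfl⟩ := mul_add_inj hk₁ hk heq
      have hp : gr T[j₁].1 ≤ g T[j₁].1 := by
        by_contra hlt
        exact hU (u2 _ (by omega))
      refine ⟨hp.trans (d₁.trans (m₂ _)), fun hR => ?_⟩
      rw [(h₂ hR).1, Function.update_self]
      exact le_max_of_le_right (Nat.succ_le_succ (hp.trans (m₁ _)))

/-- Each round with wrong vertices left removes at least one from `U`: otherwise an optimal walk
would enter the wrong vertices from an exact one, and the round has relaxed that very edge or pair.
-/
theorem Estimate.next_round (hT : StayList A T)
    (hR : ∀ p q, R p q → (p, none, p) ∈ T ∧ (q, none, q) ∈ T) (hgr : Grades A R gr) {i : ℕ}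
    (hi : i < T.length) {g : Fin n → ℕ} {best : ℕ}
    (h : Estimate A T R gr i (T.length * T.length) g best) :
    Estimate A T R gr (i + 1) 0 g best := by
  classical
  refine ⟨h.walk, h.best_walk, h.le_best, ?_⟩
  obtain ⟨U, u1, u2, u3⟩ := h.exact
  refine ⟨Finset.univ.filter fun v => g v < gr v, ?_, fun v hv => by simpa using hv,
    fun _ _ _ _ h => absurd h (by omega)⟩
  set U' := Finset.univ.filter fun v => g v < gr v with hU'
  have hsub : U' ⊆ U := fun v hv => u2 v (by simpa [hU'] using hv)
  rcases U'.eq_empty_or_nonempty with he | hne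
  · rw [he]
    simp
    omega
  · have hss : U' ⊂ U := by
      refine hsub.ssubset_of_ne fun heq => ?_
      obtain ⟨p, hp, v, hv, hpv⟩ := hgr.exists_entering (U := U')
        (fun v hv => by
          have : g v < gr v := by simpa [hU'] using hv
          omega) hne
      have hv' : g v < gr v := by simpa [hU'] using hv
      rw [Finset.mem_coe, heq] at hp
      have hlt : ∀ j k' : ℕ, j < T.length → k' < T.length →
          j * T.length + k' < T.length * T.length := by
        intro j k' hj hk
        nlinarith
      rcases hpv with ⟨a, hs, he⟩ | ⟨hRpv, he⟩
      · obtain ⟨j, hj, hjT⟩ := List.getElem_of_mem (hT.step _ _ _ hs)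
        have := (u3 j j hj hj (hlt _ _ hj hj) (by rwa [hjT])).1
        rw [hjT] at this
        simp only at this
        omega
      · obtain ⟨h1, h2⟩ := hR _ _ hRpv
        obtain ⟨j, hj, hjT⟩ := List.getElem_of_mem h1
        obtain ⟨k', hk, hkT⟩ := List.getElem_of_mem h2
        have := (u3 j k' hj hk (hlt _ _ hj hk) (by rwa [hjT])).2
        rw [hjT, hkT] at this
        have := this hRpv
        simp only at this
        omega
    have := Finset.card_lt_card hss
    omega

theorem Estimate.le_best_of_endWalk (hgr : Grades A R gr) {b : ℕ} {g : Fin n → ℕ} {best : ℕ}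
    (h : Estimate A T R gr T.length b g best) {q : Fin n} {d : ℕ} (hw : EndWalk A R q d) :
    d ≤ best := by
  obtain ⟨U, u1, u2, -⟩ := h.exact
  have hU : U = ∅ := Finset.card_eq_zero.1 (by omega)
  refine ((hgr q).2 hw).trans (le_trans ?_ (h.le_best q))
  by_contra hlt
  have := u2 q (by omega)
  simp [hU] at this

end εNFA

namespace RAM

/-! ### Relaxation as a program -/

/-- Relaxation of the transition `j`. -/
def stepBlock : Block :=
  .ite (.get .grade (dstAt .j)) (.get .grade (srcAt .j))
    (.put .grade (dstAt .j) (.get .grade (srcAt .j))) .skip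

/-- Relaxation of the pair of the origins of the transitions `j` and `k`. -/
def raiseBlock : Block :=
  .set .x (.add (.get .grade (srcAt .j)) (.const 1)) ;;
  .ite (.get .grade (srcAt .k)) (.var .x) (.put .grade (srcAt .k) (.var .x)) .skip ;;
  .ite (.var .best) (.var .x) (.set .best (.var .x)) .skip

/-- Relaxation of the pair, if its two vertices of the product graph have the same mark. -/
def markBlock : Block :=
  .ite (.get .rmark (.var .org)) (.get .rmark (.var .des)) .skip
    (.ite (.get .rmark (.var .des)) (.get .rmark (.var .org)) .skip raiseBlock)

def pairBlock : Block :=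
  .set .org (codeExpr (srcAt .j) (srcAt .j) (srcAt .k) 0) ;;
  .set .des (codeExpr (srcAt .j) (srcAt .k) (srcAt .k) 0) ;;
  .ite (srcAt .j) (srcAt .k) markBlock (.ite (srcAt .k) (srcAt .j) markBlock .skip)

theorem stepBlock_run (st : Store) : (stepBlock.run st).arr .grade =
    Function.update (st.arr .grade) (st.arr .dst (st.reg .j))
      (max (st.arr .grade (st.arr .dst (st.reg .j))) (st.arr .grade (st.arr .src (st.reg .j)))) := by
  simp only [stepBlock, Block.run, srcAt, dstAt, Expr.eval]
  split_ifs with h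
  · simp [h, max_eq_right h.le]
  · simp [h, max_eq_left (not_lt.1 h)]

theorem raiseBlock_run (st : Store) : (raiseBlock.run st).arr .grade =
    Function.update (st.arr .grade) (st.arr .src (st.reg .k))
      (max (st.arr .grade (st.arr .src (st.reg .k)))
        (st.arr .grade (st.arr .src (st.reg .j)) + 1)) ∧
    (raiseBlock.run st).reg .best =
      max (st.reg .best) (st.arr .grade (st.arr .src (st.reg .j)) + 1) := by
  simp only [raiseBlock, Block.run, srcAt, Expr.eval]
  simp
  split_ifs <;> simp_all [le_of_lt]

/-- The pair of the origins of `j` and `k` passes the test. -/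
def Marked (st : Store) : Prop :=
  st.arr .src (st.reg .j) ≠ st.arr .src (st.reg .k) ∧
  st.arr .rmark (nodeCode (st.reg .n) (st.arr .src (st.reg .j)) (st.arr .src (st.reg .j))
      (st.arr .src (st.reg .k)) 0) =
    st.arr .rmark (nodeCode (st.reg .n) (st.arr .src (st.reg .j)) (st.arr .src (st.reg .k))
      (st.arr .src (st.reg .k)) 0)

theorem pairBlock_run (st : Store) :
    (Marked st → (pairBlock.run st).arr .grade =
      Function.update (st.arr .grade) (st.arr .src (st.reg .k))
        (max (st.arr .grade (st.arr .src (st.reg .k)))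
          (st.arr .grade (st.arr .src (st.reg .j)) + 1)) ∧
      (pairBlock.run st).reg .best =
        max (st.reg .best) (st.arr .grade (st.arr .src (st.reg .j)) + 1)) ∧
    (¬ Marked st → (pairBlock.run st).arr .grade = st.arr .grade ∧
      (pairBlock.run st).reg .best = st.reg .best) := by
  classical
  set st₁ := (Block.set .des (codeExpr (srcAt .j) (srcAt .k) (srcAt .k) 0)).run
    ((Block.set .org (codeExpr (srcAt .j) (srcAt .j) (srcAt .k) 0)).run st) with hst₁
  have ho : st₁.reg .org = nodeCode (st.reg .n) (st.arr .src (st.reg .j)) (st.arr .src (st.reg .j))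
      (st.arr .src (st.reg .k)) 0 := by
    simp [hst₁, Block.run, codeExpr, srcAt, nodeCode]
  have hd : st₁.reg .des = nodeCode (st.reg .n) (st.arr .src (st.reg .j)) (st.arr .src (st.reg .k))
      (st.arr .src (st.reg .k)) 0 := by
    simp [hst₁, Block.run, codeExpr, srcAt, nodeCode]
  have ha : st₁.arr = st.arr := rfl
  have hj : st₁.reg .j = st.reg .j := by simp [hst₁, Block.run]
  have hk : st₁.reg .k = st.reg .k := by simp [hst₁, Block.run]
  have hb : st₁.reg .best = st.reg .best := by simp [hst₁, Block.run]
  have hrun : pairBlock.run st = if Marked st then raiseBlock.run st₁ else st₁ := by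
    change (Block.ite (srcAt .j) (srcAt .k) markBlock
      (.ite (srcAt .k) (srcAt .j) markBlock .skip)).run st₁ = _
    simp only [Block.run, markBlock, srcAt, Expr.eval, ho, hd, ha, hj, hk]
    by_cases h : Marked st
    · rw [if_pos h]
      unfold Marked at h
      split_ifs <;> first | rfl | (exfalso; omega)
    · rw [if_neg h]
      unfold Marked at h
      split_ifs <;> first | rfl | (exfalso; omega)
  have hr := raiseBlock_run st₁
  rw [ha, hj, hk, hb] at hr
  rw [hrun]
  refine ⟨fun h => ?_, fun h => ?_⟩
  · rw [if_pos h]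
    exact hr
  · rw [if_neg h]
    exact ⟨rfl, hb⟩

theorem pairBlock_ok {B V : ℕ} {st : Store} (h : Small st) (hV : 2 * st.reg .n ^ 3 ≤ V)
    (hg : ∀ v, st.arr .grade v + 1 ≤ V) : pairBlock.Ok B V st := by
  have b1 := hg (st.arr .src (st.reg .j))
  have c1 := nodeCode_lt h.j.1 h.j.1 h.k.1 (φ := 0) (by omega)
  have c2 := nodeCode_lt h.j.1 h.k.1 h.k.1 (φ := 0) (by omega)
  unfold nodeCode at c1 c2
  simp [pairBlock, markBlock, raiseBlock, Block.Ok, Block.run, srcAt, codeExpr, b1,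
    apply_ite Store.reg, ite_apply]
  omega

theorem relax_ok {B V : ℕ} {st : Store} (hb : st.Bdd V) (h : Small st)
    (hV : 2 * st.reg .n ^ 3 ≤ V) (hg : ∀ v, st.arr .grade v + 1 ≤ V) :
    (stepBlock ;; pairBlock).Ok B V st := by
  have o1 : stepBlock.Ok B V st := by
    simp [stepBlock, Block.Ok, srcAt, dstAt, hb.arr]
  have f := stepBlock.frame_run st
  refine ⟨o1, pairBlock_ok (h.congr f (by decide) (by decide))
    (by rwa [f.reg .n (by decide)]) fun v => ?_⟩
  have h1 := hg v
  have h2 := hg (st.arr .dst (st.reg .j))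
  have h3 := hg (st.arr .src (st.reg .j))
  rw [stepBlock_run, Function.update_apply]
  split_ifs
  · omega
  · exact h1

theorem Digits.split {st : Store} (h : Digits st) : st.reg .c =
    st.reg .i * (st.reg .m * st.reg .m) + (st.reg .j * st.reg .m + st.reg .k) := by
  rw [h.1]
  ring

/-- `j` and `k` together form one digit to the base `m * m`, and `i` counts the completed rounds. -/
theorem advance_split {st : Store} (hc : st.reg .c < st.reg .m * st.reg .m * st.reg .m)
    (h : Digits st) :
    ((advance.run st).reg .i = st.reg .i ∧ (advance.run st).reg .j * st.reg .m +
      (advance.run st).reg .k = st.reg .j * st.reg .m + st.reg .k + 1) ∨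
    ((advance.run st).reg .i = st.reg .i + 1 ∧ (advance.run st).reg .j * st.reg .m +
      (advance.run st).reg .k = 0 ∧
      st.reg .j * st.reg .m + st.reg .k + 1 = st.reg .m * st.reg .m) := by
  obtain ⟨hm, -, hj, hk⟩ := h.lt hc
  obtain ⟨hd, he⟩ := advance_digits hc h
  have s1 := h.split
  have s2 := hd.split
  have em : (advance.run st).reg .m = st.reg .m := (advance.frame_run st).reg _ (by decide)
  have hlt := hd.2
  rw [em] at s2 hlt
  obtain ⟨hj', hk'⟩ := hlt hm
  rw [he, s1] at s2
  generalize (advance.run st).reg .i = i' at *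
  generalize (advance.run st).reg .j = j' at *
  generalize (advance.run st).reg .k = k' at *
  have h1 : j' * st.reg .m + k' < st.reg .m * st.reg .m := by nlinarith
  have h2 : st.reg .j * st.reg .m + st.reg .k < st.reg .m * st.reg .m := by nlinarith
  rcases (show st.reg .j * st.reg .m + st.reg .k + 1 < st.reg .m * st.reg .m ∨
    st.reg .j * st.reg .m + st.reg .k + 1 = st.reg .m * st.reg .m by omega) with hl | hl
  · rw [add_assoc] at s2
    obtain ⟨e1, e2⟩ := mul_add_inj hl h1 s2
    exact Or.inl ⟨e1.symm, e2.symm⟩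
  · rw [add_assoc, hl] at s2
    have s3 : (st.reg .i + 1) * (st.reg .m * st.reg .m) + 0 =
        i' * (st.reg .m * st.reg .m) + (j' * st.reg .m + k') := by
      rw [← s2]
      ring
    obtain ⟨e1, e2⟩ := mul_add_inj (by omega) h1 s3
    exact Or.inr ⟨e1.symm, e2.symm, hl⟩

/-- The program computing the greatest weight of a walk. -/
def relaxCode : Code :=
  .loop (.var .c) (.mul (.mul (.var .m) (.var .m)) (.var .m)) ((stepBlock ;; pairBlock) ;; advance)

open εNFA in
theorem relaxCode_runs {B V W n k : ℕ} {A : εNFA (Fin k) (Fin n)}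
    {T : List (Fin n × Option (Fin k) × Fin n)} {R : Fin n → Fin n → Prop} {gr : Fin n → ℕ}
    (hT : StayList A T) (hRT : ∀ p q, R p q → (p, none, p) ∈ T ∧ (q, none, q) ∈ T)
    (hgr : Grades A R gr) (hBV : B ≤ V) (hW : relaxCode.bd V ≤ W) {st₀ : Store}
    (hst : st₀.Bdd V) (hc : st₀.reg .c = 0) (hi : st₀.reg .i = 0) (hj : st₀.reg .j = 0)
    (hk : st₀.reg .k = 0) (hbest : st₀.reg .best = 0) (hgrade : ∀ v, st₀.arr .grade v = 0)
    (hn : st₀.reg .n = n) (hm : st₀.reg .m = T.length)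
    (hS : Holds T (st₀.arr .src) (st₀.arr .lab) (st₀.arr .dst))
    (hR : ∀ p q : Fin n, (p, none, p) ∈ T → (q, none, q) ∈ T → (R p q ↔ p ≠ q ∧
      st₀.arr .rmark (nodeCode n p p q 0) = st₀.arr .rmark (nodeCode n p q q 0)))
    (hV : 2 * n ^ 3 ≤ V) (hmV : T.length * T.length * T.length ≤ V) :
    relaxCode.Runs B V W st₀ ((T.length * T.length * T.length + 1) *
        (((stepBlock ;; pairBlock) ;; advance).cost + 11))
      (fun st' => (st'.reg .best = 0 ∨ ∃ q, EndWalk A R q (st'.reg .best)) ∧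
        ∀ q d, EndWalk A R q d → d ≤ st'.reg .best) := by
  -- The maximum grows by at most one per step, so it stays below the counter; this keeps all grades
  -- within the word size.
  let I : ℕ → Store → Prop := fun m st =>
    m + st.reg .c = T.length * T.length * T.length ∧ Digits st ∧ st.reg .best ≤ st.reg .c ∧
    (∀ v, st.arr .grade v ≤ st.reg .best) ∧
    Estimate A T R gr (st.reg .i) (st.reg .j * T.length + st.reg .k)
      (fun v => st.arr .grade v) (st.reg .best)
  have h := Code.Runs.loop_frame hBV (W := W) (N := T.length * T.length * T.length) hW
    (fun _ => by simp) hst I ?_ ?_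
  · intro s hR
    obtain ⟨t, s', st', h1, h2, h3, h4, h5, ⟨m, g1, g2, g3, g4, g5⟩, h7⟩ := h s hR
    have hm' : st'.reg .m = T.length := (h5.reg _ (by decide)).trans hm
    simp only [Expr.eval, hm'] at h7
    refine ⟨t, s', st', h1, h2, h3, h4, g5.best_walk, fun q d hw => ?_⟩
    -- Without transitions the loop is never entered and `0` rounds are enough; otherwise the final
    -- counter shows that exactly `T.length` rounds were completed.
    rcases Nat.eq_zero_or_pos T.length with h0 | h0
    · have hi : st'.reg .i = T.length := by
        obtain ⟨U, u1, -⟩ := g5.exact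
        omega
      rw [hi] at g5
      exact g5.le_best_of_endWalk hgr hw
    · have hd := g2.split
      rw [hm'] at hd
      obtain ⟨hj, hk⟩ := g2.2 (by omega)
      rw [hm'] at hj hk
      have hlt : st'.reg .j * T.length + st'.reg .k < T.length * T.length := by nlinarith
      have hc' : st'.reg .c = T.length * (T.length * T.length) + 0 := by
        rw [← mul_assoc]
        omega
      rw [hc'] at hd
      obtain ⟨hi, -⟩ := mul_add_inj (by positivity) hlt hd
      rw [← hi] at g5
      exact g5.le_best_of_endWalk hgr hw
  · rintro m st hb hF ⟨g1, g2, g3, g4, g5⟩ hlt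
    have em : st.reg .m = T.length := (hF.reg _ (by decide)).trans hm
    have en : st.reg .n = n := (hF.reg _ (by decide)).trans hn
    have es : st.arr .src = st₀.arr .src := hF.arr _ (by decide)
    have ed : st.arr .dst = st₀.arr .dst := hF.arr _ (by decide)
    have er : st.arr .rmark = st₀.arr .rmark := hF.arr _ (by decide)
    have hlt' : st.reg .c < st.reg .m * st.reg .m * st.reg .m := hlt
    obtain ⟨hm0, hi, hj, hk⟩ := g2.lt hlt'
    rw [em] at hi hj hk
    rw [em] at hlt'
    obtain ⟨S1, -, D1⟩ := hS _ hi
    obtain ⟨S2, -, D2⟩ := hS _ hj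
    obtain ⟨S3, -, D3⟩ := hS _ hk
    rw [← es] at S1 S2 S3
    rw [← ed] at D1 D2 D3
    have hsm : Small st := by
      refine ⟨?_, ?_, ?_⟩
      · rw [S1, D1, en]
        exact ⟨Fin.is_lt _, Fin.is_lt _⟩
      · rw [S2, D2, en]
        exact ⟨Fin.is_lt _, Fin.is_lt _⟩
      · rw [S3, D3, en]
        exact ⟨Fin.is_lt _, Fin.is_lt _⟩
    have o1 : (stepBlock ;; pairBlock).Ok B V st :=
      relax_ok hb hsm (by rwa [en]) fun v => by have := g4 v; omega
    have f1 := stepBlock.frame_run st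
    have r1 := stepBlock_run st
    have r2 := pairBlock_run (stepBlock.run st)
    set st₁ := stepBlock.run st with hst₁
    have f := (stepBlock ;; pairBlock).frame_run st
    set st₂ := (stepBlock ;; pairBlock).run st with hst₂
    change (Marked st₁ → st₂.arr .grade = _ ∧ st₂.reg .best = _) ∧
      (¬ Marked st₁ → st₂.arr .grade = _ ∧ st₂.reg .best = _) at r2
    have fm := f.reg .m (by decide)
    have fc := f.reg .c (by decide)
    have fi := f.reg .i (by decide)
    have fj := f.reg .j (by decide)
    have fk := f.reg .k (by decide)
    have hMk : Marked st₁ ↔ R T[st.reg .j].1 T[st.reg .k].1 := by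
      rw [hR _ _ (hT.stay_origin _ (List.getElem_mem hj)) (hT.stay_origin _ (List.getElem_mem hk))]
      unfold Marked
      rw [f1.reg .j (by decide), f1.reg .k (by decide), f1.reg .n (by decide),
        f1.arr .src (by decide), f1.arr .rmark (by decide), S2, S3, en, er, Ne, Ne, Fin.val_inj]
    rw [f1.reg .j (by decide), f1.reg .k (by decide), f1.reg .best (by decide),
      f1.arr .src (by decide), hMk, S2, S3] at r2
    rw [S2, D2] at r1
    have hup : ∀ (f : ℕ → ℕ) (w : Fin n) (x : ℕ), (fun v : Fin n => Function.update f w x v) =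
        Function.update (fun v : Fin n => f v) w x := by
      intro f w x
      funext v
      simp [Function.update_apply, Fin.ext_iff]
    have hest := g5.relax hT hj hk (g₁ := fun v => st₁.arr .grade v)
      (g₂ := fun v => st₂.arr .grade v) (best' := st₂.reg .best) (by rw [r1, hup])
      (fun h => ⟨by rw [(r2.1 h).1, hup], (r2.1 h).2⟩)
      (fun h => ⟨by rw [(r2.2 h).1], (r2.2 h).2⟩)
    have g4₁ : ∀ v, st₁.arr .grade v ≤ st.reg .best := by
      intro v
      rw [r1, Function.update_apply]
      split_ifs
      · exact max_le (g4 _) (g4 _)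
      · exact g4 v
    have g4₂ : (∀ v, st₂.arr .grade v ≤ st₂.reg .best) ∧ st₂.reg .best ≤ st.reg .best + 1 := by
      by_cases hRp : R T[st.reg .j].1 T[st.reg .k].1
      · obtain ⟨q1, q2⟩ := r2.1 hRp
        rw [q1, q2]
        refine ⟨fun v => ?_, max_le (by omega) (Nat.succ_le_succ (g4₁ _))⟩
        rw [Function.update_apply]
        split_ifs
        · exact max_le_max (g4₁ _) le_rfl
        · exact le_max_of_le_left (g4₁ v)
      · obtain ⟨q1, q2⟩ := r2.2 hRp
        rw [q1, q2]
        exact ⟨g4₁, by omega⟩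
    have g2' : Digits st₂ := by
      unfold Digits
      rw [fm, fc, fi, fj, fk]
      exact g2
    have hlt2 : st₂.reg .c < st₂.reg .m * st₂.reg .m * st₂.reg .m := by
      rw [fm, fc, em]
      exact hlt'
    obtain ⟨a1, a2⟩ := advance_digits hlt2 g2'
    have fa := advance.frame_run st₂
    have fag : (advance.run st₂).arr .grade = st₂.arr .grade := fa.arr _ (by decide)
    have fab : (advance.run st₂).reg .best = st₂.reg .best := fa.reg _ (by decide)
    have fam : (advance.run st₂).reg .m = T.length := by rw [fa.reg _ (by decide), fm, em]
    refine ⟨⟨o1, advance_ok (o1.bdd hb) g2' hlt2 (by rw [fm, em]; omega)⟩, m - 1, by omega, ?_, a1,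
      ?_, ?_, ?_⟩
    · change m - 1 + (advance.run st₂).reg .c = _
      rw [a2, fc]
      omega
    · change (advance.run st₂).reg .best ≤ (advance.run st₂).reg .c
      rw [a2, fc, fab]
      omega
    · change ∀ v, (advance.run st₂).arr .grade v ≤ (advance.run st₂).reg .best
      rw [fag, fab]
      exact g4₂.1
    · change Estimate A T R gr ((advance.run st₂).reg .i)
        ((advance.run st₂).reg .j * T.length + (advance.run st₂).reg .k)
        (fun v => (advance.run st₂).arr .grade v) ((advance.run st₂).reg .best)
      rw [fag, fab]
      have hsplit := advance_split hlt2 g2'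
      rw [fi, fj, fk, fm, em] at hsplit
      rcases hsplit with ⟨e1, e2⟩ | ⟨e1, e2, e3⟩
      · rw [e1, e2]
        exact hest
      · rw [e1, e2]
        rw [e3] at hest
        exact hest.next_round hT hRT hgr hi
  · refine ⟨by omega, ⟨?_, fun h => ?_⟩, by omega, fun v => by rw [hgrade]; omega, ?_⟩
    · simp [hc, hi, hj, hk]
    · omega
    · rw [hi, hj, hk, hbest, Nat.zero_mul]
      simp only [hgrade]
      exact .init hT (fun p q h => (hRT p q h).2) hgr

end RAM

/-! ### The program -/

theorem List.getElem?_flatMap_mul {α β : Type*} {f : α → List β} {c : ℕ}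
    (hf : ∀ a, (f a).length = c) (l : List α) (e : ℕ) {r : ℕ} (hr : r < c) :
    (l.flatMap f)[c * e + r]? = l[e]?.bind fun a => (f a)[r]? := by
  induction l generalizing e with
  | nil => simp
  | cons a l ih =>
    rw [List.flatMap_cons]
    cases e with
    | zero => rw [List.getElem?_append_left (by simp [hf, hr])]; simp
    | succ e =>
      rw [List.getElem?_append_right (by rw [hf, Nat.mul_succ]; omega), hf,
        show c * (e + 1) + r - c = c * e + r by rw [Nat.mul_succ]; omega, ih]
      simp

namespace εNFA

variable {n k : ℕ} {A : εNFA (Fin k) (Fin n)}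

/-- The cycles at `p` and `q` contain a letter, so a transition starts at each of these states.
States without transitions need not be examined. -/
theorem SyncPair.mem_stays {T : List (Fin n × Option (Fin k) × Fin n)} (hT : StayList A T)
    {t : ℕ} {p q : Fin n} (h : A.SyncPair t p q) : (p, none, p) ∈ T ∧ (q, none, q) ∈ T := by
  have key : ∀ {p π}, A.TransPath p π p → TailLength π t → (p, none, p) ∈ T := by
    rintro p π hπ ⟨κ, e, τ, rfl, -⟩
    cases hκ : κ ++ e :: τ with
    | nil => simp at hκ
    | cons e' π =>
      rw [hκ] at hπ
      cases hπ with
      | cons hs _ => exact hT.stay_origin _ (hT.step _ _ _ hs)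
  obtain ⟨-, π₁, π₂, π₃, h₁, -, h₃, -, -, t₁, -, t₃⟩ := h
  exact ⟨key h₁ t₁, key h₃ t₃⟩

theorem holds_stays {l : List (Fin n × Option (Fin k) × Fin n)} {st : RAM.Store}
    (hc : ∀ e < l.length, RAM.Copied st e)
    (hi : ∀ e (h : e < l.length), st.inp (3 * e + 3) = l[e].1 ∧
      st.inp (3 * e + 4) = encodeLabel l[e].2.1 ∧ st.inp (3 * e + 5) = l[e].2.2) :
    Holds (stays l) (st.arr .src) (st.arr .lab) (st.arr .dst) := by
  intro i h
  rw [length_stays] at h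
  have he : i / 3 < l.length := by omega
  obtain ⟨⟨a1, a2, a3⟩, ⟨b1, b2, b3⟩, ⟨c1, c2, c3⟩⟩ := hc _ he
  obtain ⟨i1, i2, i3⟩ := hi _ he
  have hget := List.getElem?_flatMap_mul (f := fun e : Fin n × Option (Fin k) × Fin n =>
    [e, (e.1, none, e.1), (e.2.2, none, e.2.2)]) (c := 3) (fun _ => rfl) l (i / 3)
    (Nat.mod_lt i (by omega))
  change (stays l)[3 * (i / 3) + i % 3]? = _ at hget
  rw [Nat.div_add_mod, List.getElem?_eq_getElem (by rwa [length_stays]),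
    List.getElem?_eq_getElem he] at hget
  have hlt : i % 3 < 3 := Nat.mod_lt i (by omega)
  have hdm := Nat.div_add_mod i 3
  obtain h0 | h0 | h0 : i % 3 = 0 ∨ i % 3 = 1 ∨ i % 3 = 2 := by omega
  · rw [h0] at hget hdm
    have : (stays l)[i]'(by rwa [length_stays]) = l[i / 3] := by simpa using hget
    rw [this, ← i1, ← i2, ← i3, ← a1, ← a2, ← a3, ← add_zero (3 * (i / 3)), hdm]
    exact ⟨rfl, rfl, rfl⟩
  · rw [h0] at hget hdm
    have : (stays l)[i]'(by rwa [length_stays]) = (l[i / 3].1, none, l[i / 3].1) := by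
      simpa using hget
    rw [hdm] at b1 b2 b3
    rw [this, b1, b2, b3, i1]
    exact ⟨rfl, rfl, rfl⟩
  · rw [h0] at hget hdm
    have : (stays l)[i]'(by rwa [length_stays]) = (l[i / 3].2.2, none, l[i / 3].2.2) := by
      simpa using hget
    rw [hdm] at c1 c2 c3
    rw [this, c1, c2, c3, i3]
    exact ⟨rfl, rfl, rfl⟩

end εNFA

namespace RAM

def readBlock : Block :=
  .set .n (.inp (.const 0)) ;; .set .E (.inp (.const 2)) ;; .set .m (.mul (.const 3) (.var .E))

def rewindBlock : Block := .set .c (.const 0)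

def rootsBlock : Block := .set .ri (.var .M)

def reverseBlock : Block :=
  .set .ri (.var .oc) ;; .set .sp (.const 0) ;; .set .oc (.const 0)

def resetBlock : Block :=
  .set .c (.const 0) ;; .set .i (.const 0) ;; .set .j (.const 0) ;; .set .k (.const 0)

def forwardCode : Code := dfsCode .hd .nx .tg .mark .out .rtg

def backwardCode : Code := dfsCode .rhd .rnx .rtg .rmark .rout .out

def buildPhase : Code :=
  .seq (.block readBlock) (.seq copyCode (.seq (.block rewindBlock) buildCode))

def searchPhase : Code :=
  .seq (.block rootsBlock) (.seq forwardCode (.seq (.block reverseBlock) backwardCode))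

def relaxPhase : Code := .seq (.block resetBlock) relaxCode

def mainCode : Code := .seq buildPhase (.seq searchPhase relaxPhase)

/-- Bounds for the times of the three phases, for `E` transitions. -/
def buildTime (E : ℕ) : ℕ :=
  readBlock.cost + ((E + 1) * (copyBlock.cost + 5) + (rewindBlock.cost +
    (27 * E ^ 3 + 1) * ((edgesBlock ;; advance).cost + 11)))

def searchTime (E : ℕ) : ℕ :=
  rootsBlock.cost + ((2 * (162 * E ^ 3) + 1) * dfsCost .hd .nx .tg .mark .out .rtg +
    (reverseBlock.cost + (2 * (243 * E ^ 3) + 1) * dfsCost .rhd .rnx .rtg .rmark .rout .out))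

def relaxTime (E : ℕ) : ℕ :=
  resetBlock.cost + (27 * E ^ 3 + 1) * (((stepBlock ;; pairBlock) ;; advance).cost + 11)

open εNFA

variable {B V W n k : ℕ} {A : εNFA (Fin k) (Fin n)}
  {T l : List (Fin n × Option (Fin k) × Fin n)}

/-- The product graph of the list `T` has been built. -/
structure Built (T : List (Fin n × Option (Fin k) × Fin n)) (G : List (ℕ × ℕ)) (st : Store) :
    Prop where
  size : st.reg .n = n
  count : st.reg .m = T.length
  reg : ∀ v ∈ [Var.sp, .oc, .best], st.reg v = 0
  arr : ∀ a ∈ [Arr.mark, .rmark, .grade], ∀ i, st.arr a i = 0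
  holds : Holds T (st.arr .src) (st.arr .lab) (st.arr .dst)
  graph : HoldsGraph st G
  edges : ProductGraph n T.length (st.arr .src) (st.arr .lab) (st.arr .dst) G

theorem buildPhase_runs (hBV : B ≤ V) (hW : buildPhase.bd V ≤ W)
    {st₀ : Store} (hst : st₀.Bdd V) (hreg : ∀ v, st₀.reg v = 0) (harr : ∀ a i, st₀.arr a i = 0)
    (hn : st₀.inp 0 = n) (hE : st₀.inp 2 = l.length)
    (hi : ∀ e (h : e < l.length), st₀.inp (3 * e + 3) = l[e].1 ∧
      st₀.inp (3 * e + 4) = encodeLabel l[e].2.1 ∧ st₀.inp (3 * e + 5) = l[e].2.2)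
    (hB : 3 * l.length + 3 ≤ B) (hV : 2 * n ^ 3 ≤ V) (hVE : 243 * l.length ^ 3 < V) :
    buildPhase.Runs B V W st₀ (buildTime l.length)
      (fun st' => ∃ G : List (ℕ × ℕ), G.length = 81 * l.length ^ 3 ∧ Built (stays l) G st') := by
  have hm3 : 3 * l.length * (3 * l.length) * (3 * l.length) = 27 * l.length ^ 3 := by ring
  simp only [buildPhase, Code.bd] at hW
  refine (Code.Runs.block hBV (by omega) hst (Q := fun st => st = readBlock.run st₀) ?_ rfl).seq ?_
  · have h1 := hst.inp 0
    have h2 := hst.inp 2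
    simp [readBlock, Block.Ok, Block.run]
    omega
  rintro st₁ hb₁ rfl
  have f₁ := readBlock.frame_run st₀
  have n₁ : (readBlock.run st₀).reg .n = n := by simp [readBlock, Block.run, hn]
  have E₁ : (readBlock.run st₀).reg .E = l.length := by simp [readBlock, Block.run, hE]
  have m₁ : (readBlock.run st₀).reg .m = 3 * l.length := by simp [readBlock, Block.run, hE]
  have a₁ : ∀ a i, (readBlock.run st₀).arr a i = 0 := fun a i => by
    rw [f₁.arr a (by simp [readBlock, Block.arrs]), harr]
  have z₁ : ∀ v, v ∉ readBlock.vars → (readBlock.run st₀).reg v = 0 := fun v hv => by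
    rw [f₁.reg v hv, hreg]
  have i₁ : (readBlock.run st₀).inp = st₀.inp := f₁.inp
  clear f₁
  generalize readBlock.run st₀ = st₁ at *
  have r₂ := copyCode_runs (W := W) hBV (by omega) hb₁ (z₁ .c (by decide)) (by rw [E₁]; exact hB)
  rw [E₁] at r₂
  refine r₂.seq ?_
  rintro st₂ hb₂ ⟨f₂, c₂⟩
  have hS₂ : Holds (stays l) (st₂.arr .src) (st₂.arr .lab) (st₂.arr .dst) :=
    holds_stays c₂ (by rw [f₂.inp, i₁]; exact hi)
  refine (Code.Runs.block hBV (by omega) hb₂ (Q := fun st => st = rewindBlock.run st₂)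
    (by simp [rewindBlock, Block.Ok]) rfl).seq ?_
  rintro st₃ hb₃ rfl
  have f₃ := rewindBlock.frame_run st₂
  have n₃ : (rewindBlock.run st₂).reg .n = n := by
    rw [f₃.reg _ (by decide), f₂.reg _ (by decide), n₁]
  have m₃ : (rewindBlock.run st₂).reg .m = 3 * l.length := by
    rw [f₃.reg _ (by decide), f₂.reg _ (by decide), m₁]
  have c₃ : (rewindBlock.run st₂).reg .c = 0 := by simp [rewindBlock, Block.run]
  have z₃ : ∀ v ∈ [Var.i, .j, .k, .M, .sp, .oc, .best], (rewindBlock.run st₂).reg v = 0 := by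
    intro v hv
    have h : ∀ v ∈ [Var.i, .j, .k, .M, .sp, .oc, .best], v ∉ rewindBlock.vars ∧
      v ∉ copyBlock.vars ∧ v ∉ readBlock.vars := by decide
    obtain ⟨h1, h2, h3⟩ := h v hv
    rw [f₃.reg _ h1, f₂.reg _ h2, z₁ _ h3]
  have a₃ : ∀ a, a ∉ copyBlock.arrs → ∀ i, (rewindBlock.run st₂).arr a i = 0 := fun a ha i => by
    rw [f₃.arr a (by simp [rewindBlock, Block.arrs]), f₂.arr _ ha, a₁]
  have hS₃ : Holds (stays l) ((rewindBlock.run st₂).arr .src) ((rewindBlock.run st₂).arr .lab)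
    ((rewindBlock.run st₂).arr .dst) := hS₂
  clear f₃ f₂ hS₂ c₂ z₁ a₁
  generalize rewindBlock.run st₂ = st₃ at *
  have hSD : ∀ t < 3 * l.length, st₃.arr .src t < n ∧ st₃.arr .dst t < n := by
    intro t ht
    obtain ⟨h1, -, h3⟩ := hS₃ t (by rwa [length_stays])
    rw [h1, h3]
    exact ⟨Fin.is_lt _, Fin.is_lt _⟩
  have r₄ := buildCode_runs (W := W) hBV (by omega) hb₃ c₃ (z₃ _ (by decide)) (z₃ _ (by decide))
    (z₃ _ (by decide)) (z₃ _ (by decide)) (a₃ _ (by decide)) (a₃ _ (by decide))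
    (by rwa [m₃, n₃]) (by rwa [n₃]) (by rw [m₃, hm3]; omega)
  rw [m₃, n₃, hm3] at r₄
  intro s hR
  obtain ⟨t, s', st₄, h1, h2, h3, h4, f₄, G, hG, hGl, hPG⟩ := r₄ s hR
  have es := f₄.arr .src (by decide)
  have el := f₄.arr .lab (by decide)
  have ed := f₄.arr .dst (by decide)
  refine ⟨t, s', st₄, h1, h2, h3, h4, G, by omega, ?_, ?_, fun v hv => ?_, fun a ha i => ?_,
    ?_, hG, ?_⟩
  · rw [f₄.reg _ (by decide), n₃]
  · rw [f₄.reg _ (by decide), m₃, length_stays]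
  · have h : ∀ v ∈ [Var.sp, .oc, .best], v ∉ (edgesBlock ;; advance).vars ∧
      v ∈ [Var.i, .j, .k, .M, .sp, .oc, .best] := by decide
    rw [f₄.reg _ (h v hv).1, z₃ _ (h v hv).2]
  · have h : ∀ a ∈ [Arr.mark, .rmark, .grade], a ∉ (edgesBlock ;; advance).arrs ∧
      a ∉ copyBlock.arrs := by decide
    rw [f₄.arr _ (h a ha).1, a₃ _ (h a ha).2]
  · rwa [es, el, ed]
  · rwa [es, el, ed, length_stays]

/-- The strongly connected components of the product graph have been computed. -/
structure Searched (T : List (Fin n × Option (Fin k) × Fin n)) (G : List (ℕ × ℕ)) (st : Store) :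
    Prop where
  size : st.reg .n = n
  count : st.reg .m = T.length
  best : st.reg .best = 0
  grade : ∀ i, st.arr .grade i = 0
  holds : Holds T (st.arr .src) (st.arr .lab) (st.arr .dst)
  edges : ProductGraph n T.length (st.arr .src) (st.arr .lab) (st.arr .dst) G
  marks : ∀ u ∈ G.map Prod.fst, ∀ v ∈ G.map Prod.fst,
    st.arr .rmark u = st.arr .rmark v ↔ DFS.Scc G u v

theorem searchPhase_runs (hBV : B ≤ V) (hW : searchPhase.bd V ≤ W) {st₀ : Store}
    (hst : st₀.Bdd V) {G : List (ℕ × ℕ)} (h : Built T G st₀) {E : ℕ} (hGl : G.length = 81 * E ^ 3)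
    (hV : 2 * n ^ 3 ≤ V) (hVE : 243 * E ^ 3 < V) :
    searchPhase.Runs B V W st₀ (searchTime E) (Searched T G) := by
  simp only [searchPhase, Code.bd] at hW
  have hSD : ∀ t < T.length, st₀.arr .src t < n ∧ st₀.arr .dst t < n := by
    intro t ht
    obtain ⟨h1, -, h3⟩ := h.holds t ht
    rw [h1, h3]
    exact ⟨Fin.is_lt _, Fin.is_lt _⟩
  have hGlt : ∀ e ∈ G, e.1 < 2 * n ^ 3 ∧ e.2 < 2 * n ^ 3 := by
    intro e he
    obtain ⟨i, hi, j, hj, k', hk, he⟩ := (h.edges e).1 he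
    exact edgesAt_lt hSD hi hj hk e he
  have hGswap : ∀ e ∈ G.map Prod.swap, e.1 < 2 * n ^ 3 ∧ e.2 < 2 * n ^ 3 := by
    intro e he
    obtain ⟨e', he', rfl⟩ := List.mem_map.1 he
    exact (hGlt e' he').symm
  have hroots : ∀ r ∈ G.map Prod.fst, r < 2 * n ^ 3 := by
    intro r hr
    obtain ⟨e, he, rfl⟩ := List.mem_map.1 hr
    exact (hGlt e he).1
  refine (Code.Runs.block hBV (by omega) hst (Q := fun st => st = rootsBlock.run st₀)
    (by simpa [rootsBlock, Block.Ok] using hst.reg .M) rfl).seq ?_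
  rintro st₁ hb₁ rfl
  have f₁ := rootsBlock.frame_run st₀
  have ri₁ : (rootsBlock.run st₀).reg .ri = G.length := by
    simp [rootsBlock, Block.run, h.graph.length]
  have ha₁ : (rootsBlock.run st₀).arr = st₀.arr := rfl
  have roots₁ : downList ((rootsBlock.run st₀).arr .rtg) ((rootsBlock.run st₀).reg .ri) =
      G.map Prod.fst := by
    rw [ri₁, ha₁, ← h.graph.length]
    exact h.graph.origins
  generalize rootsBlock.run st₀ = st₁ at *
  -- The `81 * E ^ 3` edge origins are the roots, and there are as many edges.
  have r₂ := dfsCode_runs (W := W) (Z := 162 * E ^ 3) hBV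
    (hd := .hd) (nx := .nx) (tg := .tg) (mk := .mark) (out := .out) (R := .rtg) (by decide)
    (by simp only [forwardCode] at hW; omega) hb₁ hGlt hV (by rw [ha₁]; exact h.graph.fwd)
    (by rw [ha₁]; exact h.arr _ (by decide))
    (by rw [f₁.reg _ (by decide)]; exact h.reg _ (by decide))
    (by rw [f₁.reg _ (by decide)]; exact h.reg _ (by decide)) (by rwa [roots₁])
    (by rw [ri₁, hGl]; omega) (by omega)
  rw [roots₁] at r₂
  refine r₂.seq ?_
  rintro st₂ hb₂ ⟨f₂, oc₂, s₂, inv₂, stack₂, out₂, -⟩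
  obtain ⟨hfin, hmem⟩ := inv₂.finishOrder stack₂
  have hL : ∀ v ∈ s₂.out, v < 2 * n ^ 3 := fun v hv =>
    inv₂.lt_of_mark hGlt hroots ((inv₂.mark_iff v).2 (Or.inr hv))
  refine (Code.Runs.block hBV (by omega) hb₂ (Q := fun st => st = reverseBlock.run st₂)
    (by simpa [reverseBlock, Block.Ok] using hb₂.reg .oc) rfl).seq ?_
  rintro st₃ hb₃ rfl
  have f₃ := reverseBlock.frame_run st₂
  have ha₃ : (reverseBlock.run st₂).arr = st₂.arr := rfl
  have ri₃ : (reverseBlock.run st₂).reg .ri = st₂.reg .oc := by simp [reverseBlock, Block.run]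
  have sp₃ : (reverseBlock.run st₂).reg .sp = 0 := by simp [reverseBlock, Block.run]
  have oc₃ : (reverseBlock.run st₂).reg .oc = 0 := by simp [reverseBlock, Block.run]
  have roots₃ : downList ((reverseBlock.run st₂).arr .out) ((reverseBlock.run st₂).reg .ri) =
      s₂.out := by
    rw [ri₃, ha₃, out₂]
  generalize reverseBlock.run st₂ = st₃ at *
  -- The roots are the at most `162 * E ^ 3` finished vertices of the first search, and there are
  -- again `81 * E ^ 3` edges.
  have r₄ := dfsCode_runs (W := W) (Z := 243 * E ^ 3) (M := st₀.reg .M) hBV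
    (hd := .rhd) (nx := .rnx) (tg := .rtg) (mk := .rmark) (out := .rout) (R := .out) (by decide)
    (by simp only [backwardCode] at hW; omega) hb₃ hGswap hV
    (by
      rw [ha₃, f₂.arr _ (by decide), f₂.arr _ (by decide), f₂.arr _ (by decide), ha₁]
      exact h.graph.bwd)
    (by rw [ha₃, f₂.arr _ (by decide), ha₁]; exact h.arr _ (by decide)) sp₃ oc₃ (by rwa [roots₃])
    (by rw [ri₃, List.length_map, hGl]; omega) hVE
  rw [roots₃] at r₄
  intro s hR
  obtain ⟨t, s', st₄, h1, h2, h3, h4, f₄, -, s₄, inv₄, stack₄, -, mark₄⟩ := r₄ s hR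
  have reg₄ : ∀ v ∈ [Var.n, .m, .best], st₄.reg v = st₀.reg v := by
    intro v hv
    have hv' : ∀ v ∈ [Var.n, .m, .best], v ∉ rootsBlock.vars ∧ v ∉ reverseBlock.vars ∧
      v ∉ (dfsBlock .hd .nx .tg .mark .out .rtg).vars ∧
      v ∉ (dfsBlock .rhd .rnx .rtg .rmark .rout .out).vars := by decide
    obtain ⟨g1, g2, g3, g4⟩ := hv' v hv
    rw [f₄.reg _ g4, f₃.reg _ g2, f₂.reg _ g3, f₁.reg _ g1]
  have arr₄ : ∀ a ∈ [Arr.src, .lab, .dst, .grade], st₄.arr a = st₀.arr a := by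
    intro a ha
    have ha' : ∀ a ∈ [Arr.src, .lab, .dst, .grade],
      a ∉ (dfsBlock .hd .nx .tg .mark .out .rtg).arrs ∧
      a ∉ (dfsBlock .rhd .rnx .rtg .rmark .rout .out).arrs := by decide
    obtain ⟨g1, g2⟩ := ha' a ha
    rw [f₄.arr _ g2, ha₃, f₂.arr _ g1, ha₁]
  have es := arr₄ .src (by decide)
  have el := arr₄ .lab (by decide)
  have ed := arr₄ .dst (by decide)
  refine ⟨t, s', st₄, h1, h2, h3, h4, ?_, ?_, ?_, ?_, ?_, ?_, fun u hu v hv => ?_⟩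
  · rw [reg₄ _ (by decide), h.size]
  · rw [reg₄ _ (by decide), h.count]
  · rw [reg₄ _ (by decide), h.reg _ (by decide)]
  · rw [arr₄ _ (by decide)]
    exact h.arr _ (by decide)
  · rw [es, el, ed]
    exact h.holds
  · rw [es, el, ed]
    exact h.edges
  · rw [← mark₄]
    exact inv₄.mark_eq_iff hfin stack₄ (hmem u hu) (hmem v hv)

theorem relaxPhase_runs (hT : StayList A T) {gr : Fin n → ℕ} (hgr : Grades A (A.SyncPair 0) gr)
    (hBV : B ≤ V) (hW : relaxPhase.bd V ≤ W) {st₀ : Store} (hst : st₀.Bdd V) {G : List (ℕ × ℕ)}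
    (h : Searched T G st₀) {E : ℕ} (hE : T.length = 3 * E) (hV : 2 * n ^ 3 ≤ V)
    (hVE : 243 * E ^ 3 < V) :
    relaxPhase.Runs B V W st₀ (relaxTime E)
      (fun st' => (st'.reg .best = 0 ∨ ∃ q, EndWalk A (A.SyncPair 0) q (st'.reg .best)) ∧
        ∀ q d, EndWalk A (A.SyncPair 0) q d → d ≤ st'.reg .best) := by
  have hm3 : T.length * T.length * T.length = 27 * E ^ 3 := by
    rw [hE]
    ring
  simp only [relaxPhase, Code.bd] at hW
  refine (Code.Runs.block hBV (by omega) hst (Q := fun st => st = resetBlock.run st₀)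
    (by simp [resetBlock, Block.Ok]) rfl).seq ?_
  rintro st₁ hb₁ rfl
  have f := resetBlock.frame_run st₀
  have ha : (resetBlock.run st₀).arr = st₀.arr := rfl
  have r := relaxCode_runs (W := W) (R := A.SyncPair 0) hT (fun p q h => h.mem_stays hT) hgr hBV
    (by omega) hb₁ (by simp [resetBlock, Block.run]) (by simp [resetBlock, Block.run])
    (by simp [resetBlock, Block.run]) (by simp [resetBlock, Block.run])
    (by rw [f.reg _ (by decide), h.best]) (by rw [ha]; exact h.grade)
    (by rw [f.reg _ (by decide), h.size]) (by rw [f.reg _ (by decide), h.count])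
    (by rw [ha]; exact h.holds) ?_ hV (by omega)
  · rwa [hm3] at r
  · intro p q hp hq
    -- The vertices compared in the test are origins of edges, so both searches have visited them
    -- and their marks are meaningful.
    have key : ∀ {x y z : Fin n}, (x, none, x) ∈ T → (y, none, y) ∈ T → (z, none, z) ∈ T →
        nodeCode n x y z 0 ∈ G.map Prod.fst := by
      intro x y z hx hy hz
      obtain ⟨i, hi, hxi⟩ := List.getElem_of_mem hx
      obtain ⟨j, hj, hyj⟩ := List.getElem_of_mem hy
      obtain ⟨k', hk, hzk⟩ := List.getElem_of_mem hz
      have h1 := (h.holds i hi).1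
      have h2 := (h.holds j hj).1
      have h3 := (h.holds k' hk).1
      rw [hxi] at h1
      rw [hyj] at h2
      rw [hzk] at h3
      refine List.mem_map.2 ⟨(nodeCode n x y z 0, edgeTarget n (st₀.arr .src) (st₀.arr .lab)
        (st₀.arr .dst) i j k'), (h.edges _).2 ⟨i, hi, j, hj, k', hk, ?_⟩, rfl⟩
      simp [edgesAt, h1, h2, h3]
    rw [ha, h.marks _ (key hp hp hq) _ (key hp hq hq)]
    constructor
    · exact fun h' => ⟨h'.1, (scc_iff_syncPair hT h.holds h.edges hp hq h'.1).2 h'⟩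
    · exact fun h' => (scc_iff_syncPair hT h.holds h.edges hp hq h'.1).1 h'.2

theorem mainCode_runs (hl : ∀ e, e ∈ l ↔ e ∈ A.transitions)
    {gr : Fin n → ℕ} (hgr : Grades A (A.SyncPair 0) gr) (hBV : B ≤ V) (hW : mainCode.bd V ≤ W)
    {st₀ : Store} (hst : st₀.Bdd V) (hreg : ∀ v, st₀.reg v = 0) (harr : ∀ a i, st₀.arr a i = 0)
    (hn : st₀.inp 0 = n) (hE : st₀.inp 2 = l.length)
    (hi : ∀ e (h : e < l.length), st₀.inp (3 * e + 3) = l[e].1 ∧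
      st₀.inp (3 * e + 4) = encodeLabel l[e].2.1 ∧ st₀.inp (3 * e + 5) = l[e].2.2)
    (hB : 3 * l.length + 3 ≤ B) (hV : 2 * n ^ 3 ≤ V) (hVE : 243 * l.length ^ 3 < V) :
    mainCode.Runs B V W st₀
      (buildTime l.length + (searchTime l.length + relaxTime l.length))
      (fun st' => (st'.reg .best = 0 ∨ ∃ q, EndWalk A (A.SyncPair 0) q (st'.reg .best)) ∧
        ∀ q d, EndWalk A (A.SyncPair 0) q d → d ≤ st'.reg .best) := by
  simp only [mainCode, Code.bd] at hW
  refine (buildPhase_runs hBV (by omega) hst hreg harr hn hE hi hB hV hVE).seq ?_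
  rintro st₁ hb₁ ⟨G, hGl, h₁⟩
  refine (searchPhase_runs hBV (by omega) hb₁ h₁ hGl hV hVE).seq ?_
  intro st₂ hb₂ h₂
  exact relaxPhase_runs (stayList_stays hl) hgr hBV (by omega) hb₂ h₂ (length_stays l) hV hVE

end RAM

/-! ### The encoding of the automaton -/

namespace εNFA

variable {n k : ℕ} (A : εNFA (Fin k) (Fin n)) (l : List (Fin n × Option (Fin k) × Fin n))

theorem length_encode : (A.encode l).length = 3 * l.length + 3 + n + n := by
  simp [encode]
  omega

theorem encode_getD_zero : (A.encode l).getD 0 0 = n := by simp [encode]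

theorem encode_getD_two : (A.encode l).getD 2 0 = l.length := by simp [encode]

theorem encode_getD_transition (e : ℕ) (h : e < l.length) :
    (A.encode l).getD (3 * e + 3) 0 = l[e].1 ∧
    (A.encode l).getD (3 * e + 4) 0 = encodeLabel l[e].2.1 ∧
    (A.encode l).getD (3 * e + 5) 0 = l[e].2.2 := by
  classical
  have key : ∀ r < 3, (A.encode l)[3 * e + r + 3]? =
      [(l[e].1 : ℕ), encodeLabel l[e].2.1, (l[e].2.2 : ℕ)][r]? := by
    intro r hr
    have h1 : A.encode l = n :: k :: l.length ::
        (l.flatMap (fun e => [(e.1 : ℕ), encodeLabel e.2.1, (e.2.2 : ℕ)]) ++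
          ((List.finRange n).map (fun q => if q ∈ A.start then 1 else 0) ++
          (List.finRange n).map (fun q => if q ∈ A.accept then 1 else 0))) := by
      simp [encode]
    rw [h1, List.getElem?_cons_succ, List.getElem?_cons_succ, List.getElem?_cons_succ,
      List.getElem?_append_left (by simp; omega),
      List.getElem?_flatMap_mul (c := 3) (fun _ => rfl) l e hr, List.getElem?_eq_getElem h]
    rfl
  have k0 := key 0 (by omega)
  have k1 := key 1 (by omega)
  have k2 := key 2 (by omega)
  rw [show 3 * e + 1 + 3 = 3 * e + 4 by ring] at k1
  rw [show 3 * e + 2 + 3 = 3 * e + 5 by ring] at k2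
  simp only [add_zero] at k0
  simp [List.getD_eq_getElem?_getD, k0, k1, k2]

theorem encode_getD_le (i : ℕ) : (A.encode l).getD i 0 ≤ n + k + l.length + 1 := by
  classical
  have hmem : ∀ x ∈ A.encode l, x ≤ n + k + l.length + 1 := by
    intro x hx
    simp only [encode, List.mem_append, List.mem_cons, List.not_mem_nil, or_false,
      List.mem_flatMap, List.mem_map] at hx
    rcases hx with ((((rfl | rfl | rfl) | ⟨e, -, rfl | rfl | rfl⟩) | ⟨q, -, rfl⟩) | ⟨q, -, rfl⟩)
    · omega
    · omega
    · omega
    · have := e.1.2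
      omega
    · have := encodeLabel_le e.2.1
      omega
    · have := e.2.2.2
      omega
    · split_ifs <;> omega
    · split_ifs <;> omega
  rw [List.getD_eq_getElem?_getD]
  cases h : (A.encode l)[i]? with
  | none => simp
  | some x => exact hmem x (List.mem_of_getElem? h)

end εNFA

/-! ### The start of the program and the total time -/

namespace RAM

/-- The length of the input is computed in the register `39`. -/
def preamble : Prog :=
  -- Register `40` is still zero, so the first load reads cell `0`, the number of states.
  .seq (.load 41 40) (.seq (.const 42 2) (.seq (.load 43 42) (.seq (.const 42 3)
    (.seq (.mul 43 43 42) (.seq (.add 43 43 42) (.seq (.add 43 43 41) (.add 39 43 41)))))))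

theorem exec_preamble {W n E : ℕ} {input : List ℕ} (hn : input.getD 0 0 = n)
    (hE : input.getD 2 0 = E) (hl : input.length = 3 * E + 3 + n + n)
    (hW : 3 * E + 3 + n + n ≤ W) :
    ∃ s, Exec W preamble (initState input) 8 s ∧
      Rel (3 * E + 3 + n + n) s ⟨fun _ => 0, fun _ _ => 0, fun i => input.getD i 0⟩ := by
  rw [List.getD_eq_getElem?_getD] at hn hE
  refine ⟨_, .seq (.load _ _ _ ?_ ?_) (.seq (.const _ _ _ ?_) (.seq (.load _ _ _ ?_ ?_)
    (.seq (.const _ _ _ ?_) (.seq (.mul _ _ _ _ ?_) (.seq (.add _ _ _ _ ?_)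
    (.seq (.add _ _ _ _ ?_) (.add _ _ _ _ ?_))))))), fun v => ?_, ?_, fun a i => ?_, fun i _ => ?_⟩
  all_goals try simp only [State.setReg, initState]
  · omega
  · simp [hn]
    omega
  · omega
  · simp
    omega
  · simp [hE]
    omega
  · omega
  · simp [hE]
    omega
  · simp [hE]
    omega
  · simp [hE, hn]
    omega
  · simp [hE, hn]
    omega
  · have := v.idx_lt
    rw [Function.update_of_ne (by omega), Function.update_of_ne (by omega),
      Function.update_of_ne (by omega), Function.update_of_ne (by omega),
      Function.update_of_ne (by omega), Function.update_of_ne (by omega),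
      Function.update_of_ne (by omega), Function.update_of_ne (by omega)]
  · simp [hE, hn]
    omega
  · exact List.getD_eq_default _ _ (by omega)

theorem exists_time_bound : ∃ C, ∀ E,
    8 + (buildTime E + (searchTime E + relaxTime E)) ≤ C * (E ^ 3 + 1) := by
  unfold buildTime searchTime relaxTime
  generalize readBlock.cost = a₁, copyBlock.cost + 5 = a₂, rewindBlock.cost = a₃,
    (edgesBlock ;; advance).cost + 11 = a₄, rootsBlock.cost = a₅, dfsCost .hd _ _ _ _ _ = a₆,
    reverseBlock.cost = a₇, dfsCost .rhd _ _ _ _ _ = a₈, resetBlock.cost = a₉,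
    ((stepBlock ;; pairBlock) ;; advance).cost + 11 = b₁
  refine ⟨8 + a₁ + a₂ + a₃ + 27 * a₄ + a₅ + 324 * a₆ + a₇ + 486 * a₈ + a₉ + 27 * b₁, fun E => ?_⟩
  -- Copying the transitions takes linear time, which the cubic bound absorbs.
  have hE : E ≤ E ^ 3 := Nat.le_self_pow (by omega) E
  generalize E ^ 3 = X at *
  have h2 : (E + 1) * a₂ ≤ (X + 1) * a₂ := Nat.mul_le_mul_right _ (by omega)
  nlinarith [Nat.zero_le (X * a₁), Nat.zero_le (X * a₃), Nat.zero_le (X * a₅),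
    Nat.zero_le (X * a₇), Nat.zero_le (X * a₉), Nat.zero_le a₄, Nat.zero_le a₆, Nat.zero_le a₈,
    Nat.zero_le b₁]

end RAM

/-! ### The theorem -/

theorem mainTheorem3 :
    (∃ (P : RAM.Prog) (C : ℕ), ∀ (n k : ℕ) (A : εNFA (Fin k) (Fin n)),
      A.Trim → A.EpsCycleFree → A.PolyAmbiguous →
      ∀ l : List (Fin n × Option (Fin k) × Fin n),
        l.Nodup → (∀ e, e ∈ l ↔ e ∈ A.transitions) →
        ∃ (t : ℕ) (s : RAM.State),
          RAM.Exec (C * (n + k + A.transitions.ncard + 1) ^ C) P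
            (RAM.initState (A.encode l)) t s ∧
          t ≤ C * (A.transitions.ncard ^ 3 + 1) ∧
          A.dpa = (s.reg 0 : ℕ∞)) ∧
    (∀ (α σ : Type*) [Finite α] [Finite σ] [Nonempty σ] (A : εNFA α σ),
      A.Trim → A.EpsCycleFree → A.PolyAmbiguous →
      ∃ d : ℕ, A.dpa = d ∧
        IsGreatest {m : ℕ | ∃ c c' : A.Component, A.ComponentPath c c' m} d) := by
  refine ⟨?_, fun α σ _ _ _ A hT hM hP => hP.isGreatest_componentPath hT hM⟩
  -- The bound `1000 * N ^ 3` generously covers the vertex numbers below `2 * n ^ 3`, the counters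
  -- up to `243 * |E| ^ 3` and the length of the input.
  have hV : RAM.PolyBounded fun N => 1000 * N ^ 3 := .of_le 1000 3 fun N _ => le_rfl
  obtain ⟨C₁, hC₁⟩ := (hV.code RAM.mainCode).add hV
  obtain ⟨C₂, hC₂⟩ := RAM.exists_time_bound
  refine ⟨.seq RAM.preamble RAM.mainCode.comp, C₁ + C₂, fun n k A hT hM hP l hnd hl => ?_⟩
  have hcard : A.transitions.ncard = l.length := by
    classical
    have : A.transitions = (l.toFinset : Set _) := by
      ext e
      simp [hl]
    rw [this, Set.ncard_coe_finset, List.toFinset_card_of_nodup hnd]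
  rw [hcard]
  obtain ⟨h, hh⟩ := id hP
  -- Polynomial ambiguity enters the correctness of the relaxation here: the weights of walks are
  -- bounded by a degree, so the grades exist.
  obtain ⟨gr, hgr⟩ := εNFA.exists_grades (M := A) (R := A.SyncPair 0) (b := h.natDegree)
    fun v d hw => hw.le_natDegree hT hM hh fun p q hpq => ⟨0, hpq⟩
  set N := n + k + l.length + 1 with hN
  set W := (C₁ + C₂) * N ^ (C₁ + C₂) with hWdef
  have hN1 : 1 ≤ N := by omega
  have hW : RAM.mainCode.bd (1000 * N ^ 3) + 1000 * N ^ 3 ≤ W := (hC₁ N hN1).trans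
    (Nat.mul_le_mul (Nat.le_add_right _ _) (Nat.pow_le_pow_right hN1 (Nat.le_add_right _ _)))
  have hN3 : N ≤ N ^ 3 := Nat.le_self_pow (by omega) N
  have hn3 : n ^ 3 ≤ N ^ 3 := Nat.pow_le_pow_left (by omega) 3
  have hE3 : l.length ^ 3 ≤ N ^ 3 := Nat.pow_le_pow_left (by omega) 3
  obtain ⟨s₁, hex, hrel⟩ := RAM.exec_preamble (W := W) (A.encode_getD_zero l)
    (A.encode_getD_two l) (A.length_encode l) (by omega)
  obtain ⟨t, s₂, st, hex', ht, hrel', -, hbest, hmax⟩ :=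
    RAM.mainCode_runs (B := 3 * l.length + 3 + n + n) (V := 1000 * N ^ 3) (W := W) hl hgr (by omega)
      (by omega) (st₀ := ⟨fun _ => 0, fun _ _ => 0, fun i => (A.encode l).getD i 0⟩)
      ⟨fun _ => Nat.zero_le _, fun _ _ => Nat.zero_le _, fun i => by
        have := A.encode_getD_le l i
        change (A.encode l).getD i 0 ≤ _
        omega⟩ (fun _ => rfl) (fun _ _ => rfl) (A.encode_getD_zero l) (A.encode_getD_two l)
      (A.encode_getD_transition l) (by omega) (by omega) (by omega) s₁ hrel
  refine ⟨8 + t, s₂, .seq hex hex', ?_, ?_⟩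
  · calc 8 + t ≤ C₂ * (l.length ^ 3 + 1) := le_trans (by omega) (hC₂ l.length)
      _ ≤ _ := Nat.mul_le_mul_right _ (Nat.le_add_left _ _)
  · have h0 : s₂.reg 0 = st.reg .best := hrel'.reg .best
    rw [h0]
    -- The program computes with the smallest admissible relation, the pairs without trailing
    -- ε-transitions.
    exact hP.dpa_eq_of_isGreatest hT hM (fun p q h => h) (fun p q h => ⟨0, h⟩) hbest hmax
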